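/- A game arena consists of a finite set $P$ of players, a finite set $V$ of vertices partitioned into sets $(V_p)_{p\in P}$, an initial vertex $v_0\in V$, and an edge relation $\Delta\subseteq V\times V$ in which every vertex has a successor. A play is an infinite path from $v_0$, and a history is a non-empty finite prefix of a play. A strategy of $p$ maps each history ending in some $v\in V_p$ to a $\Delta$-successor of $v$; it is positional if its value depends only on the last vertex. A profile $\boldsymbol{s}=(s_p)_{p\in P}$ of strategies has an outcome $\mathrm{out}(\boldsymbol{s})$, the play in which each player follows her strategy. For a Boolean formula $\varphi$ over $V$, the Muller objective of $\varphi$ is the set of plays $\rho$ such that $\varphi$ is true under the assignment making exactly the vertices visited infinitely often by $\rho$ true. Given an arena and objectives $\boldsymbol{\alpha}=(O_p)_{p\in P}$, an epistemic model over positional strategies is a finite set $W$ of worlds with an equivalence relation $R_p$ on $W$ for each player $p$ and a map $\sigma$ from $W$ to positional profiles such that $w\mathrel{R_p}w'$ implies $\sigma_p(w)=\sigma_p(w')$. Player $p$ is rational in $w$ if she has no positional strategy $s_p$ such that (i) for all $w'$ with $w\mathrel{R_p}w'$, $\mathrm{out}(\sigma(w'))\in O_p$ implies $\mathrm{out}(\sigma(w')[p\mapsto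 s_p])\in O_p$, and (ii) for some $w'$ with $w\mathrel{R_p}w'$, $\mathrm{out}(\sigma(w'))\notin O_p$ and $\mathrm{out}(\sigma(w')[p\mapsto s_p])\in O_p$. Let $\mathrm{RAT}\subseteq W$ be the set of worlds in which all players are rational. For $E\subseteq W$ let $\mathrm{MK}(E)$ be the set of $w$ such that $\{w' : w\mathrel{R_p}w'\}\subseteq E$ for all $p\in P$, and let $\mathrm{CK}(E)=\bigcap_{i\ge 1}\mathrm{MK}^i(E)$. Let $T_{G,\boldsymbol{\alpha},\mathrm{Pos}}$ be the set of positional profiles of the form $\sigma(w)$ for some epistemic model over positional strategies and some world $w\in\mathrm{CK}(\mathrm{RAT})$ of it. The problem $\mathrm{VPCKR}_{\mathrm{Pos}}$ is the language of all (encodings of) triples $\langle G,\boldsymbol{\alpha},O\rangle$, where $G$ is a game arena, each objective in $\boldsymbol{\alpha}$ and the specification $O$ is a Muller objective given by a Boolean formula, and $\mathrm{out}(\boldsymbol{t})\in O$ for every $\boldsymbol{t}\in T_{G,\boldsymbol{\alpha},\mathrm{Pos}}$. **Theorem.** $\mathrm{VPCKR}_{\mathrm{Pos}}$ is in $\mathrm{coNEXP}^{\mathrm{NP}}$: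 there are a language $A\in\mathrm{NP}$ and a nondeterministic oracle Turing machine that, with oracle $A$, decides the complement of $\mathrm{VPCKR}_{\mathrm{Pos}}$ in time $2^{p(n)}$ for some polynomial $p$, where $n$ is the input length. -/

import Mathlib

/-! ### Nondeterministic oracle Turing machines and complexity classes -/

/-- A nondeterministic oracle Turing machine with input alphabet `α` and oracle alphabet `β`.
It is a finite multi-stack machine in the sense of Mathlib's `Turing.TM2` (two stacks make a tape),
with two transition functions between which it chooses freely at each step, a query stack
on which it writes the strings it asks the oracle about, and three labels `ask`, `yes`, `no` for the
oracle calls. -/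
structure OracleNTM (α β : Type) where
  K : Type
  [decEqK : DecidableEq K]
  [fintypeK : Fintype K]
  Γ : K → Type
  [fintypeΓ : ∀ k, Fintype (Γ k)]
  Λ : Type
  [fintypeΛ : Fintype Λ]
  σ : Type
  [fintypeσ : Fintype σ]
  /-- the two transition functions -/
  program : Bool → Λ → Turing.TM2.Stmt Γ Λ σ
  main : Λ
  initialState : σ
  /-- A computation that has halted is accepting if its internal state lies in this set. -/
  accept : Set σ
  inputStack : K
  inputAlphabet : Γ inputStack ≃ α
  queryStack : K
  queryAlphabet : Γ queryStack ≃ β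
  ask : Λ
  yes : Λ
  no : Λ

namespace OracleNTM

variable {α β : Type} (M : OracleNTM α β)

instance : DecidableEq M.K := M.decEqK

abbrev Cfg : Type := Turing.TM2.Cfg M.Γ M.Λ M.σ

/-- The initial configuration: the input stands on the input stack (its first symbol on top) and
all other stacks are empty. -/
def initCfg (x : List α) : M.Cfg where
  l := some M.main
  var := M.initialState
  stk := Function.update (fun _ => []) M.inputStack (x.map M.inputAlphabet.symm)

/-- The string on the query stack, read from the top. -/
def queryString (c : M.Cfg) : List β := (c.stk M.queryStack).map M.queryAlphabet

open Classical in
/-- One step with oracle `A` and nondeterministic choice `b`. In the label `ask` the machine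
moves to `yes` or `no` according to whether the query string is in `A`, in one step; in any other
label it executes the chosen transition function. The value is `none` iff it has halted. -/
noncomputable def step (A : Set (List β)) (b : Bool) (c : M.Cfg) : Option M.Cfg :=
  if c.l = some M.ask then
    some { c with l := some (if M.queryString c ∈ A then M.yes else M.no) }
  else
    Turing.TM2.step (M.program b) c

/-- `M.Run A n c c'`: some computation with oracle `A` leads from `c` to `c'` in exactly `n`
steps. -/
inductive Run (A : Set (List β)) : ℕ → M.Cfg → M.Cfg → Prop
  | refl (c : M.Cfg) : Run A 0 c c
  | cons {n : ℕ} {c c' c'' : M.Cfg} (b : Bool) (h : M.step A b c = some c')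
      (hr : Run A n c' c'') : Run A (n + 1) c c''

/-- `M` with oracle `A` decides the language `L` in time `T`: on each input `x`, every computation
halts after at most `T |x|` steps, and some computation accepts iff `x ∈ L`. -/
def DecidesInTime (A : Set (List β)) (L : Set (List α)) (T : ℕ → ℕ) : Prop :=
  ∀ x : List α,
    (∀ n c, M.Run A n (M.initCfg x) c → n ≤ T x.length) ∧
    (x ∈ L ↔ ∃ n c, M.Run A n (M.initCfg x) c ∧ c.l = none ∧ c.var ∈ M.accept)

end OracleNTM

/-- The class NP (no oracle: the empty one is used). -/
def NPClass (α : Type) : Set (Set (List α)) :=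
  {L | ∃ (M : OracleNTM α Empty) (p : Polynomial ℕ), M.DecidesInTime ∅ L (fun n => p.eval n)}

/-- The class NEXP relative to the oracle `A`, where exponential time means time `2 ^ p(n)` for
a polynomial `p`. The queries are as long as the running time permits. -/
def NEXPRel {β : Type} (A : Set (List β)) (α : Type) : Set (Set (List α)) :=
  {L | ∃ (M : OracleNTM α β) (p : Polynomial ℕ), M.DecidesInTime A L (fun n => 2 ^ p.eval n)}

/-- The class NEXP^NP. -/
def NEXPNP (α : Type) : Set (Set (List α)) :=
  {L | ∃ (β : Type) (A : Set (List β)), A ∈ NPClass β ∧ L ∈ NEXPRel A α}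

/-- The class coNEXP^NP. -/
def coNEXPNP (α : Type) : Set (Set (List α)) := {L | Lᶜ ∈ NEXPNP α}

/-! ### Graph games -/

/-- A game arena with players `P` and vertices `V`. The partition `(V_p)` of the vertices is
given by `owner`: `V_p` consists of the vertices `v` with `owner v = p`. -/
structure GameArena (P V : Type) where
  owner : V → P
  start : V
  edge : V → V → Prop
  exists_edge : ∀ v, ∃ w, edge v w

namespace GameArena

variable {P V : Type} (G : GameArena P V)

def IsPlay (ρ : ℕ → V) : Prop := ρ 0 = G.start ∧ ∀ i, G.edge (ρ i) (ρ (i + 1))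

def Play : Type := {ρ : ℕ → V // G.IsPlay ρ}

/-- A history: a non-empty finite prefix of a play. -/
def Hist : Type :=
  {h : List V // ∃ ρ, G.IsPlay ρ ∧ ∃ n : ℕ, h = (List.range (n + 1)).map ρ}

variable {G}

theorem Hist.ne_nil (h : G.Hist) : h.1 ≠ [] := by
  obtain ⟨h, ρ, -, n, rfl⟩ := h
  simp

/-- The last vertex of a history. -/
def Hist.last (h : G.Hist) : V := h.1.getLast h.ne_nil

theorem exists_play_from (v : V) :
    ∃ τ : ℕ → V, τ 0 = v ∧ ∀ i, G.edge (τ i) (τ (i + 1)) := by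
  choose f hf using G.exists_edge
  refine ⟨fun n => f^[n] v, rfl, fun i => ?_⟩
  simp only [Function.iterate_succ_apply']
  exact hf _

theorem Hist.append_isHist (h : G.Hist) (w : V) (hw : G.edge h.last w) :
    ∃ ρ, G.IsPlay ρ ∧ ∃ n : ℕ, h.1 ++ [w] = (List.range (n + 1)).map ρ := by
  obtain ⟨h, ρ, hρ, n, rfl⟩ := h
  have hl : G.edge (ρ n) w := by simpa [Hist.last, List.range_succ] using hw
  obtain ⟨τ, h0, hτ⟩ := exists_play_from (G := G) w
  refine ⟨fun i => if i ≤ n then ρ i else τ (i - (n + 1)), ⟨by simpa using hρ.1, ?_⟩, n + 1, ?_⟩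
  · intro i
    rcases lt_trichotomy i n with hi | hi | hi
    · simpa [hi.le, Nat.succ_le_of_lt hi] using hρ.2 i
    · subst hi; simpa [h0] using hl
    · have h1 : ¬ i ≤ n := by omega
      have h2 : ¬ i + 1 ≤ n := by omega
      have h3 : i + 1 - (n + 1) = i - (n + 1) + 1 := by omega
      simpa only [h1, h2, if_false, h3] using hτ _
  · rw [List.range_succ (n := n + 1), List.map_append]
    congr 1
    · apply List.map_congr_left
      intro i hi
      have : i ≤ n := by have := List.mem_range.1 hi; omega
      simp [this]
    · simp [h0]

/-- The history `h w` for an edge from the last vertex of `h` to `w`. -/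
def Hist.extend (h : G.Hist) (w : V) (hw : G.edge h.last w) : G.Hist :=
  ⟨h.1 ++ [w], h.append_isHist w hw⟩

theorem Hist.last_extend (h : G.Hist) (w : V) (hw : G.edge h.last w) :
    (h.extend w hw).last = w := by
  simp [Hist.last, Hist.extend]

variable (G)

/-- The history that consists of the initial vertex. -/
def startHist : G.Hist :=
  ⟨[G.start], by
    obtain ⟨τ, h0, hτ⟩ := exists_play_from (G := G) G.start
    exact ⟨τ, ⟨h0, hτ⟩, 0, by simp [h0]⟩⟩

/-- The histories that end in a vertex of player `p`. -/
def HistOf (p : P) : Type := {h : G.Hist // G.owner h.last = p}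

/-- The strategies of player `p`. -/
def Strategy (p : P) : Type :=
  {s : G.HistOf p → V // ∀ h : G.HistOf p, G.edge h.1.last (s h)}

/-- The positional strategies of player `p`: those whose value depends only on the last vertex. -/
def Pos (p : P) : Set (G.Strategy p) :=
  {s | ∀ h h' : G.HistOf p, h.1.last = h'.1.last → s.1 h = s.1 h'}

/-- Strategy profiles. -/
abbrev Profile : Type := ∀ p, G.Strategy p

variable {G}

/-- The history produced by the first `n` moves of a strategy profile. -/
def outHist (s : G.Profile) : ℕ → G.Hist
  | 0 => G.startHist
  | n + 1 =>
    (outHist s n).extend ((s (G.owner (outHist s n).last)).1 ⟨outHist s n, rfl⟩)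
      ((s (G.owner (outHist s n).last)).2 ⟨outHist s n, rfl⟩)

theorem outHist_isPlay (s : G.Profile) : G.IsPlay (fun n => (outHist s n).last) := by
  refine ⟨rfl, fun i => ?_⟩
  simp only [outHist, Hist.last_extend]
  exact (s (G.owner (outHist s i).last)).2 ⟨outHist s i, rfl⟩

/-- The outcome of a strategy profile. -/
def out (s : G.Profile) : G.Play := ⟨fun n => (outHist s n).last, outHist_isPlay s⟩

/-- The vertices that a play visits infinitely often. -/
def Play.inf (ρ : G.Play) : Set V := {v | ∀ i, ∃ j, i ≤ j ∧ ρ.1 j = v}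

end GameArena

/-- Boolean formulas over a set `V` of variables. -/
inductive BoolFormula (V : Type) : Type
  | tru : BoolFormula V
  | fls : BoolFormula V
  | var (v : V) : BoolFormula V
  | neg (φ : BoolFormula V) : BoolFormula V
  | conj (φ ψ : BoolFormula V) : BoolFormula V
  | disj (φ ψ : BoolFormula V) : BoolFormula V

/-- Truth of a formula under the assignment that makes exactly the variables in `θ` true. -/
def BoolFormula.Holds {V : Type} (θ : Set V) : BoolFormula V → Prop
  | tru => True
  | fls => False
  | var v => v ∈ θ
  | neg φ => ¬ φ.Holds θ
  | conj φ ψ => φ.Holds θ ∧ ψ.Holds θ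
  | disj φ ψ => φ.Holds θ ∨ ψ.Holds θ

/-- The Muller objective of a formula. -/
def GameArena.Muller {P V : Type} (G : GameArena P V) (φ : BoolFormula V) : Set G.Play :=
  {ρ | φ.Holds ρ.inf}

/-! ### Epistemic models and common knowledge of rationality -/

/-- An epistemic model for `G` and a class `S` of strategies. The equivalence relations `R p`
on the finite set `W` of worlds form a KT5 Kripke frame. -/
structure EpistemicModel {P V : Type} (G : GameArena P V) (S : ∀ p, Set (G.Strategy p)) where
  W : Type
  [finiteW : Finite W]
  R : P → W → W → Prop
  equivalence_R : ∀ p, Equivalence (R p)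
  σ : W → G.Profile
  σ_mem : ∀ w p, σ w p ∈ S p
  σ_eq : ∀ p w w', R p w w' → σ w p = σ w' p

namespace EpistemicModel

variable {P V : Type} {G : GameArena P V} {S : ∀ p, Set (G.Strategy p)}
  (M : EpistemicModel G S)

/-- Player `p` knows the event `E`. -/
def knows (p : P) (E : Set M.W) : Set M.W := {w | ∀ w', M.R p w w' → w' ∈ E}

/-- The event `E` is mutual knowledge. -/
def mutualKnowledge (E : Set M.W) : Set M.W := ⋂ p, M.knows p E

/-- The event `E` is common knowledge. -/
def commonKnowledge (E : Set M.W) : Set M.W := ⋂ i : ℕ, ⋂ _ : 1 ≤ i, M.mutualKnowledge^[i] E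

open Classical in
/-- The worlds in which player `p` is rational: `p` has no strategy that in all worlds she
considers possible is at least as good as hers, and in one of them better. -/
def ratOf (α : P → Set G.Play) (p : P) : Set M.W :=
  {w | ¬ ∃ s ∈ S p,
    (∀ w', M.R p w w' →
      GameArena.out (M.σ w') ∈ α p →
      GameArena.out (Function.update (M.σ w') p s) ∈ α p) ∧
    (∃ w', M.R p w w' ∧
      GameArena.out (M.σ w') ∉ α p ∧
      GameArena.out (Function.update (M.σ w') p s) ∈ α p)}

/-- The worlds in which all players are rational. -/
def rat (α : P → Set G.Play) : Set M.W := ⋂ p, M.ratOf α p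

end EpistemicModel

/-- The set of strategy profiles over `S` that are compatible with common knowledge of
rationality. -/
def GameArena.ckr {P V : Type} (G : GameArena P V) (α : P → Set G.Play)
    (S : ∀ p, Set (G.Strategy p)) : Set G.Profile :=
  {s | (∀ p, s p ∈ S p) ∧
    ∃ (M : EpistemicModel G S) (w : M.W), w ∈ M.commonKnowledge (M.rat α) ∧ M.σ w = s}

/-! ### The verification problem -/

/-- An instance: a finite game arena (with players and vertices numbered from `0`), a Muller
objective for each player, and a Muller specification. -/
structure GameInstance where
  numPlayers : ℕ
  numVertices : ℕ
  arena : GameArena (Fin numPlayers) (Fin numVertices)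
  obj : Fin numPlayers → BoolFormula (Fin numVertices)
  spec : BoolFormula (Fin numVertices)

namespace GameInstance

/-- The outcome of each positional strategy profile that is compatible with common knowledge of
rationality satisfies the specification. -/
def SatisfiesVPCKRPos (I : GameInstance) : Prop :=
  ∀ t ∈ I.arena.ckr (fun p => I.arena.Muller (I.obj p)) I.arena.Pos,
    GameArena.out t ∈ I.arena.Muller I.spec

/-- The alphabet in which instances are written. -/
inductive Sym : Type
  | tick | mark | nonEdge | edge | tru | fls | var | neg | conj | disj
  deriving DecidableEq

instance : Fintype Sym :=
  ⟨{.tick, .mark, .nonEdge, .edge, .tru, .fls, .var, .neg, .conj, .disj}, by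
    intro x; cases x <;> decide⟩

/-- Unary notation. As the vertices and the players (with their objectives) are listed one by one
anyway, binary notation would make the instances shorter only by a polynomial. -/
def encodeNum (n : ℕ) : List Sym := List.replicate n Sym.tick ++ [Sym.mark]

/-- Prefix notation of formulas. -/
def encodeFormula {m : ℕ} : BoolFormula (Fin m) → List Sym
  | .tru => [Sym.tru]
  | .fls => [Sym.fls]
  | .var v => Sym.var :: encodeNum v
  | .neg φ => Sym.neg :: encodeFormula φ
  | .conj φ ψ => Sym.conj :: (encodeFormula φ ++ encodeFormula ψ)
  | .disj φ ψ => Sym.disj :: (encodeFormula φ ++ encodeFormula ψ)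

open Classical in
/-- The owner of a vertex, followed by its row of the adjacency matrix. -/
noncomputable def encodeVertex {n m : ℕ} (G : GameArena (Fin n) (Fin m)) (v : Fin m) : List Sym :=
  encodeNum (G.owner v) ++
    List.ofFn fun w : Fin m => if G.edge v w then Sym.edge else Sym.nonEdge

/-- The string that describes an instance. -/
noncomputable def encode (I : GameInstance) : List Sym :=
  encodeNum I.numPlayers ++ encodeNum I.numVertices ++
    (List.ofFn (encodeVertex I.arena)).flatten ++ encodeNum I.arena.start ++
    (List.ofFn fun p => encodeFormula (I.obj p)).flatten ++ encodeFormula I.spec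

theorem encodeNum_append_inj {a b : ℕ} {r r' : List Sym}
    (h : encodeNum a ++ r = encodeNum b ++ r') : a = b ∧ r = r' := by
  induction a generalizing b with
  | zero => cases b <;> simp_all [encodeNum, List.replicate_succ]
  | succ a ih =>
    cases b with
    | zero => simp [encodeNum, List.replicate_succ] at h
    | succ b =>
      have := ih (b := b) (by simpa [encodeNum, List.replicate_succ] using h)
      simpa using this

theorem encodeFormula_append_inj {m : ℕ} {φ ψ : BoolFormula (Fin m)} {r r' : List Sym}
    (h : encodeFormula φ ++ r = encodeFormula ψ ++ r') : φ = ψ ∧ r = r' := by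
  induction φ generalizing ψ r r' with
  | tru => cases ψ <;> simp_all [encodeFormula]
  | fls => cases ψ <;> simp_all [encodeFormula]
  | var v =>
    cases ψ <;> simp [encodeFormula] at h ⊢
    have := encodeNum_append_inj h
    exact ⟨Fin.ext this.1, this.2⟩
  | neg φ ih => cases ψ <;> simp [encodeFormula] at h ⊢; exact ih h
  | conj φ χ ih1 ih2 =>
    cases ψ <;> simp [encodeFormula] at h ⊢
    obtain ⟨h1, h2⟩ := ih1 h
    obtain ⟨h3, h4⟩ := ih2 h2
    exact ⟨⟨h1, h3⟩, h4⟩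
  | disj φ χ ih1 ih2 =>
    cases ψ <;> simp [encodeFormula] at h ⊢
    obtain ⟨h1, h2⟩ := ih1 h
    obtain ⟨h3, h4⟩ := ih2 h2
    exact ⟨⟨h1, h3⟩, h4⟩

theorem flatten_ofFn_append_inj {X : Type} {n : ℕ} (P : X → List Sym)
    (hP : ∀ x y r r', P x ++ r = P y ++ r' → x = y ∧ r = r') (f g : Fin n → X) {r r' : List Sym}
    (h : (List.ofFn fun i => P (f i)).flatten ++ r = (List.ofFn fun i => P (g i)).flatten ++ r') :
    f = g ∧ r = r' := by
  induction n with
  | zero => exact ⟨Subsingleton.elim _ _, by simpa using h⟩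
  | succ n ih =>
    simp only [List.ofFn_succ, List.flatten_cons, List.append_assoc] at h
    obtain ⟨h1, h2⟩ := hP _ _ _ _ h
    obtain ⟨h3, h4⟩ := ih _ _ h2
    refine ⟨funext fun i => ?_, h4⟩
    cases i using Fin.cases with
    | zero => exact h1
    | succ i => exact congrFun h3 i

open Classical in
/-- Different instances have different descriptions. -/
theorem encode_injective : Function.Injective encode := by
  rintro ⟨n, m, G, o, s⟩ ⟨n', m', G', o', s'⟩ h
  simp only [encode, List.append_assoc] at h
  obtain ⟨rfl, h⟩ := encodeNum_append_inj h
  obtain ⟨rfl, h⟩ := encodeNum_append_inj h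
  have key := flatten_ofFn_append_inj (n := m)
    (fun x : Fin n × (Fin m → Prop) => encodeNum x.1 ++
      List.ofFn fun w : Fin m => if x.2 w then Sym.edge else Sym.nonEdge) (by
      rintro ⟨a, b⟩ ⟨c, d⟩ r r' h
      simp only [List.append_assoc] at h
      obtain ⟨h1, h⟩ := encodeNum_append_inj h
      obtain ⟨h2, h3⟩ := List.append_inj h (by simp)
      have h2 := List.ofFn_injective h2
      refine ⟨Prod.ext (Fin.ext h1) (funext fun w => ?_), h3⟩
      have := congrFun h2 w
      by_cases hb : b w <;> by_cases hd : d w <;> simp_all)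
    (fun v => (G.owner v, G.edge v)) (fun v => (G'.owner v, G'.edge v)) h
  obtain ⟨hG, h⟩ := key
  obtain ⟨hst, h⟩ := encodeNum_append_inj h
  obtain ⟨ho, h⟩ := flatten_ofFn_append_inj encodeFormula
    (fun _ _ _ _ => encodeFormula_append_inj) _ _ h
  obtain ⟨hs, -⟩ := encodeFormula_append_inj (r := []) (r' := []) (by simpa using h)
  subst ho hs
  obtain ⟨ow, st, e, he⟩ := G
  obtain ⟨ow', st', e', he'⟩ := G'
  have h1 : ow = ow' := funext fun v => congrArg Prod.fst (congrFun hG v)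
  have h2 : e = e' := funext fun v => congrArg Prod.snd (congrFun hG v)
  have h3 : st = st' := Fin.ext hst
  subst h1 h2 h3
  rfl

end GameInstance

/-- The language `VPCKR_Pos`. -/
def VPCKRPos : Set (List GameInstance.Sym) :=
  {x | ∃ I : GameInstance, I.SatisfiesVPCKRPos ∧ I.encode = x}

/-! ### Runs of nondeterministic oracle machines -/

/-! A counterexample to the specification can be taken to be a plain set `Y` of positional profiles,
without any epistemic model. Write a positional profile as a function `f` from vertices to
successors, so that its outcome is the orbit of the initial vertex under `f`. Call `Y` undominated
if for no `f ∈ Y` and no player `p` does some strategy weakly dominate that of `p` in `f`, measured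
against the members of `Y` that agree with `f` on the vertices of `p`. An undominated `Y` is itself
an epistemic model: its members are the worlds, and each player knows exactly her own strategy.
Everybody is rational in every world, so rationality is common knowledge
(`GameArena.exists_ckr_of_undominated`). Conversely, the profiles at the worlds with common
knowledge of rationality form an undominated set (`GameArena.exists_undominated_of_ckr`). So the
specification fails iff some undominated `Y` has a member that violates it.

There are only exponentially many positional profiles. A machine can therefore guess the whole
characteristic table of `Y` and then check undominatedness and the violation by exhaustive search,
in deterministic exponential time. No oracle question is ever asked, so the proof uses the empty
language as the oracle and in fact gives a bound of coNEXP.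

To avoid programming this search by hand, the check is written as one fixed formula of a logic over
the input string. Its variables range over positions and over binary relations on positions, and an
atom asks whether a relation belongs to the guessed set. With `N = |x| + 1` positions there are `2 ^
(N * N)` relations, so brute-force evaluation of a fixed formula takes time `(2 ^ (N * N)) ^ e` with
`e` depending on the formula only (`Prog.does_eval`). Together with a compiler from small stack
programs to machines (`Prog.Good.exec`, `Prog.mem_NEXPRel`), this puts every language defined by
such a formula with one guessed set of relations in NEXP (`Fml.mem_NEXPRel`).

It remains to express the problem in the logic (`Definable.counterexample`, `notMem_VPCKRPos_iff`).
Players and vertices are positions, because numbers are written in unary; strategies are graphs of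
functions; parsing, evaluation of Boolean formulas, addition and reachability are least fixed
points, expressed by quantifying over all relations closed under the rules. -/

namespace OracleNTM

variable {α β : Type} {M : OracleNTM α β} {A : Set (List β)}

/-- Every computation from `c` has at most `T` steps, and some computation from `c` accepts
iff `P` holds. -/
def Acc (M : OracleNTM α β) (A : Set (List β)) (T : ℕ) (c : M.Cfg) (P : Prop) : Prop :=
  (∀ n c', M.Run A n c c' → n ≤ T) ∧
    ((∃ n c', M.Run A n c c' ∧ c'.l = none ∧ c'.var ∈ M.accept) ↔ P)

theorem Acc.mono {T T' : ℕ} {c : M.Cfg} {P : Prop} (h : M.Acc A T c P) (hT : T ≤ T') :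
    M.Acc A T' c P :=
  ⟨fun n c' hr => (h.1 n c' hr).trans hT, h.2⟩

theorem Acc.congr {T : ℕ} {c : M.Cfg} {P Q : Prop} (h : M.Acc A T c P) (hPQ : P ↔ Q) :
    M.Acc A T c Q :=
  ⟨h.1, h.2.trans hPQ⟩

theorem step_none {b : Bool} {c : M.Cfg} (h : c.l = none) : M.step A b c = none := by
  obtain ⟨l, v, s⟩ := c
  obtain rfl : l = none := h
  simp [step, Turing.TM2.step]

theorem Acc.halt {c : M.Cfg} (h : c.l = none) : M.Acc A 0 c (c.var ∈ M.accept) := by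
  have key : ∀ n c', M.Run A n c c' → n = 0 ∧ c' = c := by
    intro n c' hr
    cases hr with
    | refl => exact ⟨rfl, rfl⟩
    | cons b h1 _ => rw [step_none h] at h1; cases h1
  refine ⟨fun n c' hr => (key n c' hr).1.le, ?_, fun hc => ⟨0, c, .refl c, h, hc⟩⟩
  rintro ⟨n, c', hr, -, h2⟩
  rwa [← (key n c' hr).2]

/-- Acceptance is existential in the two choices, whereas the time bound has to hold on both
branches. A deterministic step is the case in which `c'` and `P` ignore the choice. -/
theorem Acc.step {T : ℕ} {c : M.Cfg} {c' : Bool → M.Cfg} {P : Bool → Prop}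
    (hs : ∀ b, M.step A b c = some (c' b)) (h : ∀ b, M.Acc A T (c' b) (P b)) :
    M.Acc A (T + 1) c (∃ b, P b) := by
  refine ⟨fun n d hr => ?_, ⟨?_, ?_⟩⟩
  · cases hr with
    | refl => omega
    | cons b h1 h2 =>
      rw [hs b] at h1
      cases h1
      have := (h b).1 _ _ h2
      omega
  · rintro ⟨n, d, hr, hl, hv⟩
    cases hr with
    | refl =>
      have := hs true
      rw [step_none hl] at this
      cases this
    | cons b h1 h2 =>
      rw [hs b] at h1
      cases h1
      exact ⟨b, (h b).2.1 ⟨_, _, h2, hl, hv⟩⟩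
  · rintro ⟨b, hb⟩
    obtain ⟨n, d, hr, hl, hv⟩ := (h b).2.2 hb
    exact ⟨n + 1, d, .cons b (hs b) hr, hl, hv⟩

theorem step_eq {b : Bool} {l : M.Λ} (hl : l ≠ M.ask) (v : M.σ) (s : ∀ k, List (M.Γ k)) :
    M.step A b ⟨some l, v, s⟩ = some (Turing.TM2.stepAux (M.program b l) v s) := by
  have h : ¬ (some l = some M.ask) := fun h => hl (Option.some.inj h)
  simp [step, h, Turing.TM2.step]

end OracleNTM

/-! ### Stack programs -/

/-- The registers of stack programs. Each holds a list of symbols. -/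
inductive Reg : Type
  | inp | tmp | tmp' | scr | blk | blk' | zer | tab | tab'
  | num (d : ℕ)
  | rem (d : ℕ)
  | rel (d : ℕ)
  | flag (d : ℕ)
  deriving DecidableEq

open GameInstance (Sym)

/-- The contents of the registers. -/
abbrev Store : Type := Reg → List Sym

/-- The basic instructions. Each returns a Boolean. -/
inductive Instr : Type
  | const (b : Bool)
  | push (k : Reg) (a : Sym)
  | pop (k : Reg)
  | top (k : Reg) (a : Sym)
  | move (j k : Reg)
  | dup (j k : Reg)

namespace Instr

open Function (update)

def run (s : Store) : Instr → Bool × Store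
  | const b => (b, s)
  | push k a => (true, update s k (a :: s k))
  | pop k => ((s k).head?.isSome, update s k (s k).tail)
  | top k a => ((s k).head? == some a, s)
  | move j k =>
    match s j with
    | [] => (false, s)
    | a :: l => (true, update (update s j l) k (a :: update s j l k))
  | dup j k =>
    match s j with
    | [] => (false, s)
    | a :: _ => (true, update s k (a :: s k))

def regs : Instr → Finset Reg
  | const _ => ∅
  | push k _ => {k}
  | pop k => {k}
  | top k _ => {k}
  | move j k => {j, k}
  | dup j k => {j, k}

variable {Λ : Type}

open Turing.TM2 in
/-- The translation of an instruction, with a label for each of the two results. -/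
def code (S : Finset Reg) (e : Bool → Λ) :
    Instr → Stmt (fun _ : {k // k ∈ S} => Sym) Λ (Option Sym)
  | const b => .goto fun _ => e b
  | push k a => if h : k ∈ S then .push ⟨k, h⟩ (fun _ => a) (.goto fun _ => e true) else .halt
  | pop k =>
    if h : k ∈ S then .pop ⟨k, h⟩ (fun _ o => o) (.goto fun o => e o.isSome) else .halt
  | top k a =>
    if h : k ∈ S then .peek ⟨k, h⟩ (fun _ o => o) (.goto fun o => e (o == some a)) else .halt
  | move j k =>
    if h : j ∈ S ∧ k ∈ S then
      .pop ⟨j, h.1⟩ (fun _ o => o) (.branch (fun o => o.isSome)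
        (.push ⟨k, h.2⟩ (fun o => o.getD .tick) (.goto fun _ => e true))
        (.goto fun _ => e false))
    else .halt
  | dup j k =>
    if h : j ∈ S ∧ k ∈ S then
      .peek ⟨j, h.1⟩ (fun _ o => o) (.branch (fun o => o.isSome)
        (.push ⟨k, h.2⟩ (fun o => o.getD .tick) (.goto fun _ => e true))
        (.goto fun _ => e false))
    else .halt

theorem update_restrict {S : Finset Reg} (s : Store) {k : Reg} (hk : k ∈ S) (l : List Sym) :
    update (fun k : {k // k ∈ S} => s k) ⟨k, hk⟩ l = fun k' : {k // k ∈ S} => update s k l k' := by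
  funext k'
  by_cases h : k' = ⟨k, hk⟩
  · subst h; simp
  · have : (k' : Reg) ≠ k := fun h' => h (Subtype.ext h')
    simp [h, this]

/-- The internal state only buffers the symbol just read, and the exit label is chosen within the
same step; its final value never matters and is left existential. The hypothesis `hi` rules out the
`.halt` placeholders in `code`. -/
theorem code_spec {S : Finset Reg} (i : Instr) (hi : i.regs ⊆ S) (e : Bool → Λ) (v : Option Sym)
    (s : Store) : ∃ v', Turing.TM2.stepAux (i.code S e) v (fun k : {k // k ∈ S} => s k) =
      ⟨some (e (i.run s).1), v', fun k => (i.run s).2 k⟩ := by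
  cases i with
  | const b => exact ⟨v, rfl⟩
  | push k a =>
    have hk : k ∈ S := hi (by simp [regs])
    simp [code, hk, run, Turing.TM2.stepAux, update_restrict]
  | pop k =>
    have hk : k ∈ S := hi (by simp [regs])
    simp [code, hk, run, Turing.TM2.stepAux, update_restrict]
  | top k a =>
    have hk : k ∈ S := hi (by simp [regs])
    simp [code, hk, run, Turing.TM2.stepAux]
  | move j k =>
    have hj : j ∈ S := hi (by simp [regs])
    have hk : k ∈ S := hi (by simp [regs])
    cases hs : s j with
    | nil =>
      have : update s j [] = s := by rw [← hs]; simp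
      simp [code, hj, hk, run, Turing.TM2.stepAux, hs, update_restrict, this]
    | cons a l => simp [code, hj, hk, run, Turing.TM2.stepAux, hs, update_restrict]
  | dup j k =>
    have hj : j ∈ S := hi (by simp [regs])
    have hk : k ∈ S := hi (by simp [regs])
    cases hs : s j with
    | nil => simp [code, hj, hk, run, Turing.TM2.stepAux, hs]
    | cons a l => simp [code, hj, hk, run, Turing.TM2.stepAux, hs, update_restrict]

end Instr

/-- Stack programs. Each returns a Boolean when it terminates. -/
inductive Prog : Type
  | instr (i : Instr)
  | choose
  | ite (c p q : Prog)
  | loop (c : Prog)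

namespace Prog

/-- Big-step semantics of the programs without `choose`: `Exec p s b s' t` says that `p`, started
in the store `s`, returns `b` and leaves the store `s'` after `t` steps. The program `loop c` runs
`c` until it returns `false`. -/
inductive Exec : Prog → Store → Bool → Store → ℕ → Prop
  | instr (i : Instr) (s : Store) : Exec (instr i) s (i.run s).1 (i.run s).2 1
  | ite {c p q : Prog} {s s₁ s₂ : Store} {b b' : Bool} {t t' : ℕ} (h : Exec c s b s₁ t)
      (h' : Exec (bif b then p else q) s₁ b' s₂ t') : Exec (ite c p q) s b' s₂ (t + t')
  | loop_true {c : Prog} {s s₁ s₂ : Store} {b : Bool} {t t' : ℕ} (h : Exec c s true s₁ t)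
      (h' : Exec (loop c) s₁ b s₂ t') : Exec (loop c) s b s₂ (t + t')
  | loop_false {c : Prog} {s s₁ : Store} {t : ℕ} (h : Exec c s false s₁ t) :
      Exec (loop c) s true s₁ t

def regs : Prog → Finset Reg
  | instr i => i.regs
  | choose => ∅
  | ite c p q => c.regs ∪ (p.regs ∪ q.regs)
  | loop c => c.regs

/-- The labels of the translation of a program. -/
def Lab : Prog → Type
  | instr _ => Unit
  | choose => Unit
  | ite c p q => Lab c ⊕ (Lab p ⊕ Lab q)
  | loop c => Lab c

instance fintypeLab : ∀ p : Prog, Fintype p.Lab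
  | instr _ => inferInstanceAs (Fintype Unit)
  | choose => inferInstanceAs (Fintype Unit)
  | ite c p q =>
    have := fintypeLab c
    have := fintypeLab p
    have := fintypeLab q
    inferInstanceAs (Fintype (c.Lab ⊕ (p.Lab ⊕ q.Lab)))
  | loop c => fintypeLab c

def entry : ∀ p : Prog, p.Lab
  | instr _ => ()
  | choose => ()
  | ite c _ _ => Sum.inl c.entry
  | loop c => c.entry

/-- The translation of a program, where `f` embeds its labels, `e` gives the exits, and `β` is
the nondeterministic choice. -/
def code {Λ : Type} (S : Finset Reg) (β : Bool) : ∀ p : Prog, (p.Lab → Λ) → (Bool → Λ) → p.Lab →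
    Turing.TM2.Stmt (fun _ : {k // k ∈ S} => Sym) Λ (Option Sym)
  | instr i, _, e, _ => i.code S e
  | choose, _, e, _ => .goto fun _ => e β
  | ite c p q, f, e, l =>
    match l with
    | .inl l => code S β c (fun l => f (.inl l))
        (fun b => bif b then f (.inr (.inl p.entry)) else f (.inr (.inr q.entry))) l
    | .inr (.inl l) => code S β p (fun l => f (.inr (.inl l))) e l
    | .inr (.inr l) => code S β q (fun l => f (.inr (.inr l))) e l
  | loop c, f, e, l => code S β c f (fun b => bif b then f c.entry else e true) l

/-- The machine of a program. It accepts if the program returns `true`. -/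
def machine (p : Prog) : OracleNTM Sym Sym where
  K := {k // k ∈ insert Reg.inp p.regs}
  Γ := fun _ => Sym
  Λ := p.Lab ⊕ Option Bool
  σ := Option Sym
  program := fun β l =>
    match l with
    | .inl l => code _ β p Sum.inl (fun b => .inr (some b)) l
    | .inr (some b) => .load (fun _ => if b then some .tick else none) .halt
    | .inr none => .halt
  main := .inl p.entry
  initialState := none
  accept := {some .tick}
  inputStack := ⟨.inp, by simp⟩
  inputAlphabet := Equiv.refl _
  queryStack := ⟨.inp, by simp⟩
  queryAlphabet := Equiv.refl _
  -- A label that no part of the program jumps to serves all three oracle roles, so the oracle is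
  -- never asked.
  ask := .inr none
  yes := .inr none
  no := .inr none

/-! ### Correctness of the compiled machine -/

variable {P : Prog}

/-- The configuration of the machine of `P` with label `l` and store `s`. -/
def cfg (P : Prog) (l : P.Lab ⊕ Option Bool) (v : Option Sym) (s : Store) : P.machine.Cfg :=
  ⟨some l, v, fun k => s k.1⟩

/-- Whatever the internal state is, `M.Acc` holds for the given label and store. -/
def Good (P : Prog) (T : ℕ) (l : P.Lab ⊕ Option Bool) (s : Store) (Q : Prop) : Prop :=
  ∀ v, P.machine.Acc ∅ T (P.cfg l v s) Q

theorem Good.mono {T T' : ℕ} {l : P.Lab ⊕ Option Bool} {s : Store} {Q : Prop}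
    (h : P.Good T l s Q) (hT : T ≤ T') : P.Good T' l s Q :=
  fun v => (h v).mono hT

theorem Good.congr {T : ℕ} {l : P.Lab ⊕ Option Bool} {s : Store} {Q Q' : Prop}
    (h : P.Good T l s Q) (hQ : Q ↔ Q') : P.Good T l s Q' :=
  fun v => (h v).congr hQ

/-- The program `p` is part of the program of the machine of `P`, with the labels embedded by `f`
and the exits `e`. -/
structure Embeds (P p : Prog) (f : p.Lab → P.Lab ⊕ Option Bool) (e : Bool → P.Lab ⊕ Option Bool) :
    Prop where
  regs_subset : p.regs ⊆ insert Reg.inp P.regs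
  program_eq : ∀ β l, P.machine.program β (f l) = code _ β p f e l
  ne_none : ∀ l, f l ≠ .inr none

theorem embeds_self (P : Prog) : Embeds P P Sum.inl (fun b => .inr (some b)) :=
  ⟨Finset.subset_insert _ _, fun _ _ => rfl, by simp⟩

section

variable {c p q : Prog} {e : Bool → P.Lab ⊕ Option Bool}

theorem Embeds.cond {f : (ite c p q).Lab → P.Lab ⊕ Option Bool} (h : Embeds P (ite c p q) f e) :
    Embeds P c (fun l => f (.inl l))
      (fun b => bif b then f (.inr (.inl p.entry)) else f (.inr (.inr q.entry))) :=
  ⟨fun _ hk => h.regs_subset (by simp [regs, hk]), fun β l => h.program_eq β (.inl l),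
    fun _ => h.ne_none _⟩

theorem Embeds.then {f : (ite c p q).Lab → P.Lab ⊕ Option Bool} (h : Embeds P (ite c p q) f e) :
    Embeds P p (fun l => f (.inr (.inl l))) e :=
  ⟨fun _ hk => h.regs_subset (by simp [regs, hk]), fun β l => h.program_eq β (.inr (.inl l)),
    fun _ => h.ne_none _⟩

theorem Embeds.else {f : (ite c p q).Lab → P.Lab ⊕ Option Bool} (h : Embeds P (ite c p q) f e) :
    Embeds P q (fun l => f (.inr (.inr l))) e :=
  ⟨fun _ hk => h.regs_subset (by simp [regs, hk]), fun β l => h.program_eq β (.inr (.inr l)),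
    fun _ => h.ne_none _⟩

theorem Embeds.body {f : (loop c).Lab → P.Lab ⊕ Option Bool} (h : Embeds P (loop c) f e) :
    Embeds P c f (fun b => bif b then f c.entry else e true) :=
  ⟨h.regs_subset, h.program_eq, h.ne_none⟩

end

/-- Correctness is propagated backwards, in continuation style: what holds at the exit that is taken
holds at the entry, with the time of the execution added. For a loop, the exit `true` of the body is
the entry of the loop itself, so the second induction hypothesis applies to the same embedding. -/
theorem Good.exec {p : Prog} {s s' : Store} {b : Bool} {t : ℕ} (hp : Exec p s b s' t) :
    ∀ {f e}, Embeds P p f e → ∀ {T : ℕ} {Q : Prop}, P.Good T (e b) s' Q →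
      P.Good (T + t) (f p.entry) s Q := by
  induction hp with
  | instr i s =>
    intro f e he T Q h v
    obtain ⟨v', hv⟩ := Instr.code_spec i he.regs_subset e v s
    refine (OracleNTM.Acc.step (c' := fun _ => P.cfg (e (i.run s).1) v' (i.run s).2)
      (P := fun _ => Q) (fun β => ?_) (fun _ => h v')).congr (by simp)
    exact (OracleNTM.step_eq (M := P.machine) (A := ∅) (b := β) (he.ne_none ()) v
      (fun k => s k.1)).trans (congrArg some ((congrArg (fun q =>
        Turing.TM2.stepAux q v (fun k : P.machine.K => s k.1)) (he.program_eq β ())).trans hv))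
  | @ite c p q s s₁ s₂ b b' t t' _ _ ih ih' =>
    intro f e he T Q h
    rw [Nat.add_comm t, ← Nat.add_assoc]
    refine ih he.cond ?_
    cases b
    · exact ih' he.else h
    · exact ih' he.then h
  | @loop_true c s s₁ s₂ b t t' _ _ ih ih' =>
    intro f e he T Q h
    rw [Nat.add_comm t, ← Nat.add_assoc]
    exact ih he.body (ih' he h)
  | loop_false _ ih =>
    intro f e he T Q h
    exact ih he.body h

theorem Good.choose {f e} (he : Embeds P choose f e) {T : ℕ} {s : Store} {Q : Bool → Prop}
    (h : ∀ b, P.Good T (e b) s (Q b)) : P.Good (T + 1) (f (entry choose)) s (∃ b, Q b) := by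
  intro v
  refine OracleNTM.Acc.step (c' := fun b => P.cfg (e b) v s) (fun β => ?_) (fun b => h b v)
  exact (OracleNTM.step_eq (M := P.machine) (A := ∅) (b := β) (he.ne_none ()) v
    (fun k => s k.1)).trans (congrArg some (congrArg (fun q =>
      Turing.TM2.stepAux q v (fun k => s k.1)) (he.program_eq β ())))

theorem good_exit (b : Bool) (s : Store) : P.Good 1 (.inr (some b)) s (b = true) := by
  intro v
  refine (OracleNTM.Acc.step (M := P.machine)
    (c' := fun _ => ⟨none, if b then some .tick else none, fun k => s k.1⟩)
    (fun β => OracleNTM.step_eq (by simp [machine]) _ _)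
    (fun _ => OracleNTM.Acc.halt rfl)).congr ?_
  cases b
  · exact iff_of_false (by rintro ⟨-, h⟩; cases h) (by simp)
  · exact iff_of_true ⟨true, rfl⟩ rfl

/-- A language that a stack program recognises in exponential time is in NEXP. -/
theorem mem_NEXPRel (P : Prog) (L : Set (List Sym)) (p : Polynomial ℕ)
    (h : ∀ x : List Sym, P.Good (2 ^ p.eval x.length) (.inl P.entry)
      (Function.update (fun _ => []) Reg.inp x) (x ∈ L)) :
    L ∈ NEXPRel (∅ : Set (List Sym)) Sym := by
  refine ⟨P.machine, p, fun x => ?_⟩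
  have hc : P.machine.initCfg x =
      P.cfg (.inl P.entry) none (Function.update (fun _ => []) Reg.inp x) := by
    refine Eq.trans ?_ (congrArg (fun s => (⟨some (.inl P.entry), none, s⟩ : P.machine.Cfg))
      (Instr.update_restrict (S := insert Reg.inp P.regs) (fun _ => []) (k := Reg.inp)
        (Finset.mem_insert_self _ _) x))
    simp only [OracleNTM.initCfg]
    congr 1
    congr 1
    exact List.map_id x
  rw [hc]
  exact ⟨(h x none).1, (h x none).2.symm⟩

end Prog

/-- A machine that halts at once and never accepts. Its query alphabet is `Empty`, which forces a
query stack other than the input stack, and the label `ask`, from which it would loop forever, has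
to differ from the initial one. -/
theorem empty_mem_NPClass (α : Type) [Fintype α] : (∅ : Set (List α)) ∈ NPClass α := by
  let M : OracleNTM α Empty :=
    { K := Bool
      Γ := fun b => bif b then α else Empty
      fintypeΓ := fun b => by cases b <;> dsimp <;> infer_instance
      Λ := Unit ⊕ Unit
      σ := Unit
      program := fun _ _ => .halt
      main := .inl ()
      initialState := ()
      accept := ∅
      inputStack := true
      inputAlphabet := Equiv.refl _
      queryStack := false
      queryAlphabet := Equiv.refl _
      ask := .inr ()
      yes := .inr ()
      no := .inr () }
  refine ⟨M, 1, fun x => ?_⟩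
  have h : M.Acc ∅ 1 (M.initCfg x) False := by
    refine (OracleNTM.Acc.step (M := M) (T := 0) (P := fun _ => False)
      (c' := fun _ => ⟨none, (), (M.initCfg x).stk⟩)
      (fun β => OracleNTM.step_eq (by simp [M]) _ _)
      (fun _ => (OracleNTM.Acc.halt rfl).congr (by simp [M]))).congr (by simp)
  simpa using And.intro h.1 h.2.symm

namespace Prog

open Function (update)
open GameInstance (Sym)

/-! ### Derived commands -/

/-- `p` returns `b` and turns the store `s` into `s'` within `T` steps. -/
def Does (p : Prog) (s : Store) (b : Bool) (s' : Store) (T : ℕ) : Prop :=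
  ∃ t ≤ T, Exec p s b s' t

section Does

variable {c p q : Prog} {s s₁ s₂ : Store} {b b' : Bool} {T T' : ℕ}

theorem Does.mono (h : Does p s b s₁ T) (hT : T ≤ T') : Does p s b s₁ T' :=
  let ⟨t, ht, he⟩ := h
  ⟨t, ht.trans hT, he⟩

theorem does_instr (i : Instr) (s : Store) : Does (instr i) s (i.run s).1 (i.run s).2 1 :=
  ⟨1, le_rfl, .instr i s⟩

theorem Does.ite (h : Does c s b s₁ T) (h' : Does (bif b then p else q) s₁ b' s₂ T') :
    Does (ite c p q) s b' s₂ (T + T') := by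
  obtain ⟨t, ht, he⟩ := h
  obtain ⟨t', ht', he'⟩ := h'
  exact ⟨t + t', by omega, .ite he he'⟩

theorem Does.loop_true (h : Does c s true s₁ T) (h' : Does (loop c) s₁ b s₂ T') :
    Does (loop c) s b s₂ (T + T') := by
  obtain ⟨t, ht, he⟩ := h
  obtain ⟨t', ht', he'⟩ := h'
  exact ⟨t + t', by omega, .loop_true he he'⟩

theorem Does.loop_false (h : Does c s false s₁ T) : Does (loop c) s true s₁ T := by
  obtain ⟨t, ht, he⟩ := h
  exact ⟨t, ht, .loop_false he⟩

/-- Return `b`. -/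
abbrev ret (b : Bool) : Prog := instr (.const b)

theorem does_ret (b : Bool) (s : Store) : Does (ret b) s b s 1 := does_instr (.const b) s

/-- First `p`, then `q`, whose value is returned. -/
def seq (p q : Prog) : Prog := .ite p q q

theorem Does.seq (h : Does p s b s₁ T) (h' : Does q s₁ b' s₂ T') :
    Does (seq p q) s b' s₂ (T + T') :=
  h.ite (by cases b <;> exact h')

/-- First `p`, whose value is returned, then `q`. -/
def after (p q : Prog) : Prog := .ite p (seq q (ret true)) (seq q (ret false))

theorem Does.after (h : Does p s b s₁ T) (h' : Does q s₁ b' s₂ T') :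
    Does (after p q) s b s₂ (T + (T' + 1)) :=
  h.ite (by cases b <;> exact h'.seq (does_ret _ _))

/-- One iteration is peeled off while the code after the loop stays attached, so that an induction
can treat a loop together with its epilogue. -/
theorem Does.loop_seq (h : Does c s true s₁ T) (h' : Does (Prog.seq (loop c) q) s₁ b s₂ T') :
    Does (Prog.seq (loop c) q) s b s₂ (T + T') := by
  obtain ⟨t, ht, he⟩ := h
  obtain ⟨t', ht', he'⟩ := h'
  cases he' with
  | @ite _ _ _ _ s₃ _ _ _ t₁ t₂ h1 h2 =>
    exact ⟨t + t₁ + t₂, by omega, .ite (.loop_true he h1) h2⟩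

/-- Move the whole register `j` to `k`. -/
def moveAll (j k : Reg) : Prog := loop (instr (.move j k))

theorem does_moveAll {j k : Reg} (hjk : j ≠ k) (s : Store) :
    Does (moveAll j k) s true (update (update s j []) k ((s j).reverse ++ s k))
      ((s j).length + 1) := by
  induction hl : s j generalizing s with
  | nil =>
    have := does_instr (.move j k) s
    simp only [Instr.run, hl] at this
    refine Eq.mp ?_ this.loop_false
    congr 1
    funext r
    rcases eq_or_ne r k with rfl | h₁ <;> rcases eq_or_ne r j with rfl | h₂ <;> simp_all
  | cons a l ih =>
    have h1 := does_instr (.move j k) s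
    simp only [Instr.run, hl] at h1
    have h2 := ih (update (update s j l) k (a :: update s j l k)) (by simp [hjk])
    refine Eq.mp ?_ ((h1.loop_true h2).mono (T' := (a :: l).length + 1) (by simp; omega))
    congr 1
    funext r
    rcases eq_or_ne r k with rfl | h₁ <;> rcases eq_or_ne r j with rfl | h₂ <;> simp_all

/-- Empty the register `k`. -/
def clear (k : Reg) : Prog := loop (instr (.pop k))

theorem does_clear (k : Reg) (s : Store) :
    Does (clear k) s true (update s k []) ((s k).length + 1) := by
  induction hl : s k generalizing s with
  | nil =>
    have := does_instr (.pop k) s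
    simp only [Instr.run, hl] at this
    exact this.loop_false
  | cons a l ih =>
    have h1 := does_instr (.pop k) s
    simp only [Instr.run, hl] at h1
    have h2 := ih (update s k l) (by simp)
    refine Eq.mp ?_ ((h1.loop_true h2).mono (T' := (a :: l).length + 1) (by simp; omega))
    simp [clear]

/-- Run `p` once for each symbol of the register `j`, with auxiliary register `k`. -/
def forEach (j k : Reg) (p : Prog) : Prog :=
  seq (loop (.ite (instr (.move j k)) (seq p (ret true)) (ret false))) (moveAll k j)

/-- The store `s` with the contents of the registers `j` and `k` replaced. -/
def set₂ (s : Store) (j k : Reg) (l l' : List Sym) : Store := update (update s j l) k l'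

/-- The family `F` is the loop invariant: `F i` is the store after `i` rounds, apart from `j` and
`k`. During a round the counter is split between `j` and `k`, so the body has to work for arbitrary
contents `l`, `l'` of these two; its result is ignored. -/
theorem does_forEach {j k : Reg} (hjk : j ≠ k) (F : ℕ → Store) {T : ℕ}
    (hF : ∀ i, i ≤ (F 0 j).length → F i j = F 0 j ∧ F i k = [])
    (h : ∀ i < (F 0 j).length, ∀ l l', ∃ b,
      Does p (set₂ (F i) j k l l') b (set₂ (F (i + 1)) j k l l') T) :
    Does (forEach j k p) (F 0) true (F (F 0 j).length) ((F 0 j).length * (T + 3) + 3) := by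
  set n := (F 0 j).length with hn
  -- Here `l` is the part of the counter still to be consumed, `l'` the part already moved to `k`,
  -- and `i` the number of rounds done.
  have key : ∀ (l l' : List Sym) (i : ℕ), l.length + i = n →
      Does (loop (.ite (instr (.move j k)) (seq p (ret true)) (ret false)))
        (set₂ (F i) j k l l') true (set₂ (F n) j k [] (l.reverse ++ l'))
        (l.length * (T + 2) + 2) := by
    intro l
    induction l with
    | nil =>
      intro l' i hi
      have h1 := does_instr (.move j k) (set₂ (F i) j k [] l')
      have h0 : set₂ (F i) j k [] l' j = [] := by simp [set₂, hjk]
      simp only [Instr.run, h0] at h1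
      obtain rfl : i = n := by simpa using hi
      simpa using (Does.ite (p := seq p (ret true)) h1 (does_ret false _)).loop_false
    | cons a l ih =>
      intro l' i hi
      have h1 := does_instr (.move j k) (set₂ (F i) j k (a :: l) l')
      have h0 : set₂ (F i) j k (a :: l) l' j = a :: l := by simp [set₂, hjk]
      simp only [Instr.run, h0] at h1
      have h3 : update (update (set₂ (F i) j k (a :: l) l') j l) k
          (a :: update (set₂ (F i) j k (a :: l) l') j l k) = set₂ (F i) j k l (a :: l') := by
        funext r
        rcases eq_or_ne r k with rfl | h₁ <;> rcases eq_or_ne r j with rfl | h₂ <;> simp_all [set₂]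
      rw [h3] at h1
      simp only [List.length_cons] at hi
      obtain ⟨b, hb⟩ := h i (by omega) l (a :: l')
      have h4 := ih (a :: l') (i + 1) (by omega)
      have := (Does.ite (q := ret false) h1 (hb.seq (does_ret true _))).loop_true h4
      rw [List.reverse_cons, List.append_assoc]
      refine this.mono ?_
      simp only [List.length_cons]
      nlinarith
  have h1 := key (F 0 j) [] 0 (by omega)
  have h2 : set₂ (F 0) j k (F 0 j) [] = F 0 := by
    have := (hF 0 (Nat.zero_le _)).2
    funext r
    rcases eq_or_ne r k with rfl | h₁ <;> rcases eq_or_ne r j with rfl | h₂ <;> simp_all [set₂]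
  rw [h2] at h1
  have h3 := h1.seq (does_moveAll hjk.symm _)
  have h4 : update (update (set₂ (F n) j k [] ((F 0 j).reverse ++ [])) k []) j
      ((set₂ (F n) j k [] ((F 0 j).reverse ++ []) k).reverse ++
        set₂ (F n) j k [] ((F 0 j).reverse ++ []) j) = F n := by
    have := hF n le_rfl
    funext r
    rcases eq_or_ne r k with rfl | h₁ <;> rcases eq_or_ne r j with rfl | h₂ <;> simp_all [set₂]
  rw [h4] at h3
  refine h3.mono ?_
  simp [set₂, ← hn]
  nlinarith

/-- The store `s` after moving `n` symbols from `j` to `k`. -/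
def shift (j k : Reg) (n : ℕ) (s : Store) : Store :=
  set₂ s j k ((s j).drop n) (((s j).take n).reverse ++ s k)

theorem shift_zero (j k : Reg) (s : Store) : shift j k 0 s = s := by simp [shift, set₂]

theorem shift_apply_left {j k : Reg} (h : j ≠ k) (n : ℕ) (s : Store) :
    shift j k n s j = (s j).drop n := by simp [shift, set₂, h]

theorem shift_apply_right {j k : Reg} (n : ℕ) (s : Store) :
    shift j k n s k = ((s j).take n).reverse ++ s k := by simp [shift, set₂]

theorem shift_apply_of_ne {j k r : Reg} (h : r ≠ j) (h' : r ≠ k) (n : ℕ) (s : Store) :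
    shift j k n s r = s r := by simp [shift, set₂, h, h']

theorem shift_shift {j k : Reg} (h : j ≠ k) (n n' : ℕ) (s : Store) :
    shift j k n' (shift j k n s) = shift j k (n + n') s := by
  have : ((s j).take (n + n')).reverse = (((s j).drop n).take n').reverse ++
      ((s j).take n).reverse := by rw [List.take_add, List.reverse_append]
  funext r
  simp only [shift, set₂]
  rcases eq_or_ne r k with rfl | h₁ <;> rcases eq_or_ne r j with rfl | h₂ <;> simp_all

theorem shift_set₂ {j k j' k' : Reg} (h₁ : j ≠ j') (h₂ : j ≠ k') (h₃ : k ≠ j') (h₄ : k ≠ k')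
    (n : ℕ) (s : Store) (l l' : List Sym) :
    shift j k n (set₂ s j' k' l l') = set₂ (shift j k n s) j' k' l l' := by
  funext r
  simp only [shift, set₂]
  rcases eq_or_ne r k with rfl | h₅
  · simp [h₃, h₄, h₁, h₂]
  rcases eq_or_ne r j with rfl | h₆
  · simp [h₁, h₂, h₅]
  simp only [Function.update_apply, h₅, h₆, if_false]

theorem does_move {j k : Reg} (h : j ≠ k) (s : Store) :
    Does (instr (.move j k)) s (s j ≠ []) (shift j k 1 s) 1 := by
  have h1 := does_instr (.move j k) s
  cases hs : s j with
  | nil =>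
    simp only [Instr.run, hs] at h1
    have : shift j k 1 s = s := by
      funext r
      simp only [shift, set₂, hs]
      rcases eq_or_ne r k with rfl | h₁ <;> rcases eq_or_ne r j with rfl | h₂ <;> simp_all
    rw [this]
    simpa using h1
  | cons a l =>
    simp only [Instr.run, hs] at h1
    have : shift j k 1 s = update (update s j l) k (a :: update s j l k) := by
      funext r
      simp only [shift, set₂, hs]
      rcases eq_or_ne r k with rfl | h₁ <;> rcases eq_or_ne r j with rfl | h₂ <;> simp_all
    rw [this]
    simpa using h1

/-- Moving symbols over and back reverses them twice. This makes random access to a stack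
non-destructive, provided that the auxiliary register was empty. -/
theorem unshift {j k : Reg} (h : j ≠ k) (n : ℕ) (s : Store) (hk : s k = []) :
    update (update (shift j k n s) k []) j
      ((shift j k n s k).reverse ++ shift j k n s j) = s := by
  rw [shift_apply_left h, shift_apply_right, hk, List.append_nil, List.reverse_reverse,
    List.take_append_drop]
  funext r
  simp only [shift, set₂]
  rcases eq_or_ne r k with rfl | h₁ <;> rcases eq_or_ne r j with rfl | h₂ <;> simp_all

theorem does_moveAll_shift {j k : Reg} (h : j ≠ k) (n : ℕ) (s : Store) (hk : s k = []) :
    Does (moveAll k j) (shift j k n s) true s ((s j).length + 1) := by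
  have := does_moveAll h.symm (shift j k n s)
  rw [unshift h n s hk] at this
  exact this.mono (by simp [shift_apply_right, hk])

/-- Move as many symbols from `j` to `k` as the register `i` has. -/
def skip (i j k : Reg) : Prog := forEach i .tmp (instr (.move j k))

/-- A move from an exhausted register changes nothing, in accordance with `List.drop` and
`List.take`, so the length of `j` need not be bounded below. -/
theorem does_skip {i j k : Reg} (hij : i ≠ j) (hik : i ≠ k) (hjk : j ≠ k) (hi : i ≠ .tmp)
    (hj : j ≠ .tmp) (hk : k ≠ .tmp) {s : Store} (hs : s .tmp = []) :
    Does (skip i j k) s true (shift j k (s i).length s) ((s i).length * 4 + 3) := by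
  have := does_forEach (p := instr (.move j k)) hi (fun n => shift j k n s) (T := 1) ?_ ?_
  · simp only [shift_zero] at this
    exact this
  · intro n _
    rw [shift_apply_of_ne hij hik, shift_apply_of_ne hj.symm hk.symm, shift_zero, hs]
    simp
  · intro n _ l l'
    refine ⟨decide (set₂ (shift j k n s) i .tmp l l' j ≠ []), ?_⟩
    rw [← shift_shift hjk, ← shift_set₂ hij.symm hj hik.symm hk (n := 1)]
    exact does_move hjk _

/-- Move `n` symbols from `j` to `k`, where `n` is the product of the lengths of `i` and the
register of blocks. -/
def skipBlocks (i j k : Reg) : Prog :=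
  forEach i .tmp (forEach .blk .tmp' (instr (.move j k)))

/-- Two nested counting loops perform the multiplication that row-major indexing needs. They use
different auxiliary registers, `tmp` and `tmp'`, so that the inner loop leaves the outer counter
intact. -/
theorem does_skipBlocks {i j k : Reg} (hij : i ≠ j) (hik : i ≠ k) (hjk : j ≠ k) (hi : i ≠ .tmp)
    (hj : j ≠ .tmp) (hk : k ≠ .tmp) (hj' : j ≠ .tmp') (hk' : k ≠ .tmp') (hjb : j ≠ .blk)
    (hkb : k ≠ .blk) (hi' : i ≠ .tmp') (hib : i ≠ .blk) {s : Store} (hs : s .tmp = [])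
    (hs' : s .tmp' = []) :
    Does (skipBlocks i j k) s true (shift j k ((s i).length * (s .blk).length) s)
      ((s i).length * ((s .blk).length * 4 + 6) + 3) := by
  have := does_forEach (p := forEach .blk .tmp' (instr (.move j k))) hi
    (fun n => shift j k (n * (s .blk).length) s) (T := (s .blk).length * 4 + 3) ?_ ?_
  · simp only [shift_zero, Nat.zero_mul] at this
    exact this
  · intro n _
    rw [shift_apply_of_ne hij hik, shift_apply_of_ne hj.symm hk.symm, Nat.zero_mul, shift_zero, hs]
    simp
  · intro n _ l l'
    refine ⟨true, ?_⟩
    set s' := set₂ (shift j k (n * (s .blk).length) s) i .tmp l l' with hs''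
    have hb : s' .blk = s .blk := by
      simp [hs'', set₂, hib.symm, shift_apply_of_ne hjb.symm hkb.symm]
    have ht : s' .tmp' = [] := by
      simp [hs'', set₂, hi'.symm, shift_apply_of_ne hj'.symm hk'.symm, hs']
    have := does_forEach (j := .blk) (k := .tmp') (p := instr (.move j k)) (by simp)
      (fun n => shift j k n s') (T := 1) ?_ ?_
    · simp only [shift_zero, hb] at this
      rw [hs'', shift_set₂ hij.symm hj hik.symm hk, shift_shift hjk] at this
      rwa [Nat.succ_mul]
    · intro n _
      rw [shift_apply_of_ne hjb.symm hkb.symm, shift_apply_of_ne hj'.symm hk'.symm, shift_zero, ht]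
      simp
    · intro n _ l l'
      refine ⟨decide (set₂ (shift j k n s') .blk .tmp' l l' j ≠ []), ?_⟩
      rw [← shift_shift hjk, ← shift_set₂ hjb hj' hkb hk' (n := 1)]
      exact does_move hjk _

/-! ### Binary counters -/

/-- The symbol of a bit. -/
def bitSym (b : Bool) : Sym := bif b then .tru else .fls

/-- Increment a binary number (lowest bit first). The first component is `false` iff there is an
overflow. -/
def incBits : List Bool → Bool × List Bool
  | [] => (false, [])
  | false :: l => (true, true :: l)
  | true :: l => ((incBits l).1, false :: (incBits l).2)

/-- Increment the binary number in `j`, with auxiliary register `k`. -/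
def inc (j k : Reg) : Prog :=
  seq (loop (.ite (instr (.top j .tru)) (seq (instr (.pop j)) (instr (.push k .fls))) (ret false)))
    (.ite (instr (.pop j)) (seq (instr (.push j .tru)) (seq (moveAll k j) (ret true)))
      (seq (moveAll k j) (ret false)))

/-- The statement is generalised over the state of the carry: `q` low ones have already been turned
into zeros and wait in `k` to be moved back. -/
theorem does_inc_aux {j k : Reg} (hjk : j ≠ k) (l : List Bool) (s : Store) (q : ℕ)
    (hj : s j = l.map bitSym) (hk : s k = List.replicate q .fls) :
    Does (inc j k) s (incBits l).1
      (set₂ s j k (List.replicate q .fls ++ (incBits l).2.map bitSym) []) (4 * l.length + q + 8) := by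
  have hkj := hjk.symm
  induction l generalizing s q with
  | nil =>
    have h1 := does_instr (.top j .tru) s
    simp only [Instr.run, hj, List.map_nil] at h1
    have h2 := (h1.ite (p := seq (instr (.pop j)) (instr (.push k .fls)))
      (does_ret false _)).loop_false
    have h3 := does_instr (.pop j) s
    simp only [Instr.run, hj, List.map_nil] at h3
    have h4 := h2.seq (h3.ite (p := seq (instr (.push j .tru)) (seq (moveAll k j) (ret true)))
      ((does_moveAll hjk.symm _).seq (does_ret false _)))
    refine Eq.mp ?_ (h4.mono (T' := 4 * ([] : List Bool).length + q + 8) ?_)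
    · congr 1
      funext r
      simp only [incBits, set₂]
      rcases eq_or_ne r k with rfl | h₁ <;> rcases eq_or_ne r j with rfl | h₂ <;> simp_all
    · simp [hk, hjk.symm]
      omega
  | cons b l ih =>
    cases b with
    | false =>
      have h1 := does_instr (.top j .tru) s
      simp only [Instr.run, hj, List.map_cons, bitSym, cond_false, List.head?_cons] at h1
      have h2 := (h1.ite (p := seq (instr (.pop j)) (instr (.push k .fls)))
        (does_ret false _)).loop_false
      have h3 := does_instr (.pop j) s
      simp only [Instr.run, hj, List.map_cons] at h3
      have h4 := h2.seq (h3.ite (q := seq (moveAll k j) (ret false))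
        ((does_instr (.push j .tru) _).seq ((does_moveAll hjk.symm _).seq (does_ret true _))))
      refine Eq.mp ?_ (h4.mono (T' := 4 * (false :: l).length + q + 8) ?_)
      · congr 1
        funext r
        simp only [incBits, set₂, Instr.run]
        rcases eq_or_ne r k with rfl | h₁ <;> rcases eq_or_ne r j with rfl | h₂ <;>
          simp_all [Instr.run, bitSym]
      · simp [Instr.run, hk, hjk.symm]
        omega
    | true =>
      have h1 := does_instr (.top j .tru) s
      simp only [Instr.run, hj, List.map_cons, bitSym, cond_true, List.head?_cons] at h1
      have h2 := does_instr (.pop j) s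
      simp only [Instr.run, hj, List.map_cons] at h2
      have h3 := h2.seq (does_instr (.push k .fls) _)
      simp only [Instr.run, List.tail_cons, ne_eq, hjk.symm, not_false_eq_true,
        Function.update_of_ne] at h3
      have h4 := h1.ite (q := ret false) h3
      have h5 := ih (update (update s j (l.map bitSym)) k (.fls :: s k)) (q + 1) (by simp [hjk])
        (by simp [hk, List.replicate_succ])
      have h6 := h4.loop_seq (s₁ := update (update s j (l.map bitSym)) k (.fls :: s k)) (by
        exact h5)
      refine Eq.mp ?_ (h6.mono (T' := 4 * (true :: l).length + q + 8) ?_)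
      · congr 1
        funext r
        simp only [incBits, set₂]
        rcases eq_or_ne r k with rfl | h₁ <;> rcases eq_or_ne r j with rfl | h₂ <;>
          simp_all [List.replicate_succ', bitSym]
      · simp
        omega

theorem does_inc {j k : Reg} (hjk : j ≠ k) (l : List Bool) {s : Store}
    (hj : s j = l.map bitSym) (hk : s k = []) :
    Does (inc j k) s (incBits l).1 (update s j ((incBits l).2.map bitSym)) (4 * l.length + 8) := by
  refine Eq.mp ?_ (does_inc_aux hjk l s 0 hj (by simpa using hk))
  congr 1
  funext r
  simp only [set₂]
  rcases eq_or_ne r k with rfl | h₁ <;> rcases eq_or_ne r j with rfl | h₂ <;> simp_all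

/-- The `L` lowest bits of `k`, lowest first. -/
def bits : ℕ → ℕ → List Bool
  | 0, _ => []
  | L + 1, k => (k % 2 == 1) :: bits L (k / 2)

@[simp] theorem length_bits (L k : ℕ) : (bits L k).length = L := by
  induction L generalizing k with
  | zero => rfl
  | succ L ih => simp [bits, ih]

theorem bits_zero (L : ℕ) : bits L 0 = List.replicate L false := by
  induction L with
  | zero => rfl
  | succ L ih => simp [bits, ih, List.replicate_succ]

/-- Since `bits` truncates to `L` digits, the identity also covers the overflow, after which the
counter reads zero. -/
theorem incBits_bits (L k : ℕ) (hk : k < 2 ^ L) :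
    incBits (bits L k) = (decide (k + 1 < 2 ^ L), bits L (k + 1)) := by
  induction L generalizing k with
  | zero => simp [bits, incBits]
  | succ L ih =>
    rw [pow_succ] at hk ⊢
    rcases Nat.mod_two_eq_zero_or_one k with h | h
    · have h1 : (k + 1) % 2 = 1 := by omega
      have h2 : (k + 1) / 2 = k / 2 := by omega
      have h3 : k + 1 < 2 ^ L * 2 := by omega
      simp [bits, incBits, h, h1, h2, h3]
    · have h1 : (k + 1) % 2 = 0 := by omega
      have h2 : (k + 1) / 2 = k / 2 + 1 := by omega
      have h3 : k / 2 + 1 < 2 ^ L ↔ k + 1 < 2 ^ L * 2 := by omega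
      simp [bits, incBits, h, h1, h2, ih (k / 2) (by omega), h3]

theorem exists_bits (l : List Bool) : ∃ k < 2 ^ l.length, bits l.length k = l := by
  induction l with
  | nil => exact ⟨0, by simp, rfl⟩
  | cons b l ih =>
    obtain ⟨k, hk, h⟩ := ih
    refine ⟨2 * k + b.toNat, ?_, ?_⟩
    · simp only [List.length_cons, pow_succ]
      cases b <;> simp <;> omega
    · have : (2 * k + b.toNat) / 2 = k := by cases b <;> simp; omega
      simp only [List.length_cons, bits, this, h]
      cases b <;> simp

theorem bits_injective {L k k' : ℕ} (hk : k < 2 ^ L) (hk' : k' < 2 ^ L)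
    (h : bits L k = bits L k') : k = k' := by
  induction L generalizing k k' with
  | zero => simp at hk hk'; omega
  | succ L ih =>
    rw [pow_succ] at hk hk'
    simp only [bits, List.cons.injEq] at h
    have := ih (by omega) (by omega) h.2
    have h1 := h.1
    rcases Nat.mod_two_eq_zero_or_one k with h2 | h2 <;>
      rcases Nat.mod_two_eq_zero_or_one k' with h3 | h3 <;> simp [h2, h3] at h1 <;> omega

end Does

end Prog

/-! ### A logic for relations on the positions of a string -/

open GameInstance (Sym)

/-- The binary relations on `Fin N`. -/
abbrev FinRel (N : ℕ) : Type := Fin N → Fin N → Prop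

/-- Formulas with `n` first-order variables, which range over the positions of a string (including
its end), and `m` second-order variables, which range over the binary relations on the positions.
The formula `tab r` says that the relation `r` lies in a given set of relations. -/
inductive Fml : ℕ → ℕ → Type
  | letter {n m : ℕ} (c : Sym) (i : Fin n) : Fml n m
  | lt {n m : ℕ} (i j : Fin n) : Fml n m
  | bit {n m : ℕ} (r : Fin m) (i j : Fin n) : Fml n m
  | tab {n m : ℕ} (r : Fin m) : Fml n m
  | neg {n m : ℕ} (φ : Fml n m) : Fml n m
  | and {n m : ℕ} (φ ψ : Fml n m) : Fml n m
  | exPos {n m : ℕ} (φ : Fml (n + 1) m) : Fml n m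
  | exRel {n m : ℕ} (φ : Fml n (m + 1)) : Fml n m

namespace Fml

def Holds (x : List Sym) (X : FinRel (x.length + 1) → Prop) : ∀ {n m : ℕ}, Fml n m →
    (Fin n → Fin (x.length + 1)) → (Fin m → FinRel (x.length + 1)) → Prop
  | _, _, letter c i, a, _ => x[(a i : ℕ)]? = some c
  | _, _, lt i j, a, _ => a i < a j
  | _, _, bit r i j, a, b => b r (a i) (a j)
  | _, _, tab r, _, b => X (b r)
  | _, _, neg φ, a, b => ¬ φ.Holds x X a b
  | _, _, and φ ψ, a, b => φ.Holds x X a b ∧ ψ.Holds x X a b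
  | _, _, exPos φ, a, b => ∃ v, φ.Holds x X (Fin.snoc a v) b
  | _, _, exRel φ, a, b => ∃ R, φ.Holds x X a (Fin.snoc (α := fun _ => FinRel (x.length + 1)) b R)

/-- The relation on `Fin N` with the given characteristic string. -/
def relOf (N : ℕ) (l : List Bool) : FinRel N := fun i j => l[(i : ℕ) * N + j]? = some true

theorem exists_relOf {N : ℕ} (R : FinRel N) : ∃ l : List Bool, l.length = N * N ∧ relOf N l = R := by
  classical
  rcases Nat.eq_zero_or_pos N with rfl | hN
  · exact ⟨[], rfl, by funext i; exact i.elim0⟩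
  refine ⟨List.ofFn fun k : Fin (N * N) => decide (R ⟨k / N, Nat.div_lt_of_lt_mul k.2⟩
    ⟨k % N, Nat.mod_lt _ hN⟩), by simp, ?_⟩
  funext i j
  have h1 : (i : ℕ) * N + j < N * N := by
    have := Nat.mul_le_mul_right N (Nat.succ_le_of_lt i.2)
    have := j.2
    rw [Nat.succ_mul] at *
    omega
  have h2 : ((i : ℕ) * N + j) / N = i := by
    rw [Nat.add_comm, Nat.add_mul_div_right _ _ hN, Nat.div_eq_of_lt j.2, Nat.zero_add]
  have h3 : ((i : ℕ) * N + j) % N = j := by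
    rw [Nat.add_comm, Nat.add_mul_mod_self_right, Nat.mod_eq_of_lt j.2]
  simp [relOf, h1, h2, h3]

theorem relOf_injective {N : ℕ} {l l' : List Bool} (hl : l.length = N * N)
    (hl' : l'.length = N * N) (h : relOf N l = relOf N l') : l = l' := by
  refine List.ext_getElem (hl.trans hl'.symm) fun k hk hk' => ?_
  have hN : 0 < N := by
    rcases Nat.eq_zero_or_pos N with rfl | hN
    · omega
    · exact hN
  have h1 := congrFun (congrFun h ⟨k / N, Nat.div_lt_of_lt_mul (hl ▸ hk)⟩)
    ⟨k % N, Nat.mod_lt _ hN⟩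
  have h2 : k / N * N + k % N = k := by rw [Nat.mul_comm]; exact Nat.div_add_mod k N
  simp only [relOf, h2, List.getElem?_eq_getElem hk, List.getElem?_eq_getElem hk', Option.some.injEq,
    eq_iff_iff] at h1
  exact Bool.eq_iff_iff.2 h1

/-- The set of relations described by a table of bits. -/
def tabOf (N : ℕ) (tb : List Bool) (R : FinRel N) : Prop :=
  -- The table runs backwards because `Prog.lookup` moves one cell per increment of a counter that
  -- starts at `k`. The overflow comes after `2 ^ (N * N) - k` cells, and the last cell moved is the
  -- one inspected.
  ∃ k < 2 ^ (N * N), relOf N (Prog.bits (N * N) k) = R ∧ tb[2 ^ (N * N) - k - 1]? = some true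

theorem tabOf_relOf {N k : ℕ} (hk : k < 2 ^ (N * N)) (tb : List Bool) :
    tabOf N tb (relOf N (Prog.bits (N * N) k)) ↔ tb[2 ^ (N * N) - k - 1]? = some true := by
  refine ⟨fun ⟨k', hk', h, ht⟩ => ?_, fun h => ⟨k, hk, rfl, h⟩⟩
  have := Prog.bits_injective hk' hk (relOf_injective (by simp) (by simp) h)
  rwa [← this]

theorem exists_tabOf {N : ℕ} (X : FinRel N → Prop) :
    ∃ tb : List Bool, tb.length = 2 ^ (N * N) ∧ tabOf N tb = X := by
  classical
  refine ⟨List.ofFn fun k : Fin (2 ^ (N * N)) =>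
    decide (X (relOf N (Prog.bits (N * N) (2 ^ (N * N) - 1 - k)))), by simp, ?_⟩
  funext R
  obtain ⟨l, hl, rfl⟩ := exists_relOf R
  obtain ⟨k, hk, h⟩ := Prog.exists_bits l
  rw [hl] at hk h
  rw [← h, tabOf_relOf hk]
  have h1 : 2 ^ (N * N) - k - 1 < 2 ^ (N * N) := by omega
  have h2 : 2 ^ (N * N) - 1 - (2 ^ (N * N) - k - 1) = k := by omega
  simp [h1, h2]

end Fml

/-! ### Evaluation of formulas by programs -/

namespace Prog

open Function (update)

/-- Test whether the symbol in `j` whose index is the length of `i` is `c`. -/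
def probe (i j : Reg) (c : Sym) : Prog :=
  seq (skip i j .scr) (after (instr (.top j c)) (moveAll .scr j))

theorem does_probe {i j : Reg} {c : Sym} (hij : i ≠ j) (hi : i ≠ .tmp) (hj : j ≠ .tmp)
    (hi' : i ≠ .scr) (hj' : j ≠ .scr) {s : Store} (hs : s .tmp = []) (hs' : s .scr = []) :
    Does (probe i j c) s ((s j)[(s i).length]? == some c) s
      (4 * (s i).length + (s j).length + 6) := by
  have h1 := does_skip hij hi' hj' hi hj (by simp) hs
  have h2 := does_instr (.top j c) (shift j .scr (s i).length s)
  have h3 := h1.seq (h2.after (does_moveAll_shift hj' (s i).length s hs'))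
  simp only [Instr.run, shift_apply_left hj', List.head?_drop] at h3
  exact h3.mono (by omega)

/-- Test a bit of the relation in `r`. -/
def probeRel (r i j : Reg) : Prog :=
  seq (skipBlocks i r .scr) (seq (skip j r .scr) (after (instr (.top r .tru)) (moveAll .scr r)))

theorem does_probeRel {r i j : Reg} (hir : i ≠ r) (hjr : j ≠ r) (hr : r ≠ .tmp) (hr' : r ≠ .scr)
    (hr'' : r ≠ .tmp') (hrb : r ≠ .blk) (hi : i ≠ .tmp) (hi' : i ≠ .scr) (hi'' : i ≠ .tmp')
    (hib : i ≠ .blk) (hj : j ≠ .tmp) (hj' : j ≠ .scr) {s : Store}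
    (hs : s .tmp = []) (hs' : s .scr = []) (hs'' : s .tmp' = []) :
    Does (probeRel r i j) s ((s r)[(s i).length * (s .blk).length + (s j).length]? == some .tru) s
      ((s i).length * ((s .blk).length * 4 + 6) + (s j).length * 4 + (s r).length + 12) := by
  have h1 := does_skipBlocks hir hi' hr' hi hr (by simp) hr'' (by simp) hrb (by simp) hi'' hib hs
    hs''
  set s₁ := shift r .scr ((s i).length * (s .blk).length) s with hs₁
  have hj₁ : s₁ j = s j := shift_apply_of_ne hjr hj' _ _
  have h2 := does_skip (s := s₁) hjr hj' hr' hj hr (by simp)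
    (by rw [hs₁, shift_apply_of_ne hr.symm (by simp), hs])
  rw [hj₁, hs₁, shift_shift hr'] at h2
  set n := (s i).length * (s .blk).length + (s j).length
  have h3 := does_instr (.top r .tru) (shift r .scr n s)
  have h4 := h1.seq (h2.seq (h3.after (does_moveAll_shift hr' n s hs')))
  simp only [Instr.run, shift_apply_left hr', List.head?_drop] at h4
  exact h4.mono (by omega)

/-- Copy the register `j` to the top of `k`. -/
def copy (j k : Reg) : Prog :=
  seq (moveAll j .tmp) (loop (.ite (instr (.dup .tmp k)) (instr (.move .tmp j)) (ret false)))

theorem does_copy {j k : Reg} (hjk : j ≠ k) (hj : j ≠ .tmp) (hk : k ≠ .tmp) {s : Store}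
    (hs : s .tmp = []) :
    Does (copy j k) s true (update s k (s j ++ s k)) (3 * (s j).length + 3) := by
  have hj' := hj.symm
  have hk' := hk.symm
  have hkj := hjk.symm
  have key : ∀ (l : List Sym) (s : Store), s .tmp = l →
      Does (loop (.ite (instr (.dup .tmp k)) (instr (.move .tmp j)) (ret false))) s true
        (update (set₂ s j k (l.reverse ++ s j) (l.reverse ++ s k)) .tmp []) (2 * l.length + 2) := by
    intro l
    induction l with
    | nil =>
      intro s hs
      have h1 := does_instr (.dup .tmp k) s
      simp only [Instr.run, hs] at h1
      refine Eq.mp ?_ ((h1.ite (p := instr (.move .tmp j)) (does_ret false _)).loop_false)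
      congr 1
      funext r
      simp only [set₂]
      rcases eq_or_ne r .tmp with rfl | h₃
      · simp [hs]
      · rcases eq_or_ne r k with rfl | h₁ <;> rcases eq_or_ne r j with rfl | h₂ <;> simp_all
    | cons a l ih =>
      intro s hs
      have h1 := does_instr (.dup .tmp k) s
      simp only [Instr.run, hs] at h1
      have h2 := does_instr (.move .tmp j) (update s k (a :: s k))
      have h0 : update s k (a :: s k) .tmp = a :: l := by simp [hk', hs]
      simp only [Instr.run, h0] at h2
      have h3 := ih (update (update (update s k (a :: s k)) .tmp l) j
        (a :: update (update s k (a :: s k)) .tmp l j)) (by simp [hj'])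
      have h4 := (h1.ite (q := ret false) h2).loop_true h3
      refine Eq.mp ?_ (h4.mono (T' := 2 * (a :: l).length + 2) (by simp; omega))
      congr 1
      funext r
      simp only [set₂]
      rcases eq_or_ne r .tmp with rfl | h₃
      · simp
      · rcases eq_or_ne r k with rfl | h₁ <;> rcases eq_or_ne r j with rfl | h₂ <;> simp_all
  have h1 := (does_moveAll hj s).seq (key _ _ rfl)
  refine Eq.mp ?_ (h1.mono (T' := 3 * (s j).length + 3) ?_)
  · congr 1
    funext r
    simp only [set₂]
    rcases eq_or_ne r .tmp with rfl | h₃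
    · simp [hs, hk']
    · rcases eq_or_ne r k with rfl | h₁ <;> rcases eq_or_ne r j with rfl | h₂ <;> simp_all
  · simp [hs]
    omega

/-- Look up the relation in `r` in the table of relations. -/
def lookup (r : Reg) : Prog :=
  seq (copy r .scr) (seq (loop (.ite (instr (.move .tab .tab')) (inc .scr .tmp) (ret false)))
    (after (instr (.top .tab' .tru)) (seq (clear .scr) (moveAll .tab' .tab))))

/-- The number `d` of increments left before the overflow is the induction variable. The bound
`htab` ensures that the loop stops by overflow and not because the table is exhausted. -/
theorem does_lookup_loop (L d : ℕ) (hd : 1 ≤ d) (k : ℕ) (hk : k + d = 2 ^ L) (s : Store)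
    (hs : s .scr = (bits L k).map bitSym) (ht : s .tmp = []) (htab : d ≤ (s .tab).length) :
    Does (loop (.ite (instr (.move .tab .tab')) (inc .scr .tmp) (ret false))) s true
      (update (shift .tab .tab' d s) .scr ((bits L (2 ^ L)).map bitSym)) (d * (4 * L + 9)) := by
  induction d generalizing k s with
  | zero => omega
  | succ d ih =>
    have h1 := does_move (j := .tab) (k := .tab') (by simp) s
    have h0 : s .tab ≠ [] := by rintro h; simp [h] at htab
    simp only [ne_eq, h0, not_false_eq_true, decide_true] at h1
    have h2 := does_inc (j := .scr) (k := .tmp) (by simp) (bits L k) (s := shift .tab .tab' 1 s)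
      (by rw [shift_apply_of_ne (by simp) (by simp), hs])
      (by rw [shift_apply_of_ne (by simp) (by simp), ht])
    rw [incBits_bits L k (by omega), length_bits] at h2
    have h3 := h1.ite (q := ret false) h2
    rcases Nat.eq_zero_or_pos d with rfl | hd'
    · have h4 : ¬ k + 1 < 2 ^ L := by omega
      simp only [h4, decide_false] at h3
      have h5 : k + 1 = 2 ^ L := by omega
      rw [h5] at h3
      simp only [Nat.zero_add]
      exact h3.loop_false.mono (by omega)
    · have h4 : k + 1 < 2 ^ L := by omega
      simp only [h4, decide_true] at h3
      have h5 := ih hd' (k + 1) (by omega) (update (shift .tab .tab' 1 s) .scr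
        ((bits L (k + 1)).map bitSym)) (Function.update_self _ _ _)
        (by rw [Function.update_of_ne (by simp), shift_apply_of_ne (by simp) (by simp), ht])
        (by rw [Function.update_of_ne (by simp), shift_apply_left (by simp)]; simp; omega)
      have h6 : update (shift .tab .tab' d (update (shift .tab .tab' 1 s) .scr
          ((bits L (k + 1)).map bitSym))) .scr ((bits L (2 ^ L)).map bitSym) =
          update (shift .tab .tab' (d + 1) s) .scr ((bits L (2 ^ L)).map bitSym) := by
        rw [Nat.add_comm d, ← shift_shift (by simp)]
        funext r
        by_cases hr : r = .scr
        · simp [hr]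
        · simp [shift, set₂, Function.update_apply, hr]
      rw [h6] at h5
      refine (h3.loop_true h5).mono ?_
      rw [Nat.add_mul d 1]
      omega

theorem does_lookup {r : Reg} (hr : r ≠ .scr) (hr' : r ≠ .tmp)
    {L k : ℕ} (hk : k < 2 ^ L) {s : Store} (hs : s r = (bits L k).map bitSym)
    (ht : s .tmp = []) (hsc : s .scr = []) {tb : List Bool} (htab : s .tab = tb.map bitSym)
    (htb : tb.length = 2 ^ L) (htab' : s .tab' = []) :
    Does (lookup r) s (tb[2 ^ L - k - 1]? == some true) s
      (2 ^ L * (4 * L + 10) + 4 * L + 10) := by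
  have h1 := does_copy hr hr' (k := .scr) (by simp) ht
  rw [hsc, List.append_nil, hs] at h1
  set s₁ := update s .scr ((bits L k).map bitSym) with hs₁
  have h2 := does_lookup_loop L (2 ^ L - k) (by omega) k (by omega) s₁ (by simp [hs₁])
    (by simp [hs₁, ht]) (by simp [hs₁, htab, htb])
  set s₂ := update (shift .tab .tab' (2 ^ L - k) s₁) .scr ((bits L (2 ^ L)).map bitSym) with hs₂
  have h3 := does_instr (.top .tab' .tru) s₂
  have h4 := does_clear .scr s₂
  have h5 : update s₂ .scr [] = shift .tab .tab' (2 ^ L - k) s := by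
    funext r
    by_cases hr : r = .scr
    · simp [hr, shift, set₂, hsc]
    · simp [hs₁, hs₂, shift, set₂, Function.update_apply, hr]
  rw [h5] at h4
  have h6 := h4.seq (does_moveAll_shift (by simp) (2 ^ L - k) s htab')
  have h7 := h1.seq (h2.seq (h3.after h6))
  have h8 : (Instr.run s₂ (.top .tab' .tru)).1 = (tb[2 ^ L - k - 1]? == some true) := by
    -- Moving reverses, so the top of `tab'` is the last of the first `2 ^ L - k` cells.
    have e1 : s₂ .tab' = ((tb.take (2 ^ L - k)).map bitSym).reverse := by
      simp [hs₂, hs₁, shift, set₂, htab, htab']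
    have e2 : (tb.take (2 ^ L - k)).length - 1 = 2 ^ L - k - 1 := by
      rw [List.length_take, htb]; omega
    have e3 : 2 ^ L - k - 1 < 2 ^ L - k := by omega
    simp only [Instr.run, e1, List.head?_reverse, List.getLast?_eq_getElem?, List.length_map,
      List.getElem?_map, e2, List.getElem?_take, e3, if_true]
    cases h : tb[2 ^ L - k - 1]? with
    | none => rfl
    | some b => cases b <;> rfl
  rw [h8] at h7
  refine h7.mono ?_
  have e1 : (s₂ .scr).length = L := by simp [hs₂]
  have e2 : (2 ^ L - k) * (4 * L + 9) ≤ 2 ^ L * (4 * L + 9) :=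
    Nat.mul_le_mul_right _ (Nat.sub_le _ _)
  have e3 : (s .tab).length = 2 ^ L := by simp [htab, htb]
  simp only [e1, e3, List.length_map, length_bits]
  nlinarith

theorem does_fill {j k : Reg} (c : Sym) (hjk : j ≠ k) (hj : j ≠ .tmp) (hk : k ≠ .tmp) {s : Store}
    (hs : s .tmp = []) :
    Does (forEach j .tmp (instr (.push k c))) s true
      (update s k (List.replicate (s j).length c ++ s k)) ((s j).length * 4 + 3) := by
  have := does_forEach (p := instr (.push k c)) hj
    (fun n => update s k (List.replicate n c ++ s k)) (T := 1) ?_ ?_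
  · simp only [List.replicate_zero, List.nil_append, Function.update_eq_self] at this
    exact this
  · intro n _
    simp [hjk, hk.symm, hs]
  · intro n _ l l'
    refine ⟨true, ?_⟩
    have h1 := does_instr (.push k c)
      (set₂ (update s k (List.replicate n c ++ s k)) j .tmp l l')
    refine Eq.mp ?_ h1
    congr 1
    funext r
    simp only [set₂, Instr.run]
    rcases eq_or_ne r .tmp with rfl | h₃
    · simp [hk.symm]
    · rcases eq_or_ne r k with rfl | h₁ <;> rcases eq_or_ne r j with rfl | h₂ <;>
        simp_all [List.replicate_succ]

/-- Search for a value of the first-order variable `n` for which `p` returns `true`. -/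
def searchPos (n : ℕ) (p : Prog) : Prog :=
  seq (forEach .blk .tmp (instr (.push (.rem n) .tick)))
    (seq (loop (.ite (instr (.top (.rem n) .tick))
      (.ite p (ret false) (instr (.move (.rem n) (.num n)))) (ret false)))
      (after (instr (.top (.rem n) .tick)) (seq (clear (.rem n)) (clear (.num n)))))

/-- The candidate `v` is kept in unary in `num n` and the complement `N - v` in `rem n`. The loop
stops at the first success or when `rem n` is used up, so the search succeeded iff `rem n` is not
empty afterwards. -/
theorem does_searchPos {n N T : ℕ} {p : Prog} {s : Store} (f : ℕ → Bool)
    (ht : s .tmp = []) (hn : s (.num n) = []) (hr : s (.rem n) = [])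
    (hb : s .blk = List.replicate N .tick)
    (hp : ∀ v < N, Does p
      (set₂ s (.num n) (.rem n) (List.replicate v .tick) (List.replicate (N - v) .tick)) (f v)
      (set₂ s (.num n) (.rem n) (List.replicate v .tick) (List.replicate (N - v) .tick)) T) {b : Bool}
    (hbf : b = true ↔ ∃ v < N, f v = true) :
    Does (searchPos n p) s b s (N * (T + 6) + N + 20) := by
  set S : ℕ → Store := fun v =>
    set₂ s (.num n) (.rem n) (List.replicate v .tick) (List.replicate (N - v) .tick) with hS
  -- The loop started at the candidate `v` stops at `w`, with `w = N` if there is no success.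
  have key : ∀ d v, v + d = N → ∃ w ≤ N, (w < N ↔ ∃ v' < N, v ≤ v' ∧ f v' = true) ∧
      Does (loop (.ite (instr (.top (.rem n) .tick))
        (.ite p (ret false) (instr (.move (.rem n) (.num n)))) (ret false))) (S v) true (S w)
        (d * (T + 2) + 2) := by
    intro d
    induction d with
    | zero =>
      intro v hv
      obtain rfl : v = N := hv
      refine ⟨v, le_rfl, ⟨fun h => absurd h (lt_irrefl _), fun ⟨v', h, h', _⟩ => by omega⟩, ?_⟩
      have h1 := does_instr (.top (.rem n) .tick) (S v)
      have h2 : S v (.rem n) = [] := by simp [hS, set₂]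
      simp only [Instr.run, h2] at h1
      exact (h1.ite (p := .ite p (ret false) (instr (.move (.rem n) (.num n))))
        (does_ret false _)).loop_false.mono (by omega)
    | succ d ih =>
      intro v hv
      have h1 := does_instr (.top (.rem n) .tick) (S v)
      have h2 : S v (.rem n) = .tick :: List.replicate (N - (v + 1)) .tick := by
        have : N - v = N - (v + 1) + 1 := by omega
        simp [hS, set₂, this, List.replicate_succ]
      simp only [Instr.run, h2] at h1
      have hpv := hp v (by omega)
      cases hf : f v with
      | true =>
        refine ⟨v, by omega, ⟨fun h => ⟨v, h, le_rfl, hf⟩, fun _ => by omega⟩, ?_⟩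
        rw [hf] at hpv
        have h3 := hpv.ite (q := instr (.move (.rem n) (.num n))) (does_ret false _)
        refine (h1.ite (q := ret false) h3).loop_false.mono ?_
        rw [Nat.add_mul d 1]
        omega
      | false =>
        obtain ⟨w, hw, hw', h4⟩ := ih (v + 1) (by omega)
        refine ⟨w, hw, hw'.trans ?_, ?_⟩
        · refine ⟨fun ⟨v', h, h', h''⟩ => ⟨v', h, by omega, h''⟩, fun ⟨v', h, h', h''⟩ =>
            ⟨v', h, ?_, h''⟩⟩
          rcases h'.lt_or_eq with h' | rfl
          · exact h'
          · rw [hf] at h''; cases h''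
        · rw [hf] at hpv
          have h5 := does_instr (.move (.rem n) (.num n)) (S v)
          simp only [Instr.run, h2] at h5
          have h6 : update (update (S v) (.rem n) (List.replicate (N - (v + 1)) .tick)) (.num n)
              (.tick :: update (S v) (.rem n) (List.replicate (N - (v + 1)) .tick) (.num n)) =
              S (v + 1) := by
            funext r
            simp only [hS, set₂]
            rcases eq_or_ne r (.num n) with rfl | h₁
            · simp [List.replicate_succ]
            · rcases eq_or_ne r (.rem n) with rfl | h₂ <;> simp_all
          rw [h6] at h5
          refine ((h1.ite (q := ret false) (hpv.ite (p := ret false) h5)).loop_true h4).mono ?_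
          rw [Nat.add_mul d 1]
          omega
  obtain ⟨w, hw, hw', h2⟩ := key N 0 (Nat.zero_add N)
  have h1 := does_fill (j := .blk) (k := .rem n) .tick (by simp) (by simp) (by simp) ht
  have e1 : update s (.rem n) (List.replicate (s .blk).length .tick ++ s (.rem n)) = S 0 := by
    funext r
    simp only [hS, set₂]
    rcases eq_or_ne r (.num n) with rfl | h₁
    · simp [hn]
    · rcases eq_or_ne r (.rem n) with rfl | h₂ <;> simp_all
  rw [e1] at h1
  have h3 := does_instr (.top (.rem n) .tick) (S w)
  have h4 := (does_clear (.rem n) (S w)).seq (does_clear (.num n) _)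
  have e2 : update (update (S w) (.rem n) []) (.num n) [] = s := by
    funext r
    simp only [hS, set₂]
    rcases eq_or_ne r (.num n) with rfl | h₁
    · simp [hn]
    · rcases eq_or_ne r (.rem n) with rfl | h₂ <;> simp_all
  rw [e2] at h4
  have h5 := h1.seq (h2.seq (h3.after h4))
  have e3 : (Instr.run (S w) (.top (.rem n) .tick)).1 = b := by
    rw [Bool.eq_iff_iff, hbf]
    have : (∃ v < N, f v = true) ↔ w < N := by
      rw [hw']
      simp
    rw [this]
    rcases hw.lt_or_eq with h | rfl
    · have : N - w = N - w - 1 + 1 := by omega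
      simp only [Instr.run, hS, set₂]
      rw [this]
      simp [List.replicate_succ, h]
    · simp [Instr.run, hS, set₂]
  rw [e3] at h5
  refine h5.mono ?_
  simp [hS, set₂, hb]
  have e4 : N * (T + 6) = N * (T + 2) + N * 4 := by ring
  omega

/-- Search for a value of the second-order variable `m` for which `p` returns `true`. -/
def searchRel (m : ℕ) (p : Prog) : Prog :=
  seq (forEach .zer .tmp (instr (.push (.rel m) .fls)))
    (seq (loop (.ite p (seq (instr (.push (.flag m) .tick)) (ret false)) (inc (.rel m) .tmp)))
      (after (instr (.pop (.flag m))) (clear (.rel m))))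

/-- The candidates are run through by a binary counter in `rel m`. Success and overflow both end the
loop with the value `false`; the register `flag m` records which of them occurred. -/
theorem does_searchRel {m L T : ℕ} {p : Prog} {s : Store} (f : ℕ → Bool)
    (ht : s .tmp = []) (hm : s (.rel m) = []) (hf : s (.flag m) = [])
    (hz : s .zer = List.replicate L .fls)
    (hp : ∀ k < 2 ^ L, Does p (update s (.rel m) ((bits L k).map bitSym)) (f k)
      (update s (.rel m) ((bits L k).map bitSym)) T) {b : Bool}
    (hbf : b = true ↔ ∃ k < 2 ^ L, f k = true) :
    Does (searchRel m p) s b s (2 ^ L * (T + 4 * L + 10) + 5 * L + 20) := by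
  set S : ℕ → Store := fun k => update s (.rel m) ((bits L k).map bitSym) with hS
  have key : ∀ d k, 1 ≤ d → k + d = 2 ^ L → ∃ w, ∃ c : Bool,
      (c = true ↔ ∃ k' < 2 ^ L, k ≤ k' ∧ f k' = true) ∧
      Does (loop (.ite p (seq (instr (.push (.flag m) .tick)) (ret false)) (inc (.rel m) .tmp)))
        (S k) true (update (S w) (.flag m) (bif c then [.tick] else [])) (d * (T + 4 * L + 10)) := by
    intro d
    induction d with
    | zero => intro k h; omega
    | succ d ih =>
      intro k _ hk
      have hpk := hp k (by omega)
      cases hfk : f k with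
      | true =>
        refine ⟨k, true, ⟨fun _ => ⟨k, by omega, le_rfl, hfk⟩, fun _ => rfl⟩, ?_⟩
        rw [hfk] at hpk
        have h1 := (does_instr (.push (.flag m) .tick) (S k)).seq (does_ret false _)
        have e1 : (Instr.run (S k) (.push (.flag m) .tick)).2 =
            update (S k) (.flag m) (bif true then [.tick] else []) := by
          simp [Instr.run, hS, hf]
        rw [e1] at h1
        refine (hpk.ite (q := inc (.rel m) .tmp) h1).loop_false.mono ?_
        rw [Nat.add_mul d 1]
        omega
      | false =>
        rw [hfk] at hpk
        have h1 := does_inc (j := .rel m) (k := .tmp) (by simp) (bits L k) (s := S k)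
          (by simp [hS]) (by simp [hS, ht])
        rw [incBits_bits L k (by omega), length_bits] at h1
        have e1 : update (S k) (.rel m) ((bits L (k + 1)).map bitSym) = S (k + 1) := by
          simp [hS]
        simp only [e1] at h1
        have h2 := hpk.ite (p := seq (instr (.push (.flag m) .tick)) (ret false)) h1
        rcases Nat.eq_zero_or_pos d with rfl | hd
        · have h4 : ¬ k + 1 < 2 ^ L := by omega
          simp only [h4, decide_false] at h2
          refine ⟨k + 1, false, ⟨by simp, fun ⟨k', h, h', h''⟩ => ?_⟩, ?_⟩
          · obtain rfl : k = k' := by omega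
            rw [hfk] at h''
            cases h''
          · have e2 : update (S (k + 1)) (.flag m) (bif false then [.tick] else []) =
                S (k + 1) := by
              funext r
              by_cases h : r = .flag m
              · simp [h, hS, hf]
              · simp [h]
            rw [e2]
            exact h2.loop_false.mono (by omega)
        · have h4 : k + 1 < 2 ^ L := by omega
          simp only [h4, decide_true] at h2
          obtain ⟨w, c, hc, h5⟩ := ih (k + 1) hd (by omega)
          refine ⟨w, c, hc.trans ?_, (h2.loop_true h5).mono ?_⟩
          · refine ⟨fun ⟨v', h, h', h''⟩ => ⟨v', h, by omega, h''⟩, fun ⟨v', h, h', h''⟩ =>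
              ⟨v', h, ?_, h''⟩⟩
            rcases h'.lt_or_eq with h' | rfl
            · exact h'
            · rw [hfk] at h''; cases h''
          · rw [Nat.add_mul d 1]
            omega
  obtain ⟨w, c, hc, h2⟩ := key (2 ^ L) 0 Nat.one_le_two_pow (Nat.zero_add _)
  have h1 := does_fill (j := .zer) (k := .rel m) .fls (by simp) (by simp) (by simp) ht
  have e1 : update s (.rel m) (List.replicate (s .zer).length .fls ++ s (.rel m)) = S 0 := by
    simp [hS, hm, hz, bits_zero, bitSym]
  rw [e1] at h1
  obtain rfl : c = b := by
    rw [Bool.eq_iff_iff, hc, hbf]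
    simp
  have h3 := does_instr (.pop (.flag m)) (update (S w) (.flag m) (bif c then [.tick] else []))
  have h4 := h3.after (does_clear (.rel m) _)
  have e2 : update (Instr.run (update (S w) (.flag m) (bif c then [.tick] else []))
      (.pop (.flag m))).2 (.rel m) [] = s := by
    funext r
    simp only [hS, Instr.run]
    rcases eq_or_ne r (.rel m) with rfl | h₁
    · simp [hm]
    · rcases eq_or_ne r (.flag m) with rfl | h₂
      · cases c <;> simp [hf]
      · simp [h₁, h₂]
  have e3 : (Instr.run (update (S w) (.flag m) (bif c then [.tick] else []))
      (.pop (.flag m))).1 = c := by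
    cases c <;> simp [Instr.run]
  rw [e2, e3] at h4
  refine (h1.seq (h2.seq h4)).mono ?_
  simp [hS, Instr.run, hz]
  omega

end Prog

open GameInstance (Sym)

namespace Prog

open Function (update)
open Fml (relOf tabOf)

/-- The program that evaluates a formula. -/
def eval : ∀ {n m : ℕ}, Fml n m → Prog
  | _, _, .letter c i => probe (.num i) .inp c
  -- The test `probe` moves symbols of one register while counting with the other, so equal
  -- variables need a separate case.
  | _, _, .lt i j => if i = j then ret false else probe (.num i) (.num j) .tick
  | _, _, .bit r i j => probeRel (.rel r) (.num i) (.num j)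
  | _, _, .tab r => lookup (.rel r)
  | _, _, .neg φ => .ite (eval φ) (ret false) (ret true)
  | _, _, .and φ ψ => .ite (eval φ) (eval ψ) (ret false)
  | n, _, .exPos φ => searchPos n (eval φ)
  | _, m, .exRel φ => searchRel m (eval φ)

/-- The store contains the string `x`, the table `tb` and the values `a` and `b` of the
variables. -/
structure Layout (x : List Sym) (tb : List Bool) {n m : ℕ} (a : Fin n → Fin (x.length + 1))
    (b : Fin m → List Bool) (s : Store) : Prop where
  inp : s .inp = x
  tmp : s .tmp = []
  tmp' : s .tmp' = []
  scr : s .scr = []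
  tab' : s .tab' = []
  blk : s .blk = List.replicate (x.length + 1) .tick
  zer : s .zer = List.replicate ((x.length + 1) * (x.length + 1)) .fls
  tab : s .tab = tb.map bitSym
  num : ∀ i : Fin n, s (.num i) = List.replicate (a i) .tick
  num_idle : ∀ d, n ≤ d → s (.num d) = []
  rem_idle : ∀ d, n ≤ d → s (.rem d) = []
  rel : ∀ i : Fin m, s (.rel i) = (b i).map bitSym
  length_rel : ∀ i : Fin m, (b i).length = (x.length + 1) * (x.length + 1)
  rel_idle : ∀ d, m ≤ d → s (.rel d) = []
  flag_idle : ∀ d, m ≤ d → s (.flag d) = []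

/-- A variable lives in the register with its own number, so nested searches never share a register.
The contents `l` of `rem n` are arbitrary, since only the enclosing search uses them. -/
theorem Layout.pos {x : List Sym} {tb : List Bool} {n m : ℕ} {a : Fin n → Fin (x.length + 1)}
    {b : Fin m → List Bool} {s : Store} (h : Layout x tb a b s) (v : Fin (x.length + 1))
    (l : List Sym) :
    Layout x tb (Fin.snoc a v : Fin (n + 1) → Fin (x.length + 1)) b
      (set₂ s (.num n) (.rem n) (List.replicate v .tick) l) where
  inp := by simp [set₂, h.inp]
  tmp := by simp [set₂, h.tmp]
  tmp' := by simp [set₂, h.tmp']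
  scr := by simp [set₂, h.scr]
  tab' := by simp [set₂, h.tab']
  blk := by simp [set₂, h.blk]
  zer := by simp [set₂, h.zer]
  tab := by simp [set₂, h.tab]
  num i := by
    cases i using Fin.lastCases with
    | last => simp [set₂]
    | cast i => simp [set₂, i.2.ne, h.num]
  num_idle d hd := by
    have : d ≠ n := by omega
    simp [set₂, this, h.num_idle d (by omega)]
  rem_idle d hd := by
    have : d ≠ n := by omega
    simp [set₂, this, h.rem_idle d (by omega)]
  rel i := by simp [set₂, h.rel]
  length_rel := h.length_rel
  rel_idle d hd := by simp [set₂, h.rel_idle d hd]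
  flag_idle d hd := by simp [set₂, h.flag_idle d hd]

theorem Layout.bits {x : List Sym} {tb : List Bool} {n m : ℕ} {a : Fin n → Fin (x.length + 1)}
    {b : Fin m → List Bool} {s : Store} (h : Layout x tb a b s) {l : List Bool}
    (hl : l.length = (x.length + 1) * (x.length + 1)) :
    Layout x tb a (Fin.snoc (α := fun _ => List Bool) b l)
      (update s (.rel m) (l.map bitSym)) where
  inp := by simp [h.inp]
  tmp := by simp [h.tmp]
  tmp' := by simp [h.tmp']
  scr := by simp [h.scr]
  tab' := by simp [h.tab']
  blk := by simp [h.blk]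
  zer := by simp [h.zer]
  tab := by simp [h.tab]
  num i := by simp [h.num]
  num_idle d hd := by simp [h.num_idle d hd]
  rem_idle d hd := by simp [h.rem_idle d hd]
  rel i := by
    cases i using Fin.lastCases with
    | last => simp
    | cast i => simp [i.2.ne, h.rel]
  length_rel i := by
    cases i using Fin.lastCases with
    | last => simpa using hl
    | cast i => simpa using h.length_rel i
  rel_idle d hd := by
    have : d ≠ m := by omega
    simp [this, h.rel_idle d (by omega)]
  flag_idle d hd := by simp [h.flag_idle d (by omega)]

section Bounds

variable {N Z : ℕ}

theorem two_le_two_pow_sq (hN : 1 ≤ N) : 2 ≤ 2 ^ (N * N) :=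
  (pow_one 2).symm.le.trans (Nat.pow_le_pow_right (by norm_num) (Nat.mul_pos hN hN))

theorem le_two_pow_sq : N ≤ 2 ^ (N * N) :=
  (Nat.le_mul_self N).trans (Nat.lt_two_pow_self).le

theorem sq_le_two_pow_sq : N * N ≤ 2 ^ (N * N) := Nat.lt_two_pow_self.le

/-- As `64 = 2 ^ 6 ≤ Z ^ 6`, constant factors are absorbed in the exponent; this is where each `+ 6`
below comes from. -/
theorem le_pow_of_le (hZ : 2 ≤ Z) {c e : ℕ} (h : c ≤ 64 * Z ^ e) : c ≤ Z ^ (e + 6) := by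
  refine h.trans ?_
  rw [pow_add, Nat.mul_comm]
  exact Nat.mul_le_mul_left _ ((by norm_num : 64 = 2 ^ 6).le.trans (Nat.pow_le_pow_left hZ 6))

end Bounds

theorem relOf_snoc {N m : ℕ} (b : Fin m → List Bool) (l : List Bool) :
    (fun i => relOf N (Fin.snoc (α := fun _ => List Bool) b l i)) =
      Fin.snoc (α := fun _ => FinRel N) (fun i => relOf N (b i)) (relOf N l) := by
  funext i
  cases i using Fin.lastCases with
  | last => simp
  | cast i => simp

/-- With `N = |x| + 1`, let `Z = 2 ^ (N * N)` be the number of relations, which is also the length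
of the table. Atoms cost a polynomial in `Z`, and a quantifier multiplies the cost by at most a
polynomial in `Z`, so the exponent depends on the formula alone. The store is restored, so a
subformula can be evaluated again for each candidate. -/
theorem does_eval {n m : ℕ} (φ : Fml n m) : ∃ e, ∀ (x : List Sym) (tb : List Bool)
    (a : Fin n → Fin (x.length + 1)) (b : Fin m → List Bool) (s : Store) (v : Bool),
    tb.length = 2 ^ ((x.length + 1) * (x.length + 1)) → Layout x tb a b s →
    (v = true ↔ φ.Holds x (tabOf (x.length + 1) tb) a fun i => relOf (x.length + 1) (b i)) →
    Does (eval φ) s v s ((2 ^ ((x.length + 1) * (x.length + 1))) ^ e) := by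
  classical
  induction φ with
  | letter c i =>
    refine ⟨1 + 6, fun x tb a b s v htb h hv => ?_⟩
    have h1 := does_probe (i := .num i) (j := .inp) (c := c) (by simp) (by simp) (by simp) (by simp)
      (by simp) h.tmp h.scr
    rw [h.inp, h.num, List.length_replicate] at h1
    have h2 : (x[(a i : ℕ)]? == some c) = v := by
      rw [Bool.eq_iff_iff, hv]
      simp [Fml.Holds]
    rw [h2] at h1
    refine h1.mono (le_pow_of_le (two_le_two_pow_sq (by omega)) ?_)
    have := le_two_pow_sq (N := x.length + 1)
    have := (a i).2
    rw [pow_one]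
    omega
  | @lt n m i j =>
    refine ⟨1 + 6, fun x tb a b s v htb h hv => ?_⟩
    have hZ := two_le_two_pow_sq (N := x.length + 1) (by omega)
    by_cases hij : i = j
    · subst hij
      have : v = false := by
        rw [← Bool.not_eq_true, hv]
        simp [Fml.Holds]
      rw [this]
      simp only [eval, if_true]
      exact (does_ret false s).mono (Nat.one_le_pow _ _ (by omega))
    · have hij' : (i : ℕ) ≠ j := fun h => hij (Fin.ext h)
      have h1 := does_probe (i := .num i) (j := .num j) (c := .tick) (by simpa using hij') (by simp)
        (by simp) (by simp) (by simp) h.tmp h.scr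
      rw [h.num, h.num, List.length_replicate, List.length_replicate] at h1
      -- The unary string of `a j` has a symbol with index `a i` iff `a i < a j`.
      have h2 : ((List.replicate (a j : ℕ) Sym.tick)[(a i : ℕ)]? == some .tick) = v := by
        rw [Bool.eq_iff_iff, hv]
        simp only [Fml.Holds, List.getElem?_replicate, Fin.lt_def]
        split_ifs with h <;> simp [h]
      rw [h2] at h1
      simp only [eval, hij, if_false]
      refine h1.mono (le_pow_of_le hZ ?_)
      have := le_two_pow_sq (N := x.length + 1)
      have := (a i).2
      have := (a j).2
      rw [pow_one]
      omega
  | bit r i j =>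
    refine ⟨2 + 6, fun x tb a b s v htb h hv => ?_⟩
    have hZ := two_le_two_pow_sq (N := x.length + 1) (by omega)
    have h1 := does_probeRel (r := .rel r) (i := .num i) (j := .num j) (by simp) (by simp) (by simp)
      (by simp) (by simp) (by simp) (by simp) (by simp) (by simp) (by simp) (by simp) (by simp)
      h.tmp h.scr h.tmp'
    simp only [h.num, h.blk, h.rel, List.length_replicate, List.length_map, h.length_rel] at h1
    have h2 : (((b r).map bitSym)[(a i : ℕ) * (x.length + 1) + (a j : ℕ)]? == some .tru) = v := by
      rw [Bool.eq_iff_iff, hv]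
      simp only [Fml.Holds, relOf, List.getElem?_map]
      cases (b r)[(a i : ℕ) * (x.length + 1) + (a j : ℕ)]? with
      | none => simp
      | some c => cases c <;> simp [bitSym]
    rw [h2] at h1
    refine h1.mono (le_pow_of_le hZ ?_)
    have h3 := le_two_pow_sq (N := x.length + 1)
    have h4 := sq_le_two_pow_sq (N := x.length + 1)
    have h5 := (a i).2
    have h6 := (a j).2
    generalize 2 ^ ((x.length + 1) * (x.length + 1)) = Z at *
    have h7 : (a i : ℕ) * ((x.length + 1) * 4 + 6) ≤ Z * (Z * 4 + 6) :=
      Nat.mul_le_mul (by omega) (by omega)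
    nlinarith
  | tab r =>
    refine ⟨2 + 6, fun x tb a b s v htb h hv => ?_⟩
    have hZ := two_le_two_pow_sq (N := x.length + 1) (by omega)
    obtain ⟨k, hk, hb⟩ := exists_bits (b r)
    rw [h.length_rel] at hk hb
    have h1 := does_lookup (r := .rel r) (by simp) (by simp) hk
      (by rw [h.rel, hb]) h.tmp h.scr h.tab htb h.tab'
    have h2 : (tb[2 ^ ((x.length + 1) * (x.length + 1)) - k - 1]? == some true) = v := by
      rw [Bool.eq_iff_iff, hv]
      simp only [Fml.Holds]
      rw [← hb, Fml.tabOf_relOf hk]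
      simp
    rw [h2] at h1
    refine h1.mono (le_pow_of_le hZ ?_)
    have h4 := sq_le_two_pow_sq (N := x.length + 1)
    generalize 2 ^ ((x.length + 1) * (x.length + 1)) = Z at *
    nlinarith
  | neg φ ih =>
    obtain ⟨e, he⟩ := ih
    refine ⟨e + 6, fun x tb a b s v htb h hv => ?_⟩
    have hZ := two_le_two_pow_sq (N := x.length + 1) (by omega)
    have h1 := he x tb a b s (!v) htb h (by
      simp only [Fml.Holds] at hv
      cases v <;> simp_all)
    have h2 := h1.ite (p := ret false) (q := ret true) (b' := v) (s₂ := s) (T' := 1)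
      (by cases v <;> exact does_ret _ _)
    refine h2.mono (le_pow_of_le hZ ?_)
    have : 1 ≤ (2 ^ ((x.length + 1) * (x.length + 1))) ^ e := Nat.one_le_pow _ _ (by omega)
    omega
  | and φ ψ ih ih' =>
    obtain ⟨e, he⟩ := ih
    obtain ⟨e', he'⟩ := ih'
    refine ⟨(e + e') + 6, fun x tb a b s v htb h hv => ?_⟩
    have hZ := two_le_two_pow_sq (N := x.length + 1) (by omega)
    simp only [Fml.Holds] at hv
    have h1 := he x tb a b s (decide _) htb h decide_eq_true_iff
    have h2 := he' x tb a b s (decide _) htb h decide_eq_true_iff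
    have h4 : 1 ≤ (2 ^ ((x.length + 1) * (x.length + 1))) ^ e' := Nat.one_le_pow _ _ (by omega)
    have h3 := h1.ite (p := eval ψ) (q := ret false) (b' := v) (s₂ := s)
      (T' := (2 ^ ((x.length + 1) * (x.length + 1))) ^ e') (by
        by_cases hφ : φ.Holds x (tabOf (x.length + 1) tb) a fun i => relOf (x.length + 1) (b i)
        · simp only [hφ, true_and] at hv ⊢
          simp only [← hv] at h2
          simpa using h2
        · simp only [hφ, false_and, iff_false, Bool.not_eq_true] at hv ⊢
          rw [hv]
          exact (does_ret _ _).mono h4)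
    refine h3.mono (le_pow_of_le hZ ?_)
    generalize 2 ^ ((x.length + 1) * (x.length + 1)) = Z at *
    rw [pow_add]
    have h5 : 1 ≤ Z ^ e := Nat.one_le_pow _ _ (by omega)
    nlinarith
  | @exPos n m φ ih =>
    obtain ⟨e, he⟩ := ih
    refine ⟨(e + 1) + 6, fun x tb a b s v htb h hv => ?_⟩
    have hZ := two_le_two_pow_sq (N := x.length + 1) (by omega)
    have h1 := does_searchPos (n := n) (N := x.length + 1) (p := eval φ) (s := s)
      (T := (2 ^ ((x.length + 1) * (x.length + 1))) ^ e)
      (fun v => if hv : v < x.length + 1 then decide (φ.Holds x (tabOf (x.length + 1) tb)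
        (Fin.snoc a ⟨v, hv⟩) fun i => relOf (x.length + 1) (b i)) else false)
      h.tmp (h.num_idle n le_rfl) (h.rem_idle n le_rfl) h.blk
      (fun v hv => he x tb _ b _ _ htb (h.pos ⟨v, hv⟩ _) (by simp [hv])) (b := v) (by
        rw [hv]
        simp only [Fml.Holds]
        constructor
        · rintro ⟨v, hv⟩
          exact ⟨v, v.2, by rw [dif_pos v.2]; exact decide_eq_true hv⟩
        · rintro ⟨v, hv, h'⟩
          exact ⟨⟨v, hv⟩, by simpa [hv] using h'⟩)
    refine h1.mono (le_pow_of_le hZ ?_)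
    have h3 := le_two_pow_sq (N := x.length + 1)
    generalize 2 ^ ((x.length + 1) * (x.length + 1)) = Z at *
    have h5 : 1 ≤ Z ^ e := Nat.one_le_pow _ _ (by omega)
    have h6 : (x.length + 1) * (Z ^ e + 6) ≤ Z * (Z ^ e + 6) := Nat.mul_le_mul_right _ h3
    rw [pow_succ]
    nlinarith
  | @exRel n m φ ih =>
    obtain ⟨e, he⟩ := ih
    refine ⟨(e + 2) + 6, fun x tb a b s v htb h hv => ?_⟩
    have hZ := two_le_two_pow_sq (N := x.length + 1) (by omega)
    have h1 := does_searchRel (m := m) (L := (x.length + 1) * (x.length + 1)) (p := eval φ) (s := s)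
      (T := (2 ^ ((x.length + 1) * (x.length + 1))) ^ e)
      (fun k => decide (φ.Holds x (tabOf (x.length + 1) tb) a
        (Fin.snoc (α := fun _ => FinRel (x.length + 1)) (fun i => relOf (x.length + 1) (b i))
          (relOf (x.length + 1) (Prog.bits ((x.length + 1) * (x.length + 1)) k)))))
      h.tmp (h.rel_idle m le_rfl) (h.flag_idle m le_rfl) h.zer
      (fun k hk => he x tb a _ _ _ htb (h.bits (length_bits _ _)) (by
        rw [relOf_snoc, decide_eq_true_iff])) (b := v) (by
        rw [hv]
        simp only [Fml.Holds, decide_eq_true_iff]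
        constructor
        · rintro ⟨R, hR⟩
          obtain ⟨l, hl, rfl⟩ := Fml.exists_relOf R
          obtain ⟨k, hk, hkl⟩ := exists_bits l
          rw [hl] at hk hkl
          exact ⟨k, hk, by rwa [hkl]⟩
        · rintro ⟨k, hk, h'⟩
          exact ⟨_, h'⟩)
    refine h1.mono (le_pow_of_le hZ ?_)
    have h3 := sq_le_two_pow_sq (N := x.length + 1)
    generalize 2 ^ ((x.length + 1) * (x.length + 1)) = Z at *
    generalize (x.length + 1) * (x.length + 1) = L at *
    have h5 : 1 ≤ Z ^ e := Nat.one_le_pow _ _ (by omega)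
    have h6 : Z * (Z ^ e + 4 * L + 10) ≤ Z * (Z ^ e + 4 * Z + 10) :=
      Nat.mul_le_mul_left _ (by omega)
    have h7 : Z * Z ≤ Z ^ e * (Z * Z) := Nat.le_mul_of_pos_left _ h5
    have h8 : Z * Z ^ e ≤ Z ^ e * (Z * Z) := by
      rw [Nat.mul_comm]
      exact Nat.mul_le_mul_left _ (Nat.le_mul_of_pos_left _ (by omega))
    rw [pow_add, pow_two]
    nlinarith

/-! ### The program of a formula with a guessed table -/

theorem Good.seq {P p q : Prog} {f e} (he : Embeds P (Prog.seq p q) f e) {s s₁ : Store} {b : Bool}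
    {t T : ℕ} {Q : Prop} (hp : Does p s b s₁ t)
    (h : ∀ f', Embeds P q f' e → P.Good T (f' q.entry) s₁ Q) :
    P.Good (T + t) (f (entry (Prog.seq p q))) s Q := by
  obtain ⟨t', ht, hp⟩ := hp
  refine Good.mono (Good.exec hp (Embeds.cond he) (T := T) (Q := Q) ?_) (by omega)
  cases b
  · exact h _ (Embeds.else he)
  · exact h _ (Embeds.then he)

/-- Fill the table with arbitrary bits, with a counter in the register `scr`. -/
def guess : Prog :=
  loop (seq (.ite choose (instr (.push .tab .tru)) (instr (.push .tab .fls))) (inc .scr .tmp))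

/-- The counter in `scr` stands at `k` with `d` increments left before the overflow, so exactly `d`
bits are pushed. The disjunctions over the single choices add up to an existential quantifier over
bit lists of length `d`. -/
theorem good_guess {P : Prog} (L T d : ℕ) (hd : 1 ≤ d) {f e} (he : Embeds P guess f e) :
    ∀ (k : ℕ) (_ : k + d = 2 ^ L) (s : Store) (_ : s .scr = (bits L k).map bitSym)
      (_ : s .tmp = []) (Q : List Bool → Prop)
      (_ : ∀ l : List Bool, l.length = d → P.Good T (e true) (update (update s .tab
        (l.map bitSym ++ s .tab)) .scr ((bits L (2 ^ L)).map bitSym)) (Q l)),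
      P.Good (T + d * (4 * L + 10)) (f guess.entry) s (∃ l : List Bool, l.length = d ∧ Q l) := by
  induction d with
  | zero => omega
  | succ d ih =>
    intro k hk s hs ht Q h
    have hbody := Embeds.body he
    have hc := Embeds.cond hbody
    set s' : Bool → Store := fun b => update s .tab (bitSym b :: s .tab) with hs'
    have hinc : ∀ b, Does (inc .scr .tmp) (s' b) (decide (k + 1 < 2 ^ L))
        (update (s' b) .scr ((bits L (k + 1)).map bitSym)) (4 * L + 8) := by
      intro b
      have h2 := does_inc (j := .scr) (k := .tmp) (by simp) (bits L k) (s := s' b)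
        (by simp [hs', hs]) (by simp [hs', ht])
      rwa [incBits_bits L k (by omega), length_bits] at h2
    -- The bit `b` chosen now ends up below all bits pushed later, hence at the end of the list.
    have key : ∀ b, P.Good (T + d * (4 * L + 10))
        (bif decide (k + 1 < 2 ^ L) then f guess.entry else e true)
        (update (s' b) .scr ((bits L (k + 1)).map bitSym))
        (∃ l : List Bool, l.length = d ∧ Q (l ++ [b])) := by
      intro b
      rcases Nat.eq_zero_or_pos d with rfl | hd'
      · have h4 : ¬ k + 1 < 2 ^ L := by omega
        have h5 : k + 1 = 2 ^ L := by omega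
        have h6 : P.Good T (e true) (update (s' b) .scr ((bits L (k + 1)).map bitSym)) (Q [b]) := by
          rw [h5]
          exact h [b] rfl
        simp only [h4, decide_false, cond_false]
        refine (h6.congr ?_).mono (by omega)
        simp
      · have h4 : k + 1 < 2 ^ L := by omega
        simp only [h4, decide_true, cond_true]
        refine ih hd' (k + 1) (by omega) _ (by simp) (by simp [hs', ht])
          (fun l => Q (l ++ [b])) fun l hl => ?_
        have h6 := h (l ++ [b]) (by simp [hl])
        refine Eq.mp ?_ h6
        congr 1
        funext r
        by_cases h1 : r = .scr
        · simp [h1]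
        · by_cases h2 : r = .tab
          · simp [h2, hs']
          · simp [h1, h2, hs']
    have key' : ∀ b, P.Good (T + d * (4 * L + 10) + (4 * L + 8) + 1)
        (bif b then f (.inl (.inr (.inl ()))) else f (.inl (.inr (.inr ())))) s
        (∃ l : List Bool, l.length = d ∧ Q (l ++ [b])) := by
      intro b
      obtain ⟨t, ht, hi⟩ := hinc b
      cases b
      · have h1 : P.Good (T + d * (4 * L + 10) + t) (f (.inr (.inl (entry (inc .scr .tmp)))))
            (s' false) (∃ l : List Bool, l.length = d ∧ Q (l ++ [false])) :=
          Good.exec hi (Embeds.then hbody) (key false)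
        exact Good.mono (Good.exec (.instr (.push .tab .fls) s) (Embeds.else hc) h1) (by omega)
      · have h1 : P.Good (T + d * (4 * L + 10) + t) (f (.inr (.inl (entry (inc .scr .tmp)))))
            (s' true) (∃ l : List Bool, l.length = d ∧ Q (l ++ [true])) :=
          Good.exec hi (Embeds.then hbody) (key true)
        exact Good.mono (Good.exec (.instr (.push .tab .tru) s) (Embeds.then hc) h1) (by omega)
    have hfin := Good.choose (Embeds.cond hc) key'
    refine (Good.mono hfin (by rw [Nat.add_mul d 1]; omega)).congr ?_
    constructor
    · rintro ⟨b, l, hl, hq⟩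
      exact ⟨l ++ [b], by simp [hl], hq⟩
    · rintro ⟨l, hl, hq⟩
      rcases List.eq_nil_or_concat l with rfl | ⟨l', b, rfl⟩
      · simp at hl
      · exact ⟨b, l', by simpa using hl, by simpa using hq⟩

/-- Set up the auxiliary registers. -/
def setup : Prog :=
  seq (instr (.push .blk .tick)) (seq (forEach .inp .tmp (instr (.push .blk .tick)))
    (seq (forEach .blk .tmp (instr (.push .blk' .tick)))
      (seq (forEach .blk .tmp' (forEach .blk' .tmp (instr (.push .zer .fls))))
        (forEach .zer .tmp (instr (.push .scr .fls))))))

/-- The store after `setup`. -/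
def setupStore (x : List Sym) : Store
  | .inp => x
  | .blk => List.replicate (x.length + 1) .tick
  | .blk' => List.replicate (x.length + 1) .tick
  | .zer => List.replicate ((x.length + 1) * (x.length + 1)) .fls
  | .scr => List.replicate ((x.length + 1) * (x.length + 1)) .fls
  | _ => []

/-- The register `blk'` duplicates `blk` because the nested loops that compute `N * N` cannot share
a counter. The zeros in `zer` initialise the candidates of `searchRel`, and those in `scr` the
counter of `guess`. -/
theorem does_setup (x : List Sym) :
    ∃ b, Does setup (update (fun _ => []) .inp x) b (setupStore x)
      (64 * (2 ^ ((x.length + 1) * (x.length + 1))) ^ 2) := by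
  set N := x.length + 1 with hN
  set s₀ : Store := update (fun _ => []) .inp x with hs₀
  have h1 := does_instr (.push .blk .tick) s₀
  set s₁ := (Instr.run s₀ (.push .blk .tick)).2 with hs₁
  have h2 := does_fill (j := .inp) (k := .blk) .tick (by simp) (by simp) (by simp) (s := s₁)
    (by simp [hs₁, hs₀, Instr.run])
  set s₂ := update s₁ .blk (List.replicate (s₁ .inp).length .tick ++ s₁ .blk) with hs₂
  have h3 := does_fill (j := .blk) (k := .blk') .tick (by simp) (by simp) (by simp) (s := s₂)
    (by simp [hs₂, hs₁, hs₀, Instr.run])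
  set s₃ := update s₂ .blk' (List.replicate (s₂ .blk).length .tick ++ s₂ .blk') with hs₃
  have l1 : (s₁ .inp).length = x.length := by simp [hs₁, hs₀, Instr.run]
  have e1 : s₂ .blk = List.replicate N .tick := by
    simp only [hs₂, l1, Function.update_self, hN]
    simp [hs₁, hs₀, Instr.run, List.replicate_succ']
  have e2 : s₃ .blk = List.replicate N .tick := by simp [hs₃, e1]
  have e3 : s₃ .blk' = List.replicate N .tick := by
    simp [hs₃, e1]
    simp [hs₂, hs₁, hs₀, Instr.run]
  have e4 : ∀ r, r ≠ .inp → r ≠ .blk → r ≠ .blk' → s₃ r = [] := by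
    intro r h h' h''
    simp [hs₃, hs₂, hs₁, hs₀, Instr.run, h, h', h'']
  have e5 : s₃ .inp = x := by simp [hs₃, hs₂, hs₁, hs₀, Instr.run]
  have h4 := does_forEach (j := .blk) (k := .tmp')
    (p := forEach .blk' .tmp (instr (.push .zer .fls))) (by simp)
    (fun i => update s₃ .zer (List.replicate (i * N) .fls)) (T := N * 4 + 3) ?_ ?_
  rotate_left
  · intro i _
    simp [e4]
  · intro i _ l l'
    refine ⟨true, ?_⟩
    set s' := set₂ (update s₃ .zer (List.replicate (i * N) .fls)) .blk .tmp' l l' with hs'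
    have h := does_fill (j := .blk') (k := .zer) .fls (by simp) (by simp) (by simp) (s := s')
      (by simp [hs', set₂, e4])
    have e6 : s' .blk' = List.replicate N .tick := by simp [hs', set₂, e3]
    rw [e6, List.length_replicate] at h
    refine Eq.mp ?_ h
    congr 1
    funext r
    simp only [hs', set₂]
    by_cases h1 : r = .zer
    · subst h1
      simp only [ne_eq, reduceCtorEq, not_false_eq_true, Function.update_of_ne,
        Function.update_self]
      rw [List.replicate_append_replicate, Nat.succ_mul, Nat.add_comm]
    · by_cases h2 : r = .tmp'
      · simp [h2]
      · by_cases h3 : r = .blk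
        · simp [h3]
        · simp [h1, h2, h3]
  have e7 : update s₃ .zer (List.replicate (0 * N) .fls) = s₃ := by
    funext r
    by_cases h1 : r = .zer
    · simp [h1, e4]
    · simp [h1]
  simp only [e7, e2, List.length_replicate] at h4
  set s₄ := update s₃ .zer (List.replicate (N * N) .fls) with hs₄
  have h5 := does_fill (j := .zer) (k := .scr) .fls (by simp) (by simp) (by simp) (s := s₄)
    (by simp [hs₄, e4])
  have e8 : update s₄ .scr (List.replicate (s₄ .zer).length .fls ++ s₄ .scr) = setupStore x := by
    funext r
    cases r <;> simp [hs₄, setupStore, e2, e3, e4, e5, hN]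
  rw [e8] at h5
  refine ⟨_, (h1.seq (h2.seq (h3.seq (h4.seq h5)))).mono ?_⟩
  have l2 : (s₄ .zer).length = N * N := by simp [hs₄]
  rw [l1, l2, e1, List.length_replicate]
  have b1 := le_two_pow_sq (N := N)
  have b2 := sq_le_two_pow_sq (N := N)
  have b3 := two_le_two_pow_sq (N := N) (by omega)
  generalize 2 ^ (N * N) = Z at *
  have b4 : x.length ≤ Z := by omega
  nlinarith

/-- The program that guesses a table and evaluates a formula. -/
def guessEval (φ : Fml 0 0) : Prog :=
  seq setup (seq guess (seq (clear .scr) (eval φ)))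

end Prog

/-- The languages that are definable by a formula with a guessed set of relations are
in NEXP. -/
theorem Fml.mem_NEXPRel (φ : Fml 0 0) (L : Set (List Sym))
    (h : ∀ x, x ∈ L ↔ ∃ X, φ.Holds x X Fin.elim0 Fin.elim0) :
    L ∈ NEXPRel (∅ : Set (List Sym)) Sym := by
  classical
  obtain ⟨e, he⟩ := Prog.does_eval φ
  -- With `Z = 2 ^ (N * N)`, the time is at most `64 * Z ^ (e + 3)`: `Z ^ e` for the evaluation, at
  -- most quadratic terms in `Z` for setup and guessing. The `6` absorbs the factor `64`.
  refine Prog.mem_NEXPRel (Prog.guessEval φ) L ((Polynomial.X + 1) ^ 2 * Polynomial.C (e + 3 + 6))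
    fun x => ?_
  set N := x.length + 1 with hN
  have hpoly : 2 ^ (((Polynomial.X + 1) ^ 2 * Polynomial.C (e + 3 + 6) : Polynomial ℕ).eval
      x.length) = (2 ^ (N * N)) ^ (e + 3 + 6) := by
    rw [← pow_mul]
    simp [hN, pow_two]
  rw [hpoly]
  obtain ⟨b, hsetup⟩ := Prog.does_setup x
  have hE := Prog.embeds_self (Prog.guessEval φ)
  have main : ∀ f, Prog.Embeds (Prog.guessEval φ)
      (Prog.seq Prog.guess (Prog.seq (Prog.clear .scr) (Prog.eval φ))) f
        (fun b => .inr (some b)) →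
      (Prog.guessEval φ).Good (1 + (2 ^ (N * N)) ^ e + (N * N + 1) +
        2 ^ (N * N) * (4 * (N * N) + 10))
        (f (Prog.seq Prog.guess (Prog.seq (Prog.clear .scr) (Prog.eval φ))).entry)
        (Prog.setupStore x) (x ∈ L) := by
    intro f hf
    have hg := Prog.good_guess (P := Prog.guessEval φ) (N * N)
      (1 + (2 ^ (N * N)) ^ e + (N * N + 1)) (2 ^ (N * N)) Nat.one_le_two_pow (Prog.Embeds.cond hf)
      0 (Nat.zero_add _) (Prog.setupStore x)
      (by simp [Prog.setupStore, Prog.bits_zero, Prog.bitSym, hN]) (by simp [Prog.setupStore])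
      (fun tb => φ.Holds x (tabOf N tb) Fin.elim0 Fin.elim0) (fun tb htb => ?_)
    · refine Prog.Good.congr hg ?_
      rw [h]
      constructor
      · rintro ⟨tb, -, htb⟩
        exact ⟨_, htb⟩
      · rintro ⟨X, hX⟩
        obtain ⟨tb, htb, rfl⟩ := exists_tabOf X
        exact ⟨tb, htb, hX⟩
    · set s₁ := Function.update (Function.update (Prog.setupStore x) .tab
        (tb.map Prog.bitSym ++ Prog.setupStore x .tab)) .scr
        ((Prog.bits (N * N) (2 ^ (N * N))).map Prog.bitSym) with hs₁
      have hclear := Prog.does_clear .scr s₁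
      have l1 : (s₁ .scr).length = N * N := by simp [hs₁]
      rw [l1] at hclear
      have hlay : Prog.Layout x tb (Fin.elim0 : Fin 0 → Fin (x.length + 1))
          (Fin.elim0 : Fin 0 → List Bool) (Function.update s₁ .scr []) := by
        constructor <;> simp [hs₁, Prog.setupStore]
      refine Prog.Good.seq (Prog.Embeds.then hf) hclear fun f' hf' => ?_
      obtain ⟨t, ht, hex⟩ := he x tb Fin.elim0 Fin.elim0 _
        (decide (φ.Holds x (tabOf N tb) Fin.elim0 Fin.elim0)) htb hlay (by
          rw [decide_eq_true_iff]
          refine iff_of_eq (congrArg _ ?_)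
          funext i
          exact i.elim0)
      change t ≤ (2 ^ (N * N)) ^ e at ht
      exact ((Prog.Good.exec hex hf' (Prog.good_exit _ _)).mono (by omega)).congr
        decide_eq_true_iff
  refine Prog.Good.mono (Prog.Good.seq hE hsetup main) (Prog.le_pow_of_le
    (Prog.two_le_two_pow_sq (by omega)) ?_)
  have b1 := Prog.sq_le_two_pow_sq (N := N)
  have b2 := Prog.two_le_two_pow_sq (N := N) (by omega)
  generalize 2 ^ (N * N) = Z at *
  generalize N * N = M at *
  have b3 : 1 ≤ Z ^ e := Nat.one_le_pow _ _ (by omega)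
  have b4 : Z * (4 * M + 10) ≤ Z * (4 * Z + 10) := Nat.mul_le_mul_left _ (by omega)
  have b5 : Z ^ e ≤ Z ^ (e + 2) := Nat.pow_le_pow_right (by omega) (by omega)
  have b6 : Z ^ 2 ≤ Z ^ (e + 2) := Nat.pow_le_pow_right (by omega) (by omega)
  have b7 : 2 * Z ^ (e + 2) ≤ Z ^ (e + 3) := by
    rw [pow_succ Z (e + 2), Nat.mul_comm]
    exact Nat.mul_le_mul_left _ b2
  nlinarith

/-! ### Positional profiles as functions on the vertices -/

namespace GameArena

variable {P V : Type} {G : GameArena P V}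

/-- The function `f` maps each vertex to a successor. -/
def IsMove (G : GameArena P V) (f : V → V) : Prop := ∀ v, G.edge v (f v)

/-- The profile `s` always plays according to `f`. -/
def Follows (s : G.Profile) (f : V → V) : Prop :=
  ∀ p (h : G.HistOf p), (s p).1 h = f h.1.last

/-- The function that plays as `s` on the vertices of `p` and as `f` elsewhere. -/
def deviate [DecidableEq P] (G : GameArena P V) (p : P) (f s : V → V) (v : V) : V :=
  if G.owner v = p then s v else f v

/-- The points that the iteration of `f` from `a` visits infinitely often. -/
def infSet (f : V → V) (a : V) : Set V := {v | ∀ i, ∃ j, i ≤ j ∧ f^[j] a = v}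

/-- An orbit of a function that returns to `v` once returns to it periodically, so recurrence
reduces to two reachability questions, which the logic can express. -/
theorem mem_infSet_iff {f : V → V} {a v : V} :
    v ∈ infSet f a ↔ (∃ k, f^[k] a = v) ∧ ∃ k, f^[k] (f v) = v := by
  constructor
  · intro h
    obtain ⟨j, -, hj⟩ := h 0
    obtain ⟨j', hj', h'⟩ := h (j + 1)
    refine ⟨⟨j, hj⟩, j' - (j + 1), ?_⟩
    rw [← Function.iterate_succ_apply]
    nth_rewrite 1 [← hj]
    rw [← Function.iterate_add_apply, ← h']
    congr 1
    omega
  · rintro ⟨⟨k, hk⟩, l, hl⟩ i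
    rw [← Function.iterate_succ_apply] at hl
    -- First `k` steps to `v`, then `i` rounds of the closed walk of length `l + 1` through `v`.
    refine ⟨i * (l + 1) + k, by nlinarith, ?_⟩
    rw [Function.iterate_add_apply, hk, Nat.mul_comm, Function.iterate_mul]
    exact Function.iterate_fixed hl i

theorem out_apply {s : G.Profile} {f : V → V} (h : Follows s f) (n : ℕ) :
    (out s).1 n = f^[n] G.start := by
  induction n with
  | zero => rfl
  | succ n ih =>
    rw [Function.iterate_succ_apply', ← ih]
    simp only [out, outHist, Hist.last_extend]
    exact h _ _

theorem out_mem_Muller {s : G.Profile} {f : V → V} (h : Follows s f) (φ : BoolFormula V) :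
    out s ∈ G.Muller φ ↔ φ.Holds (infSet f G.start) := by
  have : (out s).inf = infSet f G.start := by
    ext v
    simp only [Play.inf, infSet, Set.mem_ofPred_eq, out_apply h]
  simp [Muller, this]

/-- The positional strategy that follows `f`. -/
def posStrategy {f : V → V} (hf : G.IsMove f) (p : P) : G.Strategy p :=
  ⟨fun h => f h.1.last, fun h => hf h.1.last⟩

theorem posStrategy_mem {f : V → V} (hf : G.IsMove f) (p : P) : posStrategy hf p ∈ G.Pos p :=
  fun _ _ h => congrArg f h

theorem follows_posStrategy {f : V → V} (hf : G.IsMove f) : Follows (posStrategy hf) f :=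
  fun _ _ => rfl

theorem Follows.update [DecidableEq P] {s : G.Profile} {f g : V → V} (h : Follows s f) {p : P}
    {t : G.Strategy p} (ht : ∀ h, t.1 h = g h.1.last) :
    Follows (Function.update s p t) (G.deviate p f g) := by
  intro q k
  by_cases hq : q = p
  · subst hq
    have := k.2
    simp [deviate, this, ht]
  · have : G.owner k.1.last ≠ p := by rw [k.2]; exact hq
    simp [deviate, this, hq, h q k]

/-- Positionality makes the move at a vertex independent of the history. A vertex at which no
history ends is left open by the profile, and there the default `d` is used; prescribing it makes it
possible to match functions that come from different worlds. -/
theorem exists_follows {s : G.Profile} (hs : ∀ p, s p ∈ G.Pos p) {d : V → V} (hd : G.IsMove d) :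
    ∃ f, G.IsMove f ∧ Follows s f ∧ ∀ v, (¬ ∃ h : G.Hist, h.last = v) → f v = d v := by
  have cast : ∀ p (h : G.Hist) (hp : G.owner h.last = p),
      (s (G.owner h.last)).1 ⟨h, rfl⟩ = (s p).1 ⟨h, hp⟩ := by
    rintro p h rfl
    rfl
  have key : ∀ v, ∃ w, G.edge v w ∧ (∀ p (h : G.HistOf p), h.1.last = v → (s p).1 h = w) ∧
      ((¬ ∃ h : G.Hist, h.last = v) → w = d v) := by
    intro v
    by_cases h : ∃ h : G.Hist, h.last = v
    · obtain ⟨h, rfl⟩ := h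
      refine ⟨(s (G.owner h.last)).1 ⟨h, rfl⟩, (s (G.owner h.last)).2 ⟨h, rfl⟩, fun p k hk => ?_,
        fun h' => absurd ⟨h, rfl⟩ h'⟩
      have hp : G.owner h.last = p := by rw [← hk]; exact k.2
      rw [cast p h hp]
      exact hs p k ⟨h, hp⟩ hk
    · exact ⟨d v, hd v, fun p k hk => absurd ⟨k.1, hk⟩ h, fun _ => rfl⟩
  choose f hf using key
  exact ⟨f, fun v => (hf v).1, fun p h => (hf _).2.1 p h rfl, fun v => (hf v).2.2⟩

theorem exists_isMove (G : GameArena P V) : ∃ f, G.IsMove f := by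
  choose f hf using G.exists_edge
  exact ⟨f, hf⟩

end GameArena

/-! ### Common knowledge of rationality versus undominated sets of profiles -/

namespace EpistemicModel

variable {P V : Type} {G : GameArena P V} {S : ∀ p, Set (G.Strategy p)} (M : EpistemicModel G S)

theorem commonKnowledge_univ : M.commonKnowledge Set.univ = Set.univ := by
  have h1 : M.mutualKnowledge Set.univ = Set.univ := by
    ext; simp [mutualKnowledge, knows]
  have h2 : ∀ i, M.mutualKnowledge^[i] Set.univ = Set.univ := fun i => Function.iterate_fixed h1 i
  simp [commonKnowledge, h2]

variable {M}

theorem mem_of_mem_commonKnowledge {E : Set M.W} {w w' : M.W} (hw : w ∈ M.commonKnowledge E) {p : P}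
    (h : M.R p w w') : w' ∈ E := by
  have : w ∈ M.mutualKnowledge E := by
    simp only [commonKnowledge, Set.mem_iInter] at hw
    simpa using hw 1 le_rfl
  exact Set.mem_iInter.1 this p w' h

/-- Mutual knowledge of order `i + 1` in `w` is mutual knowledge of order `i` in every world that
some player considers possible in `w`. -/
theorem commonKnowledge_of_rel {E : Set M.W} {w w' : M.W} (hw : w ∈ M.commonKnowledge E) {p : P}
    (h : M.R p w w') : w' ∈ M.commonKnowledge E := by
  simp only [commonKnowledge, Set.mem_iInter] at hw ⊢
  intro i hi
  have := hw (i + 1) (by omega)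
  rw [Function.iterate_succ_apply'] at this
  exact Set.mem_iInter.1 this p w' h

end EpistemicModel

namespace GameArena

variable {P V : Type} [DecidableEq P] (G : GameArena P V) (obj : P → BoolFormula V)

/-- Player `p` wins with the profile that follows `f`. -/
def Wins (p : P) (f : V → V) : Prop := (obj p).Holds (infSet f G.start)

/-- With respect to the profiles in `Y` in which the player `p` plays as in `f`, her strategy is
dominated by the one in `s`. -/
def Dominates (Y : Set (V → V)) (p : P) (f s : V → V) : Prop :=
  (∀ g ∈ Y, (∀ v, G.owner v = p → g v = f v) → G.Wins obj p g → G.Wins obj p (G.deviate p g s)) ∧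
    ∃ g ∈ Y, (∀ v, G.owner v = p → g v = f v) ∧ ¬ G.Wins obj p g ∧ G.Wins obj p (G.deviate p g s)

/-- No strategy in a profile in `Y` is dominated. -/
def Undominated (Y : Set (V → V)) : Prop :=
  (∀ f ∈ Y, G.IsMove f) ∧ ∀ f ∈ Y, ∀ p, ¬ ∃ s, G.IsMove s ∧ G.Dominates obj Y p f s

variable {G obj}

/-- The set `Y` is turned into a model in which each player knows her own strategy and nothing else
beyond `Y`. Rationality in a world is then exactly undominatedness, so all worlds are rational and
common knowledge is automatic. -/
theorem exists_ckr_of_undominated [Finite V] {Y : Set (V → V)} (hY : G.Undominated obj Y) {f : V → V}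
    (hf : f ∈ Y) : ∃ t ∈ G.ckr (fun p => G.Muller (obj p)) G.Pos, Follows t f := by
  classical
  let M : EpistemicModel G G.Pos :=
    { W := Y
      finiteW := inferInstance
      R := fun p f g => ∀ v, G.owner v = p → f.1 v = g.1 v
      equivalence_R := fun p => ⟨fun _ _ _ => rfl, fun h v hv => (h v hv).symm,
        fun h h' v hv => (h v hv).trans (h' v hv)⟩
      σ := fun f => posStrategy (hY.1 f.1 f.2)
      σ_mem := fun f p => posStrategy_mem _ p
      σ_eq := fun p f g h => Subtype.ext (funext fun k => h _ k.2) }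
  have hrat : M.rat (fun p => G.Muller (obj p)) = Set.univ := by
    refine Set.eq_univ_of_forall fun w => Set.mem_iInter.2 fun p => ?_
    rintro ⟨s, hs, h1, w', hw', h2, h3⟩
    -- The deviation `s` is completed to a positional profile so that `exists_follows` yields a
    -- function `g` that induces it.
    have hs' : ∀ q, Function.update (posStrategy (hY.1 w.1 w.2)) p s q ∈ G.Pos q := by
      intro q
      by_cases hq : q = p
      · subst hq; simpa using hs
      · simpa [hq] using posStrategy_mem _ q
    obtain ⟨g, hg, hg', -⟩ := exists_follows hs' (hY.1 w.1 w.2)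
    have hsg : ∀ h, s.1 h = g h.1.last := fun h => by simpa using hg' p h
    have key : ∀ u : Y, (out (Function.update (M.σ u) p s) ∈ G.Muller (obj p) ↔
        G.Wins obj p (G.deviate p u.1 g)) := fun u =>
      out_mem_Muller ((follows_posStrategy (hY.1 u.1 u.2)).update hsg) (obj p)
    have key' : ∀ u : Y, (out (M.σ u) ∈ G.Muller (obj p) ↔ G.Wins obj p u.1) := fun u =>
      out_mem_Muller (follows_posStrategy (hY.1 u.1 u.2)) (obj p)
    refine hY.2 w.1 w.2 p ⟨g, hg, fun u hu hwu hwin => ?_, w'.1, w'.2, fun v hv => (hw' v hv).symm,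
      fun h => h2 ((key' w').2 h), (key w').1 (by convert h3)⟩
    refine (key ⟨u, hu⟩).1 ?_
    have := h1 ⟨u, hu⟩ (fun v hv => (hwu v hv).symm) ((key' ⟨u, hu⟩).2 hwin)
    convert this
  refine ⟨posStrategy (hY.1 f hf), ⟨fun p => posStrategy_mem _ p, M, ⟨f, hf⟩, ?_, rfl⟩,
    follows_posStrategy _⟩
  rw [hrat, M.commonKnowledge_univ]
  trivial

/-- The set `Y` consists of all functions followed in some world with common knowledge of
rationality. A class of `R p` may be finer than agreement on the vertices of `p`, but domination
over the coarser class still refutes rationality: the condition of never losing passes to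
subclasses, and the strict improvement survives if the class is that of a world realising it. -/
theorem exists_undominated_of_ckr {t : G.Profile}
    (ht : t ∈ G.ckr (fun p => G.Muller (obj p)) G.Pos) :
    ∃ Y, G.Undominated obj Y ∧ ∃ f ∈ Y, Follows t f := by
  classical
  obtain ⟨-, M, w, hw, rfl⟩ := ht
  set E := M.rat fun p => G.Muller (obj p) with hE
  refine ⟨{f | G.IsMove f ∧ ∃ w ∈ M.commonKnowledge E, Follows (M.σ w) f},
    ⟨fun f hf => hf.1, ?_⟩, ?_⟩
  · rintro f - p ⟨s, hs, h1, g, ⟨hg, u, hu, hgu⟩, hgf, h2, h3⟩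
    -- Rationality is contradicted in the world `u` of the improving profile `g`, not in a world of
    -- `f`, which may lie in another class.
    have hrat : u ∈ M.ratOf (fun p => G.Muller (obj p)) p :=
      Set.mem_iInter.1 (EpistemicModel.mem_of_mem_commonKnowledge hu ((M.equivalence_R p).refl u)) p
    refine hrat ⟨posStrategy hs p, posStrategy_mem hs p, fun w' hw' hwin => ?_, u,
      (M.equivalence_R p).refl u, fun h => h2 ((out_mem_Muller hgu _).1 h), ?_⟩
    -- The default `g` at unreachable vertices makes `f'` agree with `g`, hence with `f`, on all
    -- vertices of `p`; at the reachable ones this follows from `p` knowing her own strategy.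
    · obtain ⟨f', hf', hfw, hd⟩ := exists_follows (M.σ_mem w') hg
      have hagree : ∀ v, G.owner v = p → f' v = f v := by
        intro v hv
        rw [← hgf v hv]
        by_cases h : ∃ h : G.Hist, h.last = v
        · obtain ⟨h, rfl⟩ := h
          have e1 := hfw p ⟨h, hv⟩
          have e2 := hgu p ⟨h, hv⟩
          rw [M.σ_eq p u w' hw'] at e2
          exact e1.symm.trans e2
        · exact hd v h
      have := h1 f' ⟨hf', w', EpistemicModel.commonKnowledge_of_rel hu hw', hfw⟩ hagree
        ((out_mem_Muller hfw _).1 hwin)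
      have h4 := (out_mem_Muller (hfw.update (t := posStrategy hs p) (g := s) fun _ => rfl)
        (obj p)).2 this
      convert h4
    · have h4 := (out_mem_Muller (hgu.update (t := posStrategy hs p) (g := s) fun _ => rfl)
        (obj p)).2 h3
      convert h4
  · obtain ⟨d, hd⟩ := G.exists_isMove
    obtain ⟨f, hf, hfw, -⟩ := exists_follows (M.σ_mem w) hd
    exact ⟨f, ⟨hf, w, hw, hfw⟩, hfw⟩

end GameArena

theorem GameInstance.not_satisfiesVPCKRPos_iff (I : GameInstance) :
    ¬ I.SatisfiesVPCKRPos ↔ ∃ Y, I.arena.Undominated I.obj Y ∧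
      ∃ f ∈ Y, ¬ I.spec.Holds (GameArena.infSet f I.arena.start) := by
  simp only [SatisfiesVPCKRPos, not_forall]
  constructor
  · rintro ⟨t, ht, hout⟩
    obtain ⟨Y, hY, f, hf, hft⟩ := GameArena.exists_undominated_of_ckr ht
    exact ⟨Y, hY, f, hf, fun h => hout ((GameArena.out_mem_Muller hft _).2 h)⟩
  · rintro ⟨Y, hY, f, hf, hspec⟩
    obtain ⟨t, ht, hft⟩ := GameArena.exists_ckr_of_undominated hY hf
    exact ⟨t, ht, fun h => hspec ((GameArena.out_mem_Muller hft _).1 h)⟩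

open GameInstance (Sym encodeNum encodeFormula)

/-! ### Segments of strings -/

/-- The string `l` stands in `x` from position `i` to position `j`. -/
def Seg (x : List Sym) (i : ℕ) (l : List Sym) (j : ℕ) : Prop :=
  i ≤ x.length ∧ j ≤ x.length ∧ x.drop i = l ++ x.drop j

section Seg

variable {x : List Sym} {i j k : ℕ} {l l' : List Sym}

theorem Seg.eq_add (h : Seg x i l j) : j = i + l.length := by
  obtain ⟨hi, hj, h⟩ := h
  have := congrArg List.length h
  simp only [List.length_drop, List.length_append] at this
  omega

theorem seg_nil : Seg x i [] j ↔ i = j ∧ i ≤ x.length := by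
  constructor
  · intro h
    have := h.eq_add
    exact ⟨by simpa using this.symm, h.1⟩
  · rintro ⟨rfl, h⟩
    exact ⟨h, h, rfl⟩

theorem seg_cons {c : Sym} : Seg x i (c :: l) j ↔ x[i]? = some c ∧ Seg x (i + 1) l j := by
  constructor
  · rintro ⟨hi, hj, h⟩
    have h1 : x[i]? = some c := by rw [← List.head?_drop, h]; rfl
    have h2 : i < x.length := (List.getElem?_eq_some_iff.1 h1).1
    refine ⟨h1, h2, hj, ?_⟩
    rw [← List.tail_drop, h]
    rfl
  · rintro ⟨h1, hi, hj, h⟩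
    obtain ⟨h2, rfl⟩ := List.getElem?_eq_some_iff.1 h1
    exact ⟨h2.le, hj, by rw [List.drop_eq_getElem_cons h2, h]; rfl⟩

theorem seg_append : Seg x i (l ++ l') k ↔ ∃ j, Seg x i l j ∧ Seg x j l' k := by
  induction l generalizing i with
  | nil =>
    constructor
    · intro h
      exact ⟨i, seg_nil.2 ⟨rfl, h.1⟩, h⟩
    · rintro ⟨j, h, h'⟩
      obtain ⟨rfl, -⟩ := seg_nil.1 h
      exact h'
  | cons c l ih =>
    rw [List.cons_append, seg_cons, ih]
    simp only [seg_cons, and_assoc, exists_and_left]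

theorem Seg.append (h : Seg x i l j) (h' : Seg x j l' k) : Seg x i (l ++ l') k :=
  seg_append.2 ⟨j, h, h'⟩

theorem seg_full : Seg x 0 l x.length ↔ l = x := by
  simp [Seg, eq_comm]

theorem Seg.right_unique (h : Seg x i l j) (h' : Seg x i l k) : j = k :=
  h.eq_add.trans h'.eq_add.symm

theorem seg_iff_of_length_eq {d : ℕ} (hl : l.length = d) :
    Seg x i l j ↔ i ≤ x.length ∧ j = i + d ∧ ∀ n (h : n < l.length), x[i + n]? = some l[n] := by
  subst hl
  induction l generalizing i with
  | nil =>
    rw [seg_nil]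
    simp
    exact ⟨fun h => ⟨h.2, h.1.symm⟩, fun h => ⟨h.2.symm, h.1⟩⟩
  | cons c l ih =>
    rw [seg_cons, ih]
    constructor
    · rintro ⟨h, h1, h2, h3⟩
      refine ⟨by omega, by simp; omega, fun n hn => ?_⟩
      cases n with
      | zero => exact h
      | succ n =>
        have := h3 n (by simpa using hn)
        rwa [Nat.add_right_comm, Nat.add_assoc] at this
    · rintro ⟨h, h1, h2⟩
      have h3 := h2 0 (by simp)
      refine ⟨h3, (List.getElem?_eq_some_iff.1 h3).1, by simp at h1; omega, fun n hn => ?_⟩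
      have := h2 (n + 1) (by simpa using hn)
      rwa [Nat.add_right_comm, Nat.add_assoc]

theorem seg_encodeNum {a : ℕ} : Seg x i (encodeNum a) j ↔
    (∀ n, i ≤ n → n < i + a → x[n]? = some .tick) ∧ x[i + a]? = some .mark ∧ j = i + a + 1 := by
  induction a generalizing i with
  | zero =>
    simp only [encodeNum, List.replicate_zero, List.nil_append, seg_cons, seg_nil, Nat.add_zero]
    constructor
    · rintro ⟨h, rfl, -⟩
      exact ⟨fun n _ _ => by omega, h, rfl⟩
    · rintro ⟨-, h, rfl⟩
      exact ⟨h, rfl, (List.getElem?_eq_some_iff.1 h).1⟩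
  | succ a ih =>
    have : encodeNum (a + 1) = .tick :: encodeNum a := by
      simp [encodeNum, List.replicate_succ]
    rw [this, seg_cons, ih]
    constructor
    · rintro ⟨h, h1, h2, h3⟩
      refine ⟨fun n hn hn' => ?_, by rwa [Nat.add_right_comm] at h2, by omega⟩
      rcases hn.eq_or_lt with rfl | hn
      · exact h
      · exact h1 n hn (by omega)
    · rintro ⟨h, h1, h2⟩
      exact ⟨h i le_rfl (by omega), fun n hn hn' => h n (by omega) (by omega),
        by rwa [Nat.add_right_comm], by omega⟩

end Seg

/-! ### Truth of formulas as a least fixed point -/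

/-- The number `v` is written in `x` from `i` to `j`. -/
def NumAt (x : List Sym) (i v j : Fin (x.length + 1)) : Prop := Seg x i (encodeNum v) j

def IsSucc {N : ℕ} (i j : Fin N) : Prop := (j : ℕ) = i + 1

/-- The relations `T` and `F` respect the rules for the truth and the falsity of formulas with
`m` variables, where the variables in `θ` are true. -/
def RespectsRules (x : List Sym) (m : Fin (x.length + 1)) (θ T F : FinRel (x.length + 1)) : Prop :=
  ∀ i j k, IsSucc i k →
    (x[(i : ℕ)]? = some .tru → k = j → T i j) ∧
    (x[(i : ℕ)]? = some .fls → k = j → F i j) ∧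
    (x[(i : ℕ)]? = some .var → ∀ v, v < m → NumAt x k v j → (θ v v → T i j) ∧ (¬ θ v v → F i j)) ∧
    (x[(i : ℕ)]? = some .neg → (T k j → F i j) ∧ (F k j → T i j)) ∧
    (x[(i : ℕ)]? = some .conj → ∀ l, (T k l → T l j → T i j) ∧ (T k l → F l j → F i j) ∧
      (F k l → T l j → F i j) ∧ (F k l → F l j → F i j)) ∧
    (x[(i : ℕ)]? = some .disj → ∀ l, (T k l → T l j → T i j) ∧ (T k l → F l j → T i j) ∧
      (F k l → T l j → T i j) ∧ (F k l → F l j → F i j))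

/-- A formula with `m` variables that is true under `θ` is written in `x` from `i` to `j`. -/
def TrueAt (x : List Sym) (m : Fin (x.length + 1)) (θ : FinRel (x.length + 1))
    (i j : Fin (x.length + 1)) : Prop :=
  ∀ T F, RespectsRules x m θ T F → T i j

/-- A formula with `m` variables that is false under `θ` is written in `x` from `i` to `j`. -/
def FalseAt (x : List Sym) (m : Fin (x.length + 1)) (θ : FinRel (x.length + 1))
    (i j : Fin (x.length + 1)) : Prop :=
  ∀ T F, RespectsRules x m θ T F → F i j

section Truth

variable {x : List Sym} {m : Fin (x.length + 1)} {θ : FinRel (x.length + 1)}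

/-- The inclusion of the vertices into the positions. -/
def toPos (m : Fin (x.length + 1)) (v : Fin m) : Fin (x.length + 1) := v.castLE m.2.le

theorem toPos_injective : Function.Injective (toPos m) := fun v w h => by
  have := congrArg Fin.val h
  exact Fin.ext this

theorem toPos_lt (v : Fin m) : toPos m v < m := v.2

theorem exists_toPos {v : Fin (x.length + 1)} (h : v < m) : ∃ w, v = toPos m w :=
  ⟨⟨v, h⟩, rfl⟩

/-- One half of the fixed-point argument: by induction on the formula, any pair closed under the
rules contains actual truth and falsity. -/
theorem rules_of_seg {T F : FinRel (x.length + 1)} (h : RespectsRules x m θ T F)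
    (φ : BoolFormula (Fin m)) : ∀ i j : Fin (x.length + 1), Seg x i (encodeFormula φ) j →
      (φ.Holds {v | θ (toPos m v) (toPos m v)} → T i j) ∧
        (¬ φ.Holds {v | θ (toPos m v) (toPos m v)} → F i j) := by
  have hsucc : ∀ (i : Fin (x.length + 1)) {c : Sym}, x[(i : ℕ)]? = some c →
      ∃ k : Fin (x.length + 1), (k : ℕ) = i + 1 := fun i c hc =>
    ⟨⟨i + 1, by have := (List.getElem?_eq_some_iff.1 hc).1; omega⟩, rfl⟩
  induction φ with
  | tru =>
    intro i j hs
    obtain ⟨hc, hs⟩ := seg_cons.1 hs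
    obtain ⟨k, hk⟩ := hsucc i hc
    have hkj : k = j := Fin.ext (hk.trans (seg_nil.1 hs).1)
    exact ⟨fun _ => (h i j k hk).1 hc hkj, fun hn => absurd trivial hn⟩
  | fls =>
    intro i j hs
    obtain ⟨hc, hs⟩ := seg_cons.1 hs
    obtain ⟨k, hk⟩ := hsucc i hc
    have hkj : k = j := Fin.ext (hk.trans (seg_nil.1 hs).1)
    exact ⟨fun hn => hn.elim, fun _ => (h i j k hk).2.1 hc hkj⟩
  | var v =>
    intro i j hs
    obtain ⟨hc, hs⟩ := seg_cons.1 hs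
    obtain ⟨k, hk⟩ := hsucc i hc
    rw [← hk] at hs
    exact (h i j k hk).2.2.1 hc (toPos m v) (toPos_lt v) hs
  | neg φ ih =>
    intro i j hs
    obtain ⟨hc, hs⟩ := seg_cons.1 hs
    obtain ⟨k, hk⟩ := hsucc i hc
    rw [← hk] at hs
    have h1 := (h i j k hk).2.2.2.1 hc
    have h2 := ih k j hs
    exact ⟨fun hn => h1.2 (h2.2 hn), fun hn => h1.1 (h2.1 (not_not.1 hn))⟩
  | conj φ ψ ih ih' =>
    intro i j hs
    obtain ⟨hc, hs⟩ := seg_cons.1 hs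
    obtain ⟨k, hk⟩ := hsucc i hc
    rw [← hk] at hs
    obtain ⟨l, hl, hl'⟩ := seg_append.1 hs
    obtain ⟨l, rfl⟩ : ∃ l' : Fin (x.length + 1), (l' : ℕ) = l :=
      ⟨⟨l, Nat.lt_succ_of_le hl.2.1⟩, rfl⟩
    have h1 := (h i j k hk).2.2.2.2.1 hc l
    have h2 := ih k l hl
    have h3 := ih' l j hl'
    simp only [BoolFormula.Holds]
    clear ih ih' hsucc h hs hl hl'
    generalize BoolFormula.Holds _ φ = A at *
    generalize BoolFormula.Holds _ ψ = B at *
    generalize T k l = t₁, T l j = t₂, T i j = t₃, F k l = f₁, F l j = f₂, F i j = f₃ at *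
    by_cases A <;> by_cases B <;> simp_all
  | disj φ ψ ih ih' =>
    intro i j hs
    obtain ⟨hc, hs⟩ := seg_cons.1 hs
    obtain ⟨k, hk⟩ := hsucc i hc
    rw [← hk] at hs
    obtain ⟨l, hl, hl'⟩ := seg_append.1 hs
    obtain ⟨l, rfl⟩ : ∃ l' : Fin (x.length + 1), (l' : ℕ) = l :=
      ⟨⟨l, Nat.lt_succ_of_le hl.2.1⟩, rfl⟩
    have h1 := (h i j k hk).2.2.2.2.2 hc l
    have h2 := ih k l hl
    have h3 := ih' l j hl'
    simp only [BoolFormula.Holds]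
    clear ih ih' hsucc h hs hl hl'
    generalize BoolFormula.Holds _ φ = A at *
    generalize BoolFormula.Holds _ ψ = B at *
    generalize T k l = t₁, T l j = t₂, T i j = t₃, F k l = f₁, F l j = f₂, F i j = f₃ at *
    by_cases A <;> by_cases B <;> simp_all

/-- The other half: actual truth and falsity are closed under the rules, so they are the least such
pair. Falsity is generated alongside truth because this keeps the rule for negation positive. -/
theorem respectsRules_seg : RespectsRules x m θ
    (fun i j => ∃ φ : BoolFormula (Fin m), Seg x i (encodeFormula φ) j ∧
      φ.Holds {v | θ (toPos m v) (toPos m v)})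
    (fun i j => ∃ φ : BoolFormula (Fin m), Seg x i (encodeFormula φ) j ∧
      ¬ φ.Holds {v | θ (toPos m v) (toPos m v)}) := by
  intro i j k hk
  have hk : (k : ℕ) = i + 1 := hk
  have bin : ∀ {c : Sym} {l : Fin (x.length + 1)} {φ ψ : BoolFormula (Fin m)},
      x[(i : ℕ)]? = some c → Seg x k (encodeFormula φ) l → Seg x l (encodeFormula ψ) j →
      Seg x i (c :: (encodeFormula φ ++ encodeFormula ψ)) j := by
    intro c l φ ψ hc h h'
    exact seg_cons.2 ⟨hc, hk ▸ h.append h'⟩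
  refine ⟨?_, ?_, ?_, ?_, ?_, ?_⟩
  · rintro hc rfl
    exact ⟨.tru, seg_cons.2 ⟨hc, seg_nil.2 ⟨hk.symm, hk ▸ Nat.le_of_lt_succ k.2⟩⟩, trivial⟩
  · rintro hc rfl
    exact ⟨.fls, seg_cons.2 ⟨hc, seg_nil.2 ⟨hk.symm, hk ▸ Nat.le_of_lt_succ k.2⟩⟩, id⟩
  · intro hc v hv h
    obtain ⟨w, rfl⟩ := exists_toPos hv
    have : Seg x i (encodeFormula (.var w)) j := seg_cons.2 ⟨hc, hk ▸ h⟩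
    exact ⟨fun h' => ⟨.var w, this, h'⟩, fun h' => ⟨.var w, this, h'⟩⟩
  · intro hc
    refine ⟨?_, ?_⟩
    · rintro ⟨φ, h, h'⟩
      exact ⟨.neg φ, seg_cons.2 ⟨hc, hk ▸ h⟩, fun hn => hn h'⟩
    · rintro ⟨φ, h, h'⟩
      exact ⟨.neg φ, seg_cons.2 ⟨hc, hk ▸ h⟩, h'⟩
  · intro hc l
    refine ⟨?_, ?_, ?_, ?_⟩ <;> rintro ⟨φ, h1, h2⟩ ⟨ψ, h3, h4⟩ <;>
      exact ⟨.conj φ ψ, by rw [encodeFormula]; exact bin hc h1 h3,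
        by simp only [BoolFormula.Holds]; tauto⟩
  · intro hc l
    refine ⟨?_, ?_, ?_, ?_⟩ <;> rintro ⟨φ, h1, h2⟩ ⟨ψ, h3, h4⟩ <;>
      exact ⟨.disj φ ψ, by rw [encodeFormula]; exact bin hc h1 h3,
        by simp only [BoolFormula.Holds]; tauto⟩

theorem trueAt_iff {i j : Fin (x.length + 1)} : TrueAt x m θ i j ↔
    ∃ φ : BoolFormula (Fin m), Seg x i (encodeFormula φ) j ∧
      φ.Holds {v | θ (toPos m v) (toPos m v)} :=
  ⟨fun h => h _ _ respectsRules_seg, fun ⟨φ, h, h'⟩ _ _ hr => (rules_of_seg hr φ i j h).1 h'⟩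

theorem falseAt_iff {i j : Fin (x.length + 1)} : FalseAt x m θ i j ↔
    ∃ φ : BoolFormula (Fin m), Seg x i (encodeFormula φ) j ∧
      ¬ φ.Holds {v | θ (toPos m v) (toPos m v)} :=
  ⟨fun h => h _ _ respectsRules_seg, fun ⟨φ, h, h'⟩ _ _ hr => (rules_of_seg hr φ i j h).2 h'⟩

/-- A formula with `m` variables is written in `x` from `i` to `j`. -/
def FormulaAt (x : List Sym) (m i j : Fin (x.length + 1)) : Prop :=
  ∃ θ, TrueAt x m θ i j ∨ FalseAt x m θ i j

/-- Every formula is true or false under any assignment, so well-formedness needs no fixed point of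
its own. -/
theorem formulaAt_iff {i j : Fin (x.length + 1)} : FormulaAt x m i j ↔
    ∃ φ : BoolFormula (Fin m), Seg x i (encodeFormula φ) j := by
  constructor
  · rintro ⟨θ, h | h⟩
    · obtain ⟨φ, h, -⟩ := trueAt_iff.1 h
      exact ⟨φ, h⟩
    · obtain ⟨φ, h, -⟩ := falseAt_iff.1 h
      exact ⟨φ, h⟩
  · rintro ⟨φ, h⟩
    refine ⟨fun _ _ => True, ?_⟩
    by_cases hφ : φ.Holds {v | True}
    · exact .inl (trueAt_iff.2 ⟨φ, h, hφ⟩)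
    · exact .inr (falseAt_iff.2 ⟨φ, h, hφ⟩)

/-- Prefix notation is prefix-free, so the starting position alone determines the formula. -/
theorem Seg.formula_unique {i j j' : ℕ} {φ ψ : BoolFormula (Fin m)}
    (h : Seg x i (encodeFormula φ) j) (h' : Seg x i (encodeFormula ψ) j') : φ = ψ :=
  (GameInstance.encodeFormula_append_inj (h.2.2.symm.trans h'.2.2)).1

end Truth

/-! ### Functions as relations -/

/-- The element `b` can be reached from `a`. -/
def Reach {N : ℕ} (R : FinRel N) (a b : Fin N) : Prop :=
  ∀ S : FinRel N, S a a → (∀ i j, R i j → S i i → S j j) → S b b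

/-- The element `b` is visited infinitely often from `a`. -/
def Recurs {N : ℕ} (R : FinRel N) (a b : Fin N) : Prop :=
  Reach R a b ∧ ∃ c, R b c ∧ Reach R c b

/-- The graph of the function `f` on `Fin m`, as a relation on `Fin N`. -/
def graph {N m : ℕ} (ι : Fin m → Fin N) (f : Fin m → Fin m) : FinRel N :=
  fun a b => ∃ v, a = ι v ∧ b = ι (f v)

section Graph

variable {N m : ℕ} {ι : Fin m → Fin N} {f : Fin m → Fin m}

theorem graph_apply (hι : Function.Injective ι) {v : Fin m} {b : Fin N} :
    graph ι f (ι v) b ↔ b = ι (f v) := by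
  constructor
  · rintro ⟨w, hw, rfl⟩
    rw [hι hw]
  · rintro rfl
    exact ⟨v, rfl, rfl⟩

theorem graph_injective (hι : Function.Injective ι) : Function.Injective (graph ι) := by
  intro f g h
  funext v
  have : graph ι g (ι v) (ι (f v)) := by rw [← h]; exact ⟨v, rfl, rfl⟩
  exact hι ((graph_apply hι).1 this)

/-- The logic has only binary relation variables, so sets are coded by diagonals. The orbit of `v`
is the least set that contains `v` and is closed under the graph. -/
theorem reach_graph_iff (hι : Function.Injective ι) {v : Fin m} {b : Fin N} :
    Reach (graph ι f) (ι v) b ↔ ∃ k, b = ι (f^[k] v) := by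
  constructor
  · intro hr
    refine hr (fun i _ => ∃ k, i = ι (f^[k] v)) ⟨0, rfl⟩ ?_
    rintro i j ⟨w, hw, rfl⟩ ⟨k, rfl⟩
    exact ⟨k + 1, by rw [Function.iterate_succ_apply', ← hι hw]⟩
  · rintro ⟨k, rfl⟩ S h0 hS
    induction k with
    | zero => exact h0
    | succ k ih =>
      rw [Function.iterate_succ_apply']
      exact hS _ _ ⟨_, rfl, rfl⟩ ih

theorem recurs_graph_iff (hι : Function.Injective ι) {v w : Fin m} :
    Recurs (graph ι f) (ι v) (ι w) ↔ w ∈ GameArena.infSet f v := by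
  rw [GameArena.mem_infSet_iff, Recurs, reach_graph_iff hι]
  refine and_congr ?_ ?_
  · exact exists_congr fun k => by rw [hι.eq_iff, eq_comm]
  · simp only [graph_apply hι, exists_eq_left, reach_graph_iff hι, hι.eq_iff, eq_comm]

end Graph

/-! ### Definable predicates -/

/-- The predicates on a string, a set of relations on its positions, `n` positions and
`m` relations. -/
abbrev PosPred (n m : ℕ) : Type :=
  ∀ x : List Sym, (FinRel (x.length + 1) → Prop) → (Fin n → Fin (x.length + 1)) →
    (Fin m → FinRel (x.length + 1)) → Prop

/-- The predicate is expressed by a formula. -/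
def Definable {n m : ℕ} (Q : PosPred n m) : Prop :=
  ∃ φ : Fml n m, ∀ x X a b, φ.Holds x X a b ↔ Q x X a b

namespace Definable

variable {n m : ℕ} {Q Q' : PosPred n m}

theorem congr (h : Definable Q) (hQ : ∀ x X a b, Q x X a b ↔ Q' x X a b) : Definable Q' :=
  let ⟨φ, hφ⟩ := h
  ⟨φ, fun x X a b => (hφ x X a b).trans (hQ x X a b)⟩

theorem letter (c : Sym) (i : Fin n) :
    Definable (m := m) fun x _ a _ => x[(a i : ℕ)]? = some c :=
  ⟨.letter c i, fun _ _ _ _ => Iff.rfl⟩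

theorem lt (i j : Fin n) : Definable (m := m) fun _ _ a _ => a i < a j :=
  ⟨.lt i j, fun _ _ _ _ => Iff.rfl⟩

theorem bit (r : Fin m) (i j : Fin n) : Definable fun _ _ a b => b r (a i) (a j) :=
  ⟨.bit r i j, fun _ _ _ _ => Iff.rfl⟩

theorem tab (r : Fin m) : Definable (n := n) fun _ X _ b => X (b r) :=
  ⟨.tab r, fun _ _ _ _ => Iff.rfl⟩

theorem not (h : Definable Q) : Definable fun x X a b => ¬ Q x X a b :=
  let ⟨φ, hφ⟩ := h
  ⟨.neg φ, fun x X a b => not_congr (hφ x X a b)⟩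

theorem and (h : Definable Q) (h' : Definable Q') :
    Definable fun x X a b => Q x X a b ∧ Q' x X a b :=
  let ⟨φ, hφ⟩ := h
  let ⟨ψ, hψ⟩ := h'
  ⟨.and φ ψ, fun x X a b => and_congr (hφ x X a b) (hψ x X a b)⟩

theorem or (h : Definable Q) (h' : Definable Q') :
    Definable fun x X a b => Q x X a b ∨ Q' x X a b :=
  (h.not.and h'.not).not.congr fun _ _ _ _ => by tauto

theorem imp (h : Definable Q) (h' : Definable Q') :
    Definable fun x X a b => Q x X a b → Q' x X a b :=
  (h.and h'.not).not.congr fun _ _ _ _ => by tauto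

theorem iff (h : Definable Q) (h' : Definable Q') :
    Definable fun x X a b => (Q x X a b ↔ Q' x X a b) :=
  ((h.imp h').and (h'.imp h)).congr fun _ _ _ _ => by tauto

section Pos

variable {U : ∀ x : List Sym, (FinRel (x.length + 1) → Prop) → (Fin n → Fin (x.length + 1)) →
  (Fin m → FinRel (x.length + 1)) → Fin (x.length + 1) → Prop}

/-- The bound variable becomes the last entry of the tuple, as in the semantics with `Fin.snoc`;
formulas are then obtained by following the syntax of a predicate. -/
theorem ex (h : Definable (n := n + 1) (m := m) fun x X a b =>
      U x X (fun i => a i.castSucc) b (a (Fin.last n))) :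
    Definable fun x X a b => ∃ v, U x X a b v := by
  obtain ⟨φ, hφ⟩ := h
  refine ⟨.exPos φ, fun x X a b => exists_congr fun v => ?_⟩
  rw [hφ]
  simp

theorem all (h : Definable (n := n + 1) (m := m) fun x X a b =>
      U x X (fun i => a i.castSucc) b (a (Fin.last n))) :
    Definable fun x X a b => ∀ v, U x X a b v :=
  (ex h.not).not.congr fun _ _ _ _ => not_exists_not

end Pos

section Rel

variable {U : ∀ x : List Sym, (FinRel (x.length + 1) → Prop) → (Fin n → Fin (x.length + 1)) →
  (Fin m → FinRel (x.length + 1)) → FinRel (x.length + 1) → Prop}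

theorem exRel (h : Definable (n := n) (m := m + 1) fun x X a b =>
      U x X a (fun i => b i.castSucc) (b (Fin.last m))) :
    Definable fun x X a b => ∃ R, U x X a b R := by
  obtain ⟨φ, hφ⟩ := h
  refine ⟨.exRel φ, fun x X a b => exists_congr fun R => ?_⟩
  rw [hφ]
  simp

theorem allRel (h : Definable (n := n) (m := m + 1) fun x X a b =>
      U x X a (fun i => b i.castSucc) (b (Fin.last m))) :
    Definable fun x X a b => ∀ R, U x X a b R :=
  (exRel h.not).not.congr fun _ _ _ _ => not_exists_not

end Rel

theorem le (i j : Fin n) : Definable (m := m) fun _ _ a _ => a i ≤ a j :=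
  (lt j i).not.congr fun _ _ _ _ => not_lt

theorem eq (i j : Fin n) : Definable (m := m) fun _ _ a _ => a i = a j :=
  ((le i j).and (le j i)).congr fun _ _ _ _ => le_antisymm_iff.symm

theorem isZero (i : Fin n) : Definable (m := m) fun _ _ a _ => (a i : ℕ) = 0 := by
  refine (all (U := fun x _ a _ v => a i ≤ v) (le _ _)).congr fun x X a b => ?_
  exact ⟨fun h => Nat.le_zero.1 (h 0), fun h v => by rw [Fin.le_def, h]; exact Nat.zero_le _⟩

theorem isLast (i : Fin n) : Definable (m := m) fun x _ a _ => (a i : ℕ) = x.length := by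
  refine (all (U := fun x _ a _ v => v ≤ a i) (le _ _)).congr fun x X a b => ?_
  refine ⟨fun h => ?_, fun h v => by rw [Fin.le_def, h]; exact Nat.le_of_lt_succ v.2⟩
  have := h (Fin.last _)
  rw [Fin.le_def, Fin.val_last] at this
  have := (a i).2
  omega

theorem isSucc (i j : Fin n) : Definable (m := m) fun _ _ a _ => IsSucc (a i) (a j) := by
  refine ((lt i j).and (all (U := fun x _ a _ v => v < a j → v ≤ a i)
    ((lt _ _).imp (le _ _)))).congr fun x X a b => ?_
  constructor
  · rintro ⟨h, h'⟩
    have h1 : (a i : ℕ) < a j := h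
    have h2 := (a j).2
    by_contra hne
    have h3 : ¬ (a j : ℕ) = a i + 1 := hne
    have h4 := h' ⟨a i + 1, by omega⟩ (by rw [Fin.lt_def]; dsimp only; omega)
    rw [Fin.le_def] at h4
    dsimp only at h4
    omega
  · intro h
    have h : (a j : ℕ) = a i + 1 := h
    refine ⟨by rw [Fin.lt_def]; omega, fun v hv => ?_⟩
    rw [Fin.lt_def] at hv
    rw [Fin.le_def]
    omega

end Definable

/-- The position `k` is the sum of `i` and `j`. -/
def IsAdd {N : ℕ} (i j k : Fin N) : Prop := (k : ℕ) = i + j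

/-- Addition is not an atom of the logic. The graph of `u ↦ i + u` is the least relation that
contains `(0, i)` and is closed under taking successors on both sides. -/
theorem isAdd_iff {N : ℕ} [NeZero N] {i j k : Fin N} : IsAdd i j k ↔
    ∀ R : FinRel N, (∀ z : Fin N, (z : ℕ) = 0 → R z i) →
      (∀ u v u' v', IsSucc u u' → IsSucc v v' → R u v → R u' v') → R j k := by
  constructor
  · intro h R h0 hR
    have key : ∀ (l : ℕ) (j k : Fin N), (j : ℕ) = l → (k : ℕ) = i + j → R j k := by
      intro l
      induction l with
      | zero =>
        intro j k hj hk
        obtain rfl : k = i := Fin.ext (by omega)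
        exact h0 j hj
      | succ l ih =>
        intro j k hj hk
        have := j.2
        have := k.2
        exact hR ⟨l, by omega⟩ ⟨i + l, by omega⟩ j k hj
          (show (k : ℕ) = i + l + 1 by omega) (ih _ _ rfl rfl)
    exact key j j k rfl h
  · intro h
    refine h (fun u v => (v : ℕ) = i + u) (fun z hz => by omega) fun u v u' v' hu hv huv => ?_
    have hu : (u' : ℕ) = u + 1 := hu
    have hv : (v' : ℕ) = v + 1 := hv
    omega

theorem numAt_iff {x : List Sym} {i v j : Fin (x.length + 1)} : NumAt x i v j ↔
    ∃ k, IsAdd i v k ∧ (∀ l, i ≤ l → l < k → x[(l : ℕ)]? = some .tick) ∧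
      x[(k : ℕ)]? = some .mark ∧ IsSucc k j := by
  rw [NumAt, seg_encodeNum]
  constructor
  · rintro ⟨h1, h2, h3⟩
    have := (List.getElem?_eq_some_iff.1 h2).1
    exact ⟨⟨i + v, by omega⟩, rfl, fun l hl hl' => h1 l hl hl', h2, h3⟩
  · rintro ⟨k, h1, h2, h3, h4⟩
    have h1 : (k : ℕ) = i + v := h1
    have h4 : (j : ℕ) = k + 1 := h4
    refine ⟨fun n hn hn' => ?_, h1 ▸ h3, by omega⟩
    have := k.2
    exact h2 ⟨n, by omega⟩ hn (by rw [Fin.lt_def]; dsimp only; omega)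

/-! ### The description of instances -/

/-- The description of a vertex, in an instance with `n` players and `m` vertices, is written in
`x` from `i` to `j`. -/
def VertexAt (x : List Sym) (n m i j : Fin (x.length + 1)) : Prop :=
  ∃ o k, o < n ∧ NumAt x i o k ∧ IsAdd k m j ∧
    (∀ l, k ≤ l → l < j → x[(l : ℕ)]? = some .edge ∨ x[(l : ℕ)]? = some .nonEdge) ∧
    ∃ l, k ≤ l ∧ l < j ∧ x[(l : ℕ)]? = some .edge

/-- The relation `R` maps each `v ≤ n` to a position, so that `0` is mapped to `i`, `n` is mapped
to `j`, and each position is related by `Q` to the next one. -/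
def Chain {N : ℕ} (Q : Fin N → Fin N → Prop) (R : FinRel N) (n i j : Fin N) : Prop :=
  (∀ v a b, R v a → R v b → a = b) ∧ (∀ z : Fin N, (z : ℕ) = 0 → R z i) ∧ R n j ∧
    ∀ v, v < n → ∃ v' a b, IsSucc v v' ∧ R v a ∧ R v' b ∧ Q a b

/-- The string `x` describes an instance with `n` players, `m` vertices and the initial vertex
`st`. The relation `row` maps the vertices to the positions of their descriptions, and `obj` maps
the players to the positions of their objectives and `n` to that of the specification. -/
def Describes (x : List Sym) (n m st : Fin (x.length + 1)) (row obj : FinRel (x.length + 1)) :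
    Prop :=
  ∃ i₀ i₁ i₂ i₃ i₄ i₅ i₆ : Fin (x.length + 1), (i₀ : ℕ) = 0 ∧ NumAt x i₀ n i₁ ∧ NumAt x i₁ m i₂ ∧
    Chain (VertexAt x n m) row m i₂ i₃ ∧ NumAt x i₃ st i₄ ∧ st < m ∧
    Chain (FormulaAt x m) obj n i₄ i₅ ∧ FormulaAt x m i₅ i₆ ∧ (i₆ : ℕ) = x.length

section Game

variable (x : List Sym) (m st : Fin (x.length + 1)) (row obj : FinRel (x.length + 1))
  (X : FinRel (x.length + 1) → Prop) (p : Fin (x.length + 1)) (t t' s g : FinRel (x.length + 1))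

/-- The owner of the vertex `v` is `p`. -/
def OwnerAt (v : Fin (x.length + 1)) : Prop := ∃ a k, row v a ∧ NumAt x a p k

/-- There is an edge from `v` to `w`. -/
def EdgeAt (v w : Fin (x.length + 1)) : Prop :=
  ∃ a o k l, row v a ∧ NumAt x a o k ∧ IsAdd k w l ∧ x[(l : ℕ)]? = some .edge

/-- The relation `t` maps each vertex to a successor. -/
def MoveAt : Prop :=
  (∀ v w, t v w → v < m ∧ w < m ∧ EdgeAt x row v w) ∧ (∀ v, v < m → ∃ w, t v w) ∧
    ∀ v w w', t v w → t v w' → w = w'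

/-- The formula at position `i` is true for the vertices that `t` visits infinitely often. -/
def HoldsAt (i : Fin (x.length + 1)) : Prop :=
  ∃ θ : FinRel (x.length + 1), (∀ v, θ v v ↔ Recurs t st v) ∧ ∃ j, TrueAt x m θ i j

/-- The player `p` wins with `t`. -/
def WinsAt : Prop := ∃ i, obj p i ∧ HoldsAt x m st t i

/-- The relations `t` and `t'` agree on the vertices of `p`. -/
def AgreeAt : Prop := ∀ v, OwnerAt x row p v → ∀ w, t v w ↔ t' v w

/-- The relation `g` is `s` on the vertices of `p` and `t` elsewhere. -/
def DeviateAt : Prop :=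
  ∀ v w, g v w ↔ OwnerAt x row p v ∧ s v w ∨ ¬ OwnerAt x row p v ∧ t v w

/-- With respect to `X`, the strategy of `p` in `t` is dominated by the one in `s`. -/
def DominatesAt : Prop :=
  (∀ t' g, X t' → MoveAt x m row t' → AgreeAt x row p t' t → DeviateAt x row p t' s g →
    WinsAt x m st obj p t' → WinsAt x m st obj p g) ∧
  ∃ t' g, X t' ∧ MoveAt x m row t' ∧ AgreeAt x row p t' t ∧ DeviateAt x row p t' s g ∧
    ¬ WinsAt x m st obj p t' ∧ WinsAt x m st obj p g

/-- No strategy in a profile in `X` is dominated, and some profile in `X` violates the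
specification. -/
def ViolatesAt (n : Fin (x.length + 1)) : Prop :=
  (∀ t, X t → MoveAt x m row t → ∀ p, p < n →
    ¬ ∃ s, MoveAt x m row s ∧ DominatesAt x m st row obj X p t s) ∧
  ∃ t, X t ∧ MoveAt x m row t ∧ ∃ i, obj n i ∧ ¬ HoldsAt x m st t i

end Game

/-! ### Definability of the descriptions and the game predicates -/

namespace Definable

variable {n m : ℕ}

theorem isAdd (i j k : Fin n) :
    Definable (m := m) fun _ _ a _ => IsAdd (a i) (a j) (a k) := by
  refine Definable.congr ?_ fun x X a b => isAdd_iff.symm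
  exact allRel (((all ((isZero _).imp (bit _ _ _)))).imp ((all (all (all (all
    ((isSucc _ _).imp ((isSucc _ _).imp ((bit _ _ _).imp (bit _ _ _)))))))).imp (bit _ _ _)))

theorem numAt (i v j : Fin n) :
    Definable (m := m) fun x _ a _ => NumAt x (a i) (a v) (a j) := by
  refine Definable.congr ?_ fun x X a b => numAt_iff.symm
  exact ex ((isAdd _ _ _).and ((all ((le _ _).imp ((lt _ _).imp (letter _ _)))).and
    ((letter _ _).and (isSucc _ _))))

theorem respectsRules (i : Fin n) (θ T F : Fin m) :
    Definable fun x _ a b => RespectsRules x (a i) (b θ) (b T) (b F) :=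
  all (all (all ((isSucc _ _).imp
    (((letter _ _).imp ((eq _ _).imp (bit _ _ _))).and
    (((letter _ _).imp ((eq _ _).imp (bit _ _ _))).and
    (((letter _ _).imp (all ((lt _ _).imp ((numAt _ _ _).imp
      (((bit _ _ _).imp (bit _ _ _)).and ((bit _ _ _).not.imp (bit _ _ _))))))).and
    (((letter _ _).imp (((bit _ _ _).imp (bit _ _ _)).and ((bit _ _ _).imp (bit _ _ _)))).and
    (((letter _ _).imp (all
      (((bit _ _ _).imp ((bit _ _ _).imp (bit _ _ _))).and
      (((bit _ _ _).imp ((bit _ _ _).imp (bit _ _ _))).and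
      (((bit _ _ _).imp ((bit _ _ _).imp (bit _ _ _))).and
      ((bit _ _ _).imp ((bit _ _ _).imp (bit _ _ _)))))))).and
    ((letter _ _).imp (all
      (((bit _ _ _).imp ((bit _ _ _).imp (bit _ _ _))).and
      (((bit _ _ _).imp ((bit _ _ _).imp (bit _ _ _))).and
      (((bit _ _ _).imp ((bit _ _ _).imp (bit _ _ _))).and
      ((bit _ _ _).imp ((bit _ _ _).imp (bit _ _ _))))))))))))))))

theorem trueAt (k i j : Fin n) (θ : Fin m) :
    Definable fun x _ a b => TrueAt x (a k) (b θ) (a i) (a j) :=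
  allRel (allRel ((respectsRules _ _ _ _).imp (bit _ _ _)))

theorem falseAt (k i j : Fin n) (θ : Fin m) :
    Definable fun x _ a b => FalseAt x (a k) (b θ) (a i) (a j) :=
  allRel (allRel ((respectsRules _ _ _ _).imp (bit _ _ _)))

theorem formulaAt (k i j : Fin n) :
    Definable (m := m) fun x _ a _ => FormulaAt x (a k) (a i) (a j) :=
  exRel ((trueAt _ _ _ _).or (falseAt _ _ _ _))

theorem vertexAt (k l i j : Fin n) :
    Definable (m := m) fun x _ a _ => VertexAt x (a k) (a l) (a i) (a j) :=
  ex (ex ((lt _ _).and ((numAt _ _ _).and ((isAdd _ _ _).and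
    ((all ((le _ _).imp ((lt _ _).imp ((letter _ _).or (letter _ _))))).and
    (ex ((le _ _).and ((lt _ _).and (letter _ _)))))))))

theorem chain_vertexAt (k l i j : Fin n) (r : Fin m) :
    Definable fun x _ a b => Chain (VertexAt x (a k) (a l)) (b r) (a l) (a i) (a j) :=
  (all (all (all ((bit _ _ _).imp ((bit _ _ _).imp (eq _ _)))))).and
    ((all ((isZero _).imp (bit _ _ _))).and ((bit _ _ _).and
    (all ((lt _ _).imp (ex (ex (ex ((isSucc _ _).and ((bit _ _ _).and
    ((bit _ _ _).and (vertexAt _ _ _ _)))))))))))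

theorem chain_formulaAt (k l i j : Fin n) (r : Fin m) :
    Definable fun x _ a b => Chain (FormulaAt x (a k)) (b r) (a l) (a i) (a j) :=
  (all (all (all ((bit _ _ _).imp ((bit _ _ _).imp (eq _ _)))))).and
    ((all ((isZero _).imp (bit _ _ _))).and ((bit _ _ _).and
    (all ((lt _ _).imp (ex (ex (ex ((isSucc _ _).and ((bit _ _ _).and
    ((bit _ _ _).and (formulaAt _ _ _)))))))))))

theorem describes (k l s : Fin n) (row obj : Fin m) :
    Definable fun x _ a b => Describes x (a k) (a l) (a s) (b row) (b obj) :=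
  ex (ex (ex (ex (ex (ex (ex ((isZero _).and ((numAt _ _ _).and ((numAt _ _ _).and
    ((chain_vertexAt _ _ _ _ _).and ((numAt _ _ _).and ((lt _ _).and
    ((chain_formulaAt _ _ _ _ _).and ((formulaAt _ _ _).and (isLast _)))))))))))))))

theorem ownerAt (p v : Fin n) (row : Fin m) :
    Definable fun x _ a b => OwnerAt x (b row) (a p) (a v) :=
  ex (ex ((bit _ _ _).and (numAt _ _ _)))

theorem edgeAt (v w : Fin n) (row : Fin m) :
    Definable fun x _ a b => EdgeAt x (b row) (a v) (a w) :=
  ex (ex (ex (ex ((bit _ _ _).and ((numAt _ _ _).and ((isAdd _ _ _).and (letter _ _)))))))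

theorem moveAt (l : Fin n) (row t : Fin m) :
    Definable fun x _ a b => MoveAt x (a l) (b row) (b t) :=
  (all (all ((bit _ _ _).imp ((lt _ _).and ((lt _ _).and (edgeAt _ _ _)))))).and
    ((all ((lt _ _).imp (ex (bit _ _ _)))).and
    (all (all (all ((bit _ _ _).imp ((bit _ _ _).imp (eq _ _)))))))

theorem reach (u v : Fin n) (t : Fin m) : Definable fun _ _ a b => Reach (b t) (a u) (a v) :=
  allRel ((bit _ _ _).imp ((all (all ((bit _ _ _).imp ((bit _ _ _).imp (bit _ _ _))))).imp
    (bit _ _ _)))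

theorem recurs (u v : Fin n) (t : Fin m) : Definable fun _ _ a b => Recurs (b t) (a u) (a v) :=
  (reach _ _ _).and (ex ((bit _ _ _).and (reach _ _ _)))

theorem holdsAt (l s i : Fin n) (t : Fin m) :
    Definable fun x _ a b => HoldsAt x (a l) (a s) (b t) (a i) :=
  exRel ((all ((bit _ _ _).iff (recurs _ _ _))).and (ex (trueAt _ _ _ _)))

theorem winsAt (l s p : Fin n) (obj t : Fin m) :
    Definable fun x _ a b => WinsAt x (a l) (a s) (b obj) (a p) (b t) :=
  ex ((bit _ _ _).and (holdsAt _ _ _ _))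

theorem agreeAt (p : Fin n) (row t t' : Fin m) :
    Definable fun x _ a b => AgreeAt x (b row) (a p) (b t) (b t') :=
  all ((ownerAt _ _ _).imp (all ((bit _ _ _).iff (bit _ _ _))))

theorem deviateAt (p : Fin n) (row t s g : Fin m) :
    Definable fun x _ a b => DeviateAt x (b row) (a p) (b t) (b s) (b g) :=
  all (all ((bit _ _ _).iff (((ownerAt _ _ _).and (bit _ _ _)).or
    ((ownerAt _ _ _).not.and (bit _ _ _)))))

theorem dominatesAt (l u p : Fin n) (row obj t s : Fin m) :
    Definable fun x X a b => DominatesAt x (a l) (a u) (b row) (b obj) X (a p) (b t) (b s) :=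
  (allRel (allRel ((tab _).imp ((moveAt _ _ _).imp ((agreeAt _ _ _ _).imp
    ((deviateAt _ _ _ _ _).imp ((winsAt _ _ _ _ _).imp (winsAt _ _ _ _ _)))))))).and
  (exRel (exRel ((tab _).and ((moveAt _ _ _).and ((agreeAt _ _ _ _).and
    ((deviateAt _ _ _ _ _).and ((winsAt _ _ _ _ _).not.and (winsAt _ _ _ _ _))))))))

theorem violatesAt (k l u : Fin n) (row obj : Fin m) :
    Definable fun x X a b => ViolatesAt x (a l) (a u) (b row) (b obj) X (a k) :=
  (allRel ((tab _).imp ((moveAt _ _ _).imp (all ((lt _ _).imp (exRel ((moveAt _ _ _).and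
    (dominatesAt _ _ _ _ _ _ _))).not))))).and
  (exRel ((tab _).and ((moveAt _ _ _).and (ex ((bit _ _ _).and (holdsAt _ _ _ _).not)))))

/-- Strings that describe no instance belong to the complement too, whence the first disjunct. The
set `X` stays free, to be supplied by the guess. -/
theorem counterexample : Definable (n := 0) (m := 0) fun x X _ _ =>
    (¬ ∃ n m st row obj, Describes x n m st row obj) ∨
      ∃ n m st row obj, Describes x n m st row obj ∧ ViolatesAt x m st row obj X n :=
  ((ex (ex (ex (exRel (exRel (describes _ _ _ _ _)))))).not).or
    (ex (ex (ex (exRel (exRel ((describes _ _ _ _ _).and (violatesAt _ _ _ _ _)))))))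

end Definable

/-! ### Correctness of the description -/

section Chain

variable {x : List Sym} {Y : Type} {P : Y → List Sym} {Q : Fin (x.length + 1) →
  Fin (x.length + 1) → Prop} {n i j : Fin (x.length + 1)} {R : FinRel (x.length + 1)}

/-- The positions of a chain are the cut points of a concatenation: since `R` is functional, the
block found after each cut starts where the previous one ended. -/
theorem Chain.exists_seg (hQ : ∀ a b, Q a b ↔ ∃ y, Seg x a (P y) b) (h : Chain Q R n i j) :
    ∃ f : Fin n → Y, Seg x i (List.ofFn fun v => P (f v)).flatten j ∧
      ∀ v, ∃ a b : Fin (x.length + 1), R (toPos n v) a ∧ Seg x a (P (f v)) b := by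
  obtain ⟨h1, h2, h3, h4⟩ := h
  have key : ∀ v : Fin n, ∃ y, ∃ v' a b : Fin (x.length + 1), (v' : ℕ) = v + 1 ∧
      R (toPos n v) a ∧ R v' b ∧ Seg x a (P y) b := by
    intro v
    obtain ⟨v', a, b, hv, ha, hb, hab⟩ := h4 (toPos n v) (toPos_lt v)
    obtain ⟨y, hy⟩ := (hQ a b).1 hab
    exact ⟨y, v', a, b, hv, ha, hb, hy⟩
  choose f hf using key
  have step : ∀ (k : ℕ) (v a : Fin (x.length + 1)), (v : ℕ) = k → v ≤ n → R v a →
      Seg x i ((List.ofFn fun v => P (f v)).take k).flatten a := by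
    intro k
    induction k with
    | zero =>
      intro v a hv _ ha
      rw [h1 v a i ha (h2 v hv)]
      exact seg_nil.2 ⟨rfl, Nat.le_of_lt_succ i.2⟩
    | succ k ih =>
      intro v b hv hvn hb
      have hk : k < n := by rw [Fin.le_def] at hvn; omega
      obtain ⟨v', a, b', hv', ha, hb', hs⟩ := hf ⟨k, hk⟩
      obtain rfl : v' = v := Fin.ext (hv'.trans hv.symm)
      obtain rfl := h1 _ _ _ hb hb'
      have := ih (toPos n ⟨k, hk⟩) a rfl (toPos_lt _).le ha
      rw [List.take_add_one, List.flatten_append]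
      refine this.append ?_
      rw [List.getElem?_eq_getElem (by simpa using hk)]
      simpa using hs
  refine ⟨f, ?_, fun v => ?_⟩
  · have := step n n j rfl le_rfl h3
    rwa [List.take_of_length_le (by simp)] at this
  · obtain ⟨v', a, b, -, ha, -, hs⟩ := hf v
    exact ⟨a, b, ha, hs⟩

/-- The relation sends `v` to the position after the first `v` blocks. -/
theorem exists_chain (hQ : ∀ a b, Q a b ↔ ∃ y, Seg x a (P y) b) {f : Fin n → Y}
    (h : Seg x i (List.ofFn fun v => P (f v)).flatten j) : ∃ R, Chain Q R n i j := by
  have hex : ∀ k, ∃ a : Fin (x.length + 1),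
      Seg x i ((List.ofFn fun v => P (f v)).take k).flatten a := by
    intro k
    rw [← List.take_append_drop k (List.ofFn fun v => P (f v)), List.flatten_append,
      seg_append] at h
    obtain ⟨a, ha, -⟩ := h
    exact ⟨⟨a, Nat.lt_succ_of_le ha.2.1⟩, ha⟩
  refine ⟨fun v a => Seg x i ((List.ofFn fun v => P (f v)).take v).flatten a,
    fun v a b ha hb => Fin.ext (ha.right_unique hb), fun z hz => ?_, ?_, fun v hv => ?_⟩
  · dsimp only
    rw [hz]
    exact seg_nil.2 ⟨rfl, Nat.le_of_lt_succ i.2⟩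
  · dsimp only
    rwa [List.take_of_length_le (by simp)]
  · have hv : (v : ℕ) < n := hv
    obtain ⟨a, ha⟩ := hex v
    obtain ⟨b, hb⟩ := hex (v + 1)
    refine ⟨⟨v + 1, by have := n.2; omega⟩, a, b, rfl, ha, hb, (hQ a b).2 ⟨f ⟨v, hv⟩, ?_⟩⟩
    rw [List.take_add_one, List.flatten_append, seg_append] at hb
    obtain ⟨a', ha', hb⟩ := hb
    rw [ha.right_unique ha']
    rw [List.getElem?_eq_getElem (by simpa using hv)] at hb
    simpa using hb

end Chain

open Classical in
/-- The description of a vertex with the owner `o` and the set `r` of successors. -/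
noncomputable def encodeRow {m : ℕ} (o : ℕ) (r : Fin m → Prop) : List Sym :=
  encodeNum o ++ List.ofFn fun w => if r w then Sym.edge else Sym.nonEdge

section Describes

variable {x : List Sym} {n m st : Fin (x.length + 1)} {row obj : FinRel (x.length + 1)}

open Classical in
theorem seg_encodeRow {i o : ℕ} {j : Fin (x.length + 1)} {r : Fin m → Prop} :
    Seg x i (encodeRow o r) j ↔ ∃ k : Fin (x.length + 1), Seg x i (encodeNum o) k ∧
      IsAdd k m j ∧ ∀ w : Fin m, x[(k : ℕ) + w]? = some (if r w then .edge else .nonEdge) := by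
  rw [encodeRow, seg_append]
  constructor
  · rintro ⟨k, hk, h⟩
    rw [seg_iff_of_length_eq (d := m) (by simp)] at h
    exact ⟨⟨k, Nat.lt_succ_of_le hk.2.1⟩, hk, h.2.1, fun w => by simpa using h.2.2 w (by simp)⟩
  · rintro ⟨k, hk, h, h'⟩
    refine ⟨k, hk, (seg_iff_of_length_eq (d := m) (by simp)).2 ⟨hk.2.1, h, fun v hv => ?_⟩⟩
    simpa using h' ⟨v, by simpa using hv⟩

/-- The last clause of `VertexAt` accounts for the condition that every vertex has a successor,
which an arena carries as a proof. -/
theorem vertexAt_iff {i j : Fin (x.length + 1)} : VertexAt x n m i j ↔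
    ∃ y : {y : Fin n × (Fin m → Prop) // ∃ w, y.2 w}, Seg x i (encodeRow y.1.1 y.1.2) j := by
  classical
  constructor
  · rintro ⟨o, k, ho, hk, hj, hl, l, h1, h2, h3⟩
    have hj' : (j : ℕ) = k + m := hj
    refine ⟨⟨(⟨o, ho⟩, fun w => x[(k : ℕ) + w]? = some .edge), ⟨⟨l - k, ?_⟩, ?_⟩⟩,
      seg_encodeRow.2 ⟨k, hk, hj, fun w => ?_⟩⟩
    · rw [Fin.le_def] at h1
      rw [Fin.lt_def] at h2
      omega
    · rw [Fin.le_def] at h1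
      dsimp only
      rwa [Nat.add_sub_cancel' h1]
    · split
      · assumption
      · have := hl ⟨k + w, by have := j.2; omega⟩ (by rw [Fin.le_def]; dsimp only; omega)
          (by rw [Fin.lt_def]; dsimp only; omega)
        exact this.resolve_left ‹_›
  · rintro ⟨⟨⟨o, r⟩, w, hw⟩, h⟩
    obtain ⟨k, hk, hj, h⟩ := seg_encodeRow.1 h
    have hj' : (j : ℕ) = k + m := hj
    refine ⟨toPos n o, k, toPos_lt o, hk, hj, fun l hl hl' => ?_,
      ⟨k + w, by have := j.2; omega⟩, ?_, ?_, ?_⟩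
    · rw [Fin.le_def] at hl
      rw [Fin.lt_def] at hl'
      have := h ⟨l - k, by omega⟩
      dsimp only at this
      rw [Nat.add_sub_cancel' hl] at this
      rw [this]
      split <;> simp
    · rw [Fin.le_def]; dsimp only; omega
    · rw [Fin.lt_def]; dsimp only; omega
    · have := h w
      rwa [if_pos hw] at this

/-- The data refer to the game with the arena `G`, the objectives `o` and the specification `s`. -/
structure Represents (x : List Sym) (n m st : Fin (x.length + 1))
    (row obj : FinRel (x.length + 1)) (G : GameArena (Fin n) (Fin m))
    (o : Fin n → BoolFormula (Fin m)) (s : BoolFormula (Fin m)) : Prop where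
  start : st = toPos m G.start
  owner : ∀ p v, OwnerAt x row (toPos n p) (toPos m v) ↔ G.owner v = p
  edge : ∀ v w, EdgeAt x row (toPos m v) (toPos m w) ↔ G.edge v w
  obj_seg : ∀ p a, obj (toPos n p) a → ∃ b, Seg x a (encodeFormula (o p)) b
  obj_exists : ∀ p, ∃ a, obj (toPos n p) a
  spec_seg : ∀ a, obj n a → ∃ b, Seg x a (encodeFormula s) b
  spec_exists : ∃ a, obj n a

theorem Describes.exists_represents (h : Describes x n m st row obj) : ∃ G o s,
    (⟨n, m, G, o, s⟩ : GameInstance).encode = x ∧ Represents x n m st row obj G o s := by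
  classical
  obtain ⟨i₀, i₁, i₂, i₃, i₄, i₅, i₆, h0, h1, h2, h3, h4, h5, h6, h7, h8⟩ := h
  obtain ⟨f, hf, hf'⟩ := h3.exists_seg (P := fun y : {y : Fin n × (Fin m → Prop) // ∃ w, y.2 w} =>
    encodeRow y.1.1 y.1.2) fun a b => vertexAt_iff
  obtain ⟨o, ho, ho'⟩ := h6.exists_seg (P := fun φ : BoolFormula (Fin m) => encodeFormula φ)
    fun a b => formulaAt_iff
  obtain ⟨s, hs⟩ := formulaAt_iff.1 h7
  obtain ⟨st, rfl⟩ := exists_toPos h5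
  refine ⟨⟨fun v => (f v).1.1, st, fun v => (f v).1.2, fun v => (f v).2⟩, o, s, ?_, ?_⟩
  · rw [← seg_full]
    rw [NumAt, h0] at h1
    rw [h8] at hs
    exact ((((Seg.append h1 h2).append hf).append h4).append ho).append hs
  · have hrow : ∀ v a, row (toPos m v) a → ∃ b : Fin (x.length + 1),
        Seg x a (encodeRow (f v).1.1 (f v).1.2) b := by
      intro v a ha
      obtain ⟨a', b, ha', hb⟩ := hf' v
      rw [h3.1 _ _ _ ha ha']
      exact ⟨b, hb⟩
    -- The notation of numbers is prefix-free, so a row determines its owner and the start of its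
    -- adjacency part.
    have hnum : ∀ {a o k o' k' : Fin (x.length + 1)}, NumAt x a o k → NumAt x a o' k' →
        o = o' ∧ k = k' := by
      intro a o k o' k' h h'
      have := (GameInstance.encodeNum_append_inj (h.2.2.symm.trans h'.2.2)).1
      obtain rfl := Fin.ext this
      exact ⟨rfl, Fin.ext (h.right_unique h')⟩
    refine ⟨rfl, fun p v => ?_, fun v w => ?_, fun p a ha => ?_, fun p => ?_, fun a ha => ?_, _,
      h6.2.2.1⟩
    · constructor
      · rintro ⟨a, k, ha, hk⟩
        obtain ⟨b, hb⟩ := hrow v a ha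
        obtain ⟨k', hk', -⟩ := seg_encodeRow.1 hb
        exact toPos_injective (hnum (o := toPos n _) hk' hk).1
      · rintro rfl
        obtain ⟨a, b, ha, hb⟩ := hf' v
        obtain ⟨k, hk, -⟩ := seg_encodeRow.1 hb
        exact ⟨a, k, ha, hk⟩
    · constructor
      · rintro ⟨a, o, k, l, ha, hk, hl, he⟩
        obtain ⟨b, hb⟩ := hrow v a ha
        obtain ⟨k', hk', -, hw⟩ := seg_encodeRow.1 hb
        obtain ⟨-, rfl⟩ := hnum (o := toPos n _) hk' hk
        have hl : (l : ℕ) = k' + w := hl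
        rw [hl, hw] at he
        by_contra hne
        have hne : ¬ (f v).1.2 w := hne
        simp [hne] at he
      · intro he
        have he : (f v).1.2 w := he
        obtain ⟨a, b, ha, hb⟩ := hf' v
        obtain ⟨k, hk, hkb, hw⟩ := seg_encodeRow.1 hb
        have hkb : (b : ℕ) = k + m := hkb
        refine ⟨a, toPos n _, k, ⟨k + w, by have := b.2; omega⟩, ha, hk, rfl, ?_⟩
        have := hw w
        rwa [if_pos he] at this
    · obtain ⟨a', b, ha', hb⟩ := ho' p
      rw [h6.1 _ _ _ ha ha']
      exact ⟨b, hb⟩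
    · obtain ⟨a, -, ha, -⟩ := ho' p
      exact ⟨a, ha⟩
    · rw [h6.1 _ _ _ ha h6.2.2.1]
      exact ⟨_, hs⟩

end Describes

theorem GameInstance.exists_describes (I : GameInstance) : ∃ n m st row obj,
    Describes I.encode n m st row obj := by
  classical
  obtain ⟨n, m, G, o, s⟩ := I
  obtain ⟨x, hx⟩ : ∃ x, (⟨n, m, G, o, s⟩ : GameInstance).encode = x := ⟨_, rfl⟩
  rw [hx]
  have h := seg_full.2 hx
  simp only [encode, seg_append] at h
  obtain ⟨i₅, ⟨i₄, ⟨i₃, ⟨i₂, ⟨i₁, h1, h2⟩, h3⟩, h4⟩, h5⟩, h6⟩ := h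
  have lift : ∀ k, k ≤ x.length → ∃ k' : Fin (x.length + 1), (k' : ℕ) = k := fun k hk =>
    ⟨⟨k, Nat.lt_succ_of_le hk⟩, rfl⟩
  -- Unary notation bounds `n` and `m` by the length of the string, so they are positions themselves
  -- and can be quantified over.
  have hn := h1.eq_add
  have hm := h2.eq_add
  simp only [encodeNum, List.length_append, List.length_replicate, List.length_singleton] at hn hm
  obtain ⟨i₀, h0⟩ := lift 0 (Nat.zero_le _)
  obtain ⟨i₁, rfl⟩ := lift i₁ h1.2.1
  obtain ⟨i₂, rfl⟩ := lift i₂ h2.2.1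
  obtain ⟨i₃, rfl⟩ := lift i₃ h3.2.1
  obtain ⟨i₄, rfl⟩ := lift i₄ h4.2.1
  obtain ⟨i₅, rfl⟩ := lift i₅ h5.2.1
  obtain ⟨n, rfl⟩ := lift n (by have := i₁.2; omega)
  obtain ⟨m, rfl⟩ := lift m (by have := i₂.2; omega)
  obtain ⟨row, hrow⟩ := exists_chain (x := x) (Y := {y : Fin n × (Fin m → Prop) // ∃ w, y.2 w})
    (P := fun y => encodeRow y.1.1 y.1.2) (fun a b => vertexAt_iff)
    (f := fun v => ⟨(G.owner v, G.edge v), G.exists_edge v⟩) h3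
  obtain ⟨obj, hobj⟩ := exists_chain (x := x) (Y := BoolFormula (Fin m))
    (P := fun φ => encodeFormula φ) (fun a b => formulaAt_iff) h5
  refine ⟨n, m, toPos m G.start, row, obj, i₀, i₁, i₂, i₃, i₄, i₅, Fin.last _, h0, ?_, h2, hrow,
    h4, toPos_lt _, hobj, formulaAt_iff.2 ⟨s, h6⟩, rfl⟩
  rw [NumAt, h0]
  exact h1

/-! ### Correctness of the game predicates -/

namespace Represents

variable {x : List Sym} {n m st : Fin (x.length + 1)} {row obj : FinRel (x.length + 1)}
  {G : GameArena (Fin n) (Fin m)} {o : Fin n → BoolFormula (Fin m)} {φ : BoolFormula (Fin m)}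
  {X : FinRel (x.length + 1) → Prop} {p : Fin n} {f g s : Fin m → Fin m}
  {t : FinRel (x.length + 1)}

theorem moveAt_iff (h : Represents x n m st row obj G o φ) :
    MoveAt x m row t ↔ ∃ f, G.IsMove f ∧ t = graph (toPos m) f := by
  constructor
  · rintro ⟨h1, h2, h3⟩
    have key : ∀ v, ∃ w, t (toPos m v) (toPos m w) := fun v => by
      obtain ⟨w, hw⟩ := h2 _ (toPos_lt v)
      obtain ⟨w, rfl⟩ := exists_toPos (h1 _ _ hw).2.1
      exact ⟨w, hw⟩
    choose f hf using key
    refine ⟨f, fun v => (h.edge _ _).1 (h1 _ _ (hf v)).2.2, ?_⟩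
    funext a b
    refine propext ⟨fun hab => ?_, ?_⟩
    · obtain ⟨v, rfl⟩ := exists_toPos (h1 _ _ hab).1
      exact ⟨v, rfl, h3 _ _ _ hab (hf v)⟩
    · rintro ⟨v, rfl, rfl⟩
      exact hf v
  · rintro ⟨f, hf, rfl⟩
    refine ⟨?_, fun v hv => ?_, ?_⟩
    · rintro _ _ ⟨v, rfl, rfl⟩
      exact ⟨toPos_lt _, toPos_lt _, (h.edge _ _).2 (hf v)⟩
    · obtain ⟨v, rfl⟩ := exists_toPos hv
      exact ⟨_, v, rfl, rfl⟩
    · rintro _ _ _ ⟨v, rfl, rfl⟩ h'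
      exact ((graph_apply toPos_injective).1 h').symm

theorem holdsAt_iff (h : Represents x n m st row obj G o φ) {i : Fin (x.length + 1)} {j : ℕ}
    {ψ : BoolFormula (Fin m)} (hs : Seg x i (encodeFormula ψ) j) :
    HoldsAt x m st (graph (toPos m) f) i ↔ ψ.Holds (GameArena.infSet f G.start) := by
  have key : ∀ θ : FinRel (x.length + 1),
      (∀ v, θ v v ↔ Recurs (graph (toPos m) f) st v) →
        {v | θ (toPos m v) (toPos m v)} = GameArena.infSet f G.start := by
    intro θ hθ
    ext v
    rw [Set.mem_ofPred_eq, hθ, h.start, recurs_graph_iff toPos_injective]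
  constructor
  · rintro ⟨θ, hθ, j', hj⟩
    obtain ⟨χ, hχ, hχ'⟩ := trueAt_iff.1 hj
    rwa [← hs.formula_unique hχ, key θ hθ] at hχ'
  · intro hψ
    -- Only the diagonal of the assignment matters, so the second argument is ignored.
    refine ⟨fun v _ => Recurs (graph (toPos m) f) st v, fun v => Iff.rfl,
      ⟨j, Nat.lt_succ_of_le hs.2.1⟩, trueAt_iff.2 ⟨ψ, hs, ?_⟩⟩
    rwa [key _ fun v => Iff.rfl]

theorem winsAt_iff (h : Represents x n m st row obj G o φ) :
    WinsAt x m st obj (toPos n p) (graph (toPos m) f) ↔ G.Wins o p f := by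
  constructor
  · rintro ⟨i, hi, hw⟩
    obtain ⟨j, hj⟩ := h.obj_seg p i hi
    exact (h.holdsAt_iff hj).1 hw
  · intro hw
    obtain ⟨i, hi⟩ := h.obj_exists p
    obtain ⟨j, hj⟩ := h.obj_seg p i hi
    exact ⟨i, hi, (h.holdsAt_iff hj).2 hw⟩

theorem agreeAt_iff (h : Represents x n m st row obj G o φ) :
    AgreeAt x row (toPos n p) (graph (toPos m) g) (graph (toPos m) f) ↔
      ∀ v, G.owner v = p → g v = f v := by
  constructor
  · intro ha v hv
    have := (ha _ ((h.owner _ _).2 hv) (toPos m (g v))).1 ⟨v, rfl, rfl⟩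
    exact toPos_injective ((graph_apply toPos_injective).1 this)
  · intro ha v hv w
    constructor
    · rintro ⟨u, rfl, rfl⟩
      exact ⟨u, rfl, by rw [ha u ((h.owner _ _).1 hv)]⟩
    · rintro ⟨u, rfl, rfl⟩
      exact ⟨u, rfl, by rw [ha u ((h.owner _ _).1 hv)]⟩

theorem deviateAt_iff (h : Represents x n m st row obj G o φ) :
    DeviateAt x row (toPos n p) (graph (toPos m) f) (graph (toPos m) s) t ↔
      t = graph (toPos m) (G.deviate p f s) := by
  have key : ∀ v w, graph (toPos m) (G.deviate p f s) v w ↔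
      OwnerAt x row (toPos n p) v ∧ graph (toPos m) s v w ∨
        ¬ OwnerAt x row (toPos n p) v ∧ graph (toPos m) f v w := by
    intro v w
    constructor
    · rintro ⟨v, rfl, rfl⟩
      rw [h.owner, graph_apply toPos_injective, graph_apply toPos_injective]
      by_cases hv : G.owner v = p <;> simp [GameArena.deviate, hv]
    · rintro (⟨hv, u, rfl, rfl⟩ | ⟨hv, u, rfl, rfl⟩) <;> rw [h.owner] at hv <;>
        exact ⟨u, rfl, by simp [GameArena.deviate, hv]⟩
  constructor
  · intro ht
    funext v w
    exact propext ((ht v w).trans (key v w).symm)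
  · rintro rfl
    exact key

/-- The guessed set may contain relations that are no profiles; `MoveAt` filters them out, which
yields the set of functions on the right. -/
theorem dominatesAt_iff (h : Represents x n m st row obj G o φ) :
    DominatesAt x m st row obj X (toPos n p) (graph (toPos m) f) (graph (toPos m) s) ↔
      G.Dominates o {f | G.IsMove f ∧ X (graph (toPos m) f)} p f s := by
  refine and_congr ⟨fun hd g hg ha hw => ?_, ?_⟩ ⟨?_, ?_⟩
  · exact h.winsAt_iff.1 (hd _ _ hg.2 (h.moveAt_iff.2 ⟨g, hg.1, rfl⟩) (h.agreeAt_iff.2 ha)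
      (h.deviateAt_iff.2 rfl) (h.winsAt_iff.2 hw))
  · intro hd t' g' hX hm ha hd' hw
    obtain ⟨g, hg, rfl⟩ := h.moveAt_iff.1 hm
    obtain rfl := h.deviateAt_iff.1 hd'
    exact h.winsAt_iff.2 (hd g ⟨hg, hX⟩ (h.agreeAt_iff.1 ha) (h.winsAt_iff.1 hw))
  · rintro ⟨t', g', hX, hm, ha, hd', hw, hw'⟩
    obtain ⟨g, hg, rfl⟩ := h.moveAt_iff.1 hm
    obtain rfl := h.deviateAt_iff.1 hd'
    exact ⟨g, ⟨hg, hX⟩, h.agreeAt_iff.1 ha, fun hn => hw (h.winsAt_iff.2 hn), h.winsAt_iff.1 hw'⟩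
  · rintro ⟨g, hg, ha, hw, hw'⟩
    exact ⟨_, _, hg.2, h.moveAt_iff.2 ⟨g, hg.1, rfl⟩, h.agreeAt_iff.2 ha, h.deviateAt_iff.2 rfl,
      fun hn => hw (h.winsAt_iff.1 hn), h.winsAt_iff.2 hw'⟩

theorem violatesAt_iff (h : Represents x n m st row obj G o φ) : ViolatesAt x m st row obj X n ↔
    G.Undominated o {f | G.IsMove f ∧ X (graph (toPos m) f)} ∧
      ∃ f ∈ {f | G.IsMove f ∧ X (graph (toPos m) f)},
        ¬ φ.Holds (GameArena.infSet f G.start) := by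
  refine and_congr ⟨fun hd => ⟨fun f hf => hf.1, ?_⟩, ?_⟩ ⟨?_, ?_⟩
  · rintro f hf p ⟨s, hs, hs'⟩
    exact hd _ hf.2 (h.moveAt_iff.2 ⟨f, hf.1, rfl⟩) _ (toPos_lt p)
      ⟨_, h.moveAt_iff.2 ⟨s, hs, rfl⟩, h.dominatesAt_iff.2 hs'⟩
  · rintro ⟨-, hd⟩ t hX hm p hp ⟨s', hm', hs'⟩
    obtain ⟨f, hf, rfl⟩ := h.moveAt_iff.1 hm
    obtain ⟨s, hs, rfl⟩ := h.moveAt_iff.1 hm'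
    obtain ⟨p, rfl⟩ := exists_toPos hp
    exact hd f ⟨hf, hX⟩ p ⟨s, hs, h.dominatesAt_iff.1 hs'⟩
  · rintro ⟨t, hX, hm, i, hi, hn⟩
    obtain ⟨f, hf, rfl⟩ := h.moveAt_iff.1 hm
    obtain ⟨j, hj⟩ := h.spec_seg i hi
    exact ⟨f, ⟨hf, hX⟩, fun hφ => hn ((h.holdsAt_iff hj).2 hφ)⟩
  · rintro ⟨f, hf, hn⟩
    obtain ⟨i, hi⟩ := h.spec_exists
    obtain ⟨j, hj⟩ := h.spec_seg i hi
    exact ⟨_, hf.2, h.moveAt_iff.2 ⟨f, hf.1, rfl⟩, i, hi, fun hφ => hn ((h.holdsAt_iff hj).1 hφ)⟩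

/-- A set `Y` of profiles is passed to the logic as the set of its graphs, and is recovered from it
because a function is determined by its graph. -/
theorem exists_violatesAt_iff (h : Represents x n m st row obj G o φ) :
    (∃ X, ViolatesAt x m st row obj X n) ↔
      ¬ (⟨n, m, G, o, φ⟩ : GameInstance).SatisfiesVPCKRPos := by
  rw [GameInstance.not_satisfiesVPCKRPos_iff]
  constructor
  · rintro ⟨X, hX⟩
    exact ⟨_, h.violatesAt_iff.1 hX⟩
  · rintro ⟨Y, hY⟩
    refine ⟨fun R => ∃ f ∈ Y, graph (toPos m) f = R, h.violatesAt_iff.2 ?_⟩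
    have : {f | G.IsMove f ∧ ∃ f' ∈ Y, graph (toPos m) f' = graph (toPos m) f} = Y := by
      ext f
      simp only [(graph_injective (toPos_injective (m := m))).eq_iff, exists_eq_right]
      exact and_iff_right_of_imp (hY.1.1 f)
    rw [this]
    exact hY

end Represents

/-- Decoding a description gives some instance with the encoding `x`; injectivity of the encoding
identifies it with any instance that would witness membership. -/
theorem notMem_VPCKRPos_iff {x : List Sym} : x ∉ VPCKRPos ↔ ∃ X : FinRel (x.length + 1) → Prop,
    (¬ ∃ n m st row obj, Describes x n m st row obj) ∨
      ∃ n m st row obj, Describes x n m st row obj ∧ ViolatesAt x m st row obj X n := by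
  constructor
  · intro hx
    by_cases hd : ∃ n m st row obj, Describes x n m st row obj
    · obtain ⟨n, m, st, row, obj, hd⟩ := hd
      obtain ⟨G, o, s, he, hr⟩ := hd.exists_represents
      obtain ⟨X, hX⟩ := hr.exists_violatesAt_iff.2 fun hs => hx ⟨_, hs, he⟩
      exact ⟨X, .inr ⟨n, m, st, row, obj, hd, hX⟩⟩
    · exact ⟨fun _ => True, .inl hd⟩
  · rintro ⟨X, hd | ⟨n, m, st, row, obj, hd, hX⟩⟩ ⟨I, hI, he⟩
    · subst he
      exact hd I.exists_describes
    · obtain ⟨G, o, s, he', hr⟩ := hd.exists_represents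
      obtain rfl := GameInstance.encode_injective (he.trans he'.symm)
      exact hr.exists_violatesAt_iff.1 ⟨X, hX⟩ hI

theorem mainTheorem5 : VPCKRPos ∈ coNEXPNP GameInstance.Sym := by
  obtain ⟨φ, hφ⟩ := Definable.counterexample
  -- The empty oracle suffices, since the exponential search replaces all queries.
  refine ⟨Sym, ∅, empty_mem_NPClass Sym, Fml.mem_NEXPRel φ _ fun x => ?_⟩
  rw [Set.mem_compl_iff, notMem_VPCKRPos_iff]
  exact exists_congr fun X => (hφ x X Fin.elim0 Fin.elim0).symm
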